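/- There are a fixed random access machine program $P$ and a constant $c\in\mathbb N$ such that the following holds for every finite simple graph $G$ with $n$ vertices and $m$ edges. If $G$ has no induced subgraph isomorphic to $4K_1$ (four pairwise non-adjacent vertices), $C_4$ or $C_6$, and $G$ contains an induced cycle $C_7$, then $P$, started on any adjacency list representation of $G$ (with vertices numbered $0,\dots,n-1$ and each neighbor list in arbitrary order), outputs $\chi(G)$ together with a proper coloring of $G$ with colors $1,\dots,\chi(G)$, in at most $$\sqrt{13}^{\,2\cdot 13}\,(n+m)=13^{13}\,(n+m)\qquad (13^{13}\approx 3.03\cdot 10^{14})$$ steps. So Graph Coloring is solved on these graphs in time $\mathcal O(n+m)$. Here the machine has finitely many registers and a random access memory. One step is an addition, a truncated subtraction, a multiplication, a division rounded down, the loading of a constant into a register, an indirect read or write of the memory, a comparison of two registers, or a jump. All numbers that occur in the run are smaller than $(n+m+2)^c$, i.e. machine words have $\mathcal O(\log(n+m))$ bits. -/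

import Mathlib

/-! ### A word random access machine with unit-cost instructions -/

namespace RAM

/-- A configuration: numbered registers and a random access memory, both holding natural numbers.
(A program names only finitely many registers.) -/
structure State where
  reg : ℕ → ℕ
  mem : ℕ → ℕ

/-- Right-hand sides of assignments. Every `a`, `b` is the index of a register; only `load` reads
the memory, at the address that is held by the register `a` (indirect addressing). -/
inductive Expr where
  | const (k : ℕ)
  | add (a b : ℕ)
  | sub (a b : ℕ)
  | mul (a b : ℕ)
  | div (a b : ℕ)
  | load (a : ℕ)

/-- The value of a right-hand side: `sub` is truncated at `0`, `div` rounds down. -/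
def Expr.eval (σ : State) : Expr → ℕ
  | .const k => k
  | .add a b => σ.reg a + σ.reg b
  | .sub a b => σ.reg a - σ.reg b
  | .mul a b => σ.reg a * σ.reg b
  | .div a b => σ.reg a / σ.reg b
  | .load a => σ.mem (σ.reg a)

/-- Comparisons of two registers. -/
inductive Test where
  | lt (a b : ℕ)
  | eq (a b : ℕ)

/-- The outcome of a comparison. -/
def Test.holds (σ : State) : Test → Prop
  | .lt a b => σ.reg a < σ.reg b
  | .eq a b => σ.reg a = σ.reg b

/-- Programs. `assign r e` writes the value of `e` into register `r`; `store a b` writes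
register `b` into the memory cell whose address is held by register `a`. -/
inductive Program where
  | skip
  | assign (r : ℕ) (e : Expr)
  | store (a b : ℕ)
  | seq (p q : Program)
  | ite (c : Test) (p q : Program)
  | loop (c : Test) (p : Program)

/-- `Exec W p σ τ t`: started in the configuration `σ`, the program `p` halts in the configuration
`τ` after `t` steps, and every number that is computed on the way is smaller than `W`, that is,
fits into a machine word with `W` possible values.

An assignment and a store take one step. A conditional takes two steps besides the branch taken
and each passage through a loop takes two steps besides the body (test and jump); the last,
failing test of a loop takes one step. -/
inductive Exec (W : ℕ) : Program → State → State → ℕ → Prop where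
  | skip (σ : State) : Exec W .skip σ σ 0
  | assign (r : ℕ) (e : Expr) (σ : State) (h : e.eval σ < W) :
      Exec W (.assign r e) σ ⟨Function.update σ.reg r (e.eval σ), σ.mem⟩ 1
  | store (a b : ℕ) (σ : State) (h : σ.reg b < W) :
      Exec W (.store a b) σ ⟨σ.reg, Function.update σ.mem (σ.reg a) (σ.reg b)⟩ 1
  | seq {p q : Program} {σ τ υ : State} {s t : ℕ}
      (hp : Exec W p σ τ s) (hq : Exec W q τ υ t) : Exec W (.seq p q) σ υ (s + t)
  | iteTrue {c : Test} {p q : Program} {σ τ : State} {t : ℕ}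
      (hc : c.holds σ) (hp : Exec W p σ τ t) : Exec W (.ite c p q) σ τ (t + 2)
  | iteFalse {c : Test} {p q : Program} {σ τ : State} {t : ℕ}
      (hc : ¬ c.holds σ) (hq : Exec W q σ τ t) : Exec W (.ite c p q) σ τ (t + 2)
  | loopStop {c : Test} {p : Program} {σ : State}
      (hc : ¬ c.holds σ) : Exec W (.loop c p) σ σ 1
  | loopStep {c : Test} {p : Program} {σ τ υ : State} {s t : ℕ}
      (hc : c.holds σ) (hp : Exec W p σ τ s) (hl : Exec W (.loop c p) τ υ t) :
      Exec W (.loop c p) σ υ (s + 2 + t)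

end RAM

/-! ### Input and output of the graph coloring problem -/

/-- The memory content `M` is an adjacency list representation of the graph `G` on the vertices
`0, …, n - 1`: cell `0` holds `n`, cell `1` holds the number of edges, and the neighbors of the
vertex `v` are listed without repetition, in an arbitrary order, in the cells from address
`M (v + 2)` (inclusive) to address `M (v + 3)` (exclusive). The lists of the vertices follow each
other, the first one beginning at address `n + 3`, and all cells behind the last list hold `0`. -/
structure IsAdjListOf {n : ℕ} (G : SimpleGraph (Fin n)) (M : ℕ → ℕ) : Prop where
  order : M 0 = n
  size : M 1 = G.edgeSet.ncard
  first : M 2 = n + 3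
  next : ∀ v : Fin n, M (v + 3) = M (v + 2) + (G.neighborSet v).ncard
  sound : ∀ (v : Fin n) (a : ℕ), M (v + 2) ≤ a → a < M (v + 3) →
    ∃ u : Fin n, G.Adj v u ∧ M a = u
  complete : ∀ v u : Fin n, G.Adj v u → ∃ a : ℕ, M (v + 2) ≤ a ∧ a < M (v + 3) ∧ M a = u
  rest : ∀ a : ℕ, M (n + 2) ≤ a → M a = 0

/-- The memory content `M` presents an optimal coloring of `G`: cell `0` holds the chromatic number
`χ(G)`, and the cells `1, …, n` hold the colors of the vertices `0, …, n - 1`, which form a proper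
coloring with colors from `{1, …, χ(G)}`. -/
structure IsOptimalColoringOf {n : ℕ} (G : SimpleGraph (Fin n)) (M : ℕ → ℕ) : Prop where
  chromatic : G.chromaticNumber = (M 0 : ℕ∞)
  range : ∀ v : Fin n, 1 ≤ M (v + 1) ∧ M (v + 1) ≤ M 0
  proper : ∀ u v : Fin n, G.Adj u v → M (u + 1) ≠ M (v + 1)

/-- Started on the adjacency lists `M` with all registers `0`, and with machine words that hold the
numbers smaller than `W`, the program `P` halts within `T` steps with an optimal coloring of `G`
in its memory. -/
def ColorsWithin {n : ℕ} (P : RAM.Program) (G : SimpleGraph (Fin n)) (M : ℕ → ℕ) (W T : ℕ) : Prop :=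
  ∃ (τ : RAM.State) (t : ℕ), RAM.Exec W P ⟨fun _ => 0, M⟩ τ t ∧ t ≤ T ∧ IsOptimalColoringOf G τ.mem

/-! Fix an induced seven-cycle. Excluding `4K_1`, `C_4` and `C_6` leaves 22 possible closed traces
("types") of a vertex on it. The types of two distinct vertices determine whether they are adjacent,
and vertices of equal type are adjacent twins (`exists_typing`). So `G` is a blow-up of a graph on
types by cliques. Up to the dihedral symmetry of the cycle, the types that occur together lie in
`typesOne` or `typesTwo` (`exists_standard_typing`); hence there are at most 13 classes of twins
(`IsRepFamily.card_le`).

Coloring `G` thus means coloring at most 13 classes with multiplicities `w`. If every stable set has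
weight at most `r` for some weights `c`, then a coloring with `q` colors forces `∑ c i * w i ≤ r *
q`. The key fact is the converse: if these inequalities hold for all weights with entries up to 3,
then `q` colors suffice (`CountingBound.exists_colors`). For the two type graphs, 13 and 14 explicit
inequalities are enough (`typeColorable_typesOne`, `typeColorable_typesTwo`): a coloring is laid out
in intervals of colors, after a linear system has been solved in integers
(`exists_zone_distribution`). So `χ(G)` is the least `q` that satisfies `CountingBound`.

The algorithm needs neither the cycle nor the types. It computes the classes of twins and tests all
`4 ^ k ≤ 4 ^ 13` weight vectors with entries up to 3 against all triples of classes; triples suffice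
because stable sets have at most three vertices. This yields `q = χ(G)`. Then color classes are
peeled off. If the bound holds for `g + 1` colors, some stable triple can be removed such that it
holds for `g` (`CountingBound.exists_stableTriple`), and exhaustive search finds such a triple in
constant time. There are `q ≤ n` rounds, each of about `4 ^ 13 * 425100` steps, which is below `13 ^
13`.

The program is written in a small language of variables and arrays that is compiled to the machine;
`Runs` is a program logic with step budgets for it. The adjacency matrix takes linear time only,
since the memory behind the input is zero and just the nonzero entries are written. -/

/-! ### Distribution of colors along a path -/

theorem exists_int_between₄ {l₁ l₂ l₃ l₄ u₁ u₂ u₃ u₄ : ℤ}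
    (h : (l₁ ≤ u₁ ∧ l₁ ≤ u₂ ∧ l₁ ≤ u₃ ∧ l₁ ≤ u₄) ∧ (l₂ ≤ u₁ ∧ l₂ ≤ u₂ ∧ l₂ ≤ u₃ ∧ l₂ ≤ u₄) ∧
      (l₃ ≤ u₁ ∧ l₃ ≤ u₂ ∧ l₃ ≤ u₃ ∧ l₃ ≤ u₄) ∧ (l₄ ≤ u₁ ∧ l₄ ≤ u₂ ∧ l₄ ≤ u₃ ∧ l₄ ≤ u₄)) :
    ∃ x : ℤ, (l₁ ≤ x ∧ l₂ ≤ x ∧ l₃ ≤ x ∧ l₄ ≤ x) ∧ (x ≤ u₁ ∧ x ≤ u₂ ∧ x ≤ u₃ ∧ x ≤ u₄) := by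
  obtain ⟨⟨_, _, _, _⟩, ⟨_, _, _, _⟩, ⟨_, _, _, _⟩, _, _, _, _⟩ := h
  exact ⟨max (max l₁ l₂) (max l₃ l₄), by simp, by simp [*]⟩

/-- Distributing the demands `a₁, …, a₆` of a path over five zones of colors: a zone of size `r`
that serves the whole path, one of size `s` that serves the inner four vertices, and four zones
that serve the two ends of an edge each. -/
theorem exists_zone_distribution (a₁ a₂ a₃ a₄ a₅ a₆ s r e₁₂ e₃₄ e₄₅ e₅₆ : ℕ)
    (h₁ : a₁ ≤ r + e₁₂) (h₆ : a₆ ≤ r + e₅₆) (h₅₆ : a₅ + a₆ ≤ r + s + e₄₅ + e₅₆)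
    (h₁₂ : a₁ + a₂ ≤ r + s + e₁₂) (h₂₃ : a₂ + a₃ ≤ r + s + e₁₂ + e₃₄)
    (h₃₄ : a₃ + a₄ ≤ r + s + e₃₄ + e₄₅) (h₄₅ : a₄ + a₅ ≤ r + s + e₃₄ + e₄₅ + e₅₆)
    (h₄₆ : a₄ + a₅ + a₆ ≤ 2 * r + s + e₃₄ + e₄₅ + e₅₆)
    (h₁₃ : a₁ + a₂ + a₃ ≤ 2 * r + s + e₁₂ + e₃₄)
    (h₃ : a₃ ≤ r + s + e₃₄)
    (h₃₆ : a₃ + a₄ + a₅ + a₆ ≤ 2 * r + 2 * s + e₃₄ + e₄₅ + e₅₆)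
    (h₂₅ : a₂ + a₃ + a₄ + a₅ ≤ 2 * r + 2 * s + e₁₂ + e₃₄ + e₄₅ + e₅₆)
    (h₁₆ : a₁ + a₂ + a₃ + a₄ + a₅ + a₆ ≤ 3 * r + 2 * s + e₁₂ + e₃₄ + e₄₅ + e₅₆) :
    ∃ t₁ t₂ t₃ t₄ t₅ t₆ p₂ p₃ p₄ p₅ y₁ y₂ m₃ m₄ z₄ z₅ u₅ u₆ : ℕ,
      (a₁ ≤ t₁ + y₁ ∧ a₂ ≤ t₂ + p₂ + y₂ ∧ a₃ ≤ t₃ + p₃ + m₃ ∧ a₄ ≤ t₄ + p₄ + m₄ + z₄ ∧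
        a₅ ≤ t₅ + p₅ + z₅ + u₅ ∧ a₆ ≤ t₆ + u₆) ∧
      (t₁ + t₂ ≤ r ∧ t₂ + t₃ ≤ r ∧ t₃ + t₄ ≤ r ∧ t₄ + t₅ ≤ r ∧ t₅ + t₆ ≤ r) ∧
      (p₂ + p₃ ≤ s ∧ p₃ + p₄ ≤ s ∧ p₄ + p₅ ≤ s) ∧
      y₁ + y₂ ≤ e₁₂ ∧ m₃ + m₄ ≤ e₃₄ ∧ z₄ + z₅ ≤ e₄₅ ∧ u₅ + u₆ ≤ e₅₆ := by
  -- Fourier–Motzkin elimination run backwards: `p`, `m`, `z`, `g`, `t` become `p₃`, `m₃`, `z₅`,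
  -- `p₄`, `t₄`. Each is taken between the bounds that keep the later choices possible; repeated
  -- bounds only fill up the four slots. Integers suffice because all coefficients are `±1`.
  obtain ⟨p, hpl, hpu⟩ : ∃ p : ℤ,
      (0 ≤ p ∧ (a₃ : ℤ) + a₄ + a₅ + a₆ - 2 * r - s - e₃₄ - e₄₅ - e₅₆ ≤ p ∧
        (a₃ : ℤ) - r - e₃₄ ≤ p ∧ (a₃ : ℤ) + a₄ + a₅ - 2 * r - s - e₃₄ - e₄₅ - e₅₆ ≤ p) ∧
      (p ≤ s ∧ p ≤ (r : ℤ) + s + e₁₂ - a₁ - a₂ ∧ p ≤ a₃ ∧ p ≤ (r : ℤ) + s + e₁₂ - a₂) :=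
    exists_int_between₄ (by omega)
  obtain ⟨m, hml, hmu⟩ : ∃ m : ℤ,
      (0 ≤ m ∧ (a₂ : ℤ) + a₃ - r - s - e₁₂ ≤ m ∧ (a₃ : ℤ) - r - p ≤ m ∧ 0 ≤ m) ∧
      (m ≤ e₃₄ ∧ m ≤ (r : ℤ) + s + e₃₄ + e₄₅ + e₅₆ - a₄ - a₅ ∧ m ≤ a₃ - p ∧ m ≤ e₃₄) :=
    exists_int_between₄ (by omega)
  obtain ⟨z, hzl, hzu⟩ : ∃ z : ℤ,
      (0 ≤ z ∧ (a₅ : ℤ) - e₅₆ - r - s ≤ z ∧ (a₅ : ℤ) + a₆ - r - e₅₆ - s ≤ z ∧ 0 ≤ z) ∧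
      (z ≤ e₄₅ ∧ z ≤ (r : ℤ) + s - a₃ + m - a₄ + e₄₅ + e₃₄ - m ∧ z ≤ e₄₅ ∧ z ≤ e₄₅) :=
    exists_int_between₄ (by omega)
  obtain ⟨g, hgl, hgu⟩ : ∃ g : ℤ,
      (0 ≤ g ∧ (a₄ : ℤ) - e₄₅ - e₃₄ + z + m - (r - (a₃ - m - p)) ≤ g ∧ 0 ≤ g ∧ 0 ≤ g) ∧
      (g ≤ s - p ∧ g ≤ s + z - (a₅ + a₆ - r - e₅₆) ∧ g ≤ s ∧
        g ≤ r + s + z - (a₅ - e₅₆)) :=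
    exists_int_between₄ (by omega)
  obtain ⟨t, htl, htu⟩ : ∃ t : ℤ,
      (0 ≤ t ∧ (a₄ : ℤ) - e₄₅ - e₃₄ + z + m - g ≤ t ∧ 0 ≤ t ∧ 0 ≤ t) ∧
      (t ≤ r - (a₃ - m - p) ∧ t ≤ r + s + z - (a₅ - e₅₆) - g ∧ t ≤ r ∧ t ≤ r) :=
    exists_int_between₄ (by omega)
  lift p to ℕ using hpl.1
  lift m to ℕ using hml.1
  lift z to ℕ using hzl.1
  lift g to ℕ using hgl.1
  lift t to ℕ using htl.1
  obtain ⟨t₃, ht₃⟩ : ∃ t₃ : ℕ, (t₃ : ℤ) = a₃ - m - p := ⟨a₃ - m - p, by omega⟩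
  -- As `t₂` will be `r - t₁`, the constraint with vertex 3 asks for `t₁ ≥ t₃`, and the rest of `a₁`
  -- must fit into `e₁₂`. The choice of `t₆` is symmetric.
  obtain ⟨t₁, ht₁⟩ : ∃ t₁ : ℕ, t₁ = max t₃ (a₁ - e₁₂) := ⟨_, rfl⟩
  obtain ⟨t₆, ht₆⟩ : ∃ t₆ : ℕ, t₆ = max t (a₆ - e₅₆) := ⟨_, rfl⟩
  refine ⟨t₁, r - t₁, t₃, t, r - t₆, t₆, s - p, p, g, s - g, a₁ - t₁, e₁₂ - (a₁ - t₁), m, e₃₄ - m,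
    e₄₅ - z, z, e₅₆ - (a₆ - t₆), a₆ - t₆, ?_⟩
  clear h₁₆ h₂₅ h₃₆ h₁₃ h₄₆ h₃₄ h₄₅ h₅₆ h₂₃
  refine ⟨⟨?_, ?_, ?_, ?_, ?_, ?_⟩, ⟨?_, ?_, ?_, ?_, ?_⟩, ⟨?_, ?_, ?_⟩, ?_, ?_, ?_, ?_⟩ <;> omega

/-! ### Types of vertices relative to an induced cycle of length seven -/

/-- The position `j` belongs to the closed trace of the type `τ`. The types `i`, `7 + i`, `14 + i`
with `i < 7` have the closed traces `{i - 1, i, i + 1}`, `{i, i + 3, i + 4}` and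
`{i - 2, …, i + 2}`, and the type `21` has all positions in its trace. -/
def typeTrace (τ j : ℕ) : Bool :=
  if τ < 7 then (j + 7 - τ) % 7 ∈ [0, 1, 6]
  else if τ < 14 then (j + 14 - τ) % 7 ∈ [0, 3, 4]
  else if τ < 21 then (j + 21 - τ) % 7 ∈ [0, 1, 2, 5, 6]
  else τ = 21

/-- Distinct vertices of the types `τ` and `σ` are adjacent. The number `22` stands for a dummy
type without neighbors. -/
def typeAdj (τ σ : ℕ) : Bool :=
  if τ < 7 then typeTrace σ τ
  else if σ < 7 then typeTrace τ σ
  else if τ < 14 then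
    if σ < 14 then (σ + 7 - τ) % 7 ∈ [0, 3, 4]
    else if σ < 21 then (σ + 7 - τ) % 7 ∉ [0, 3, 4]
    else σ = 21
  else if σ < 14 then
    if τ < 21 then (τ + 7 - σ) % 7 ∉ [0, 3, 4] else τ = 21
  else τ ≤ 21 ∧ σ ≤ 21

/-- The first maximal set of types that can occur together, up to symmetry. -/
def typesOne : List ℕ := [0, 1, 2, 3, 4, 5, 6, 7, 10, 15, 16, 19, 21]

/-- The second maximal set of types that can occur together, up to symmetry. -/
def typesTwo : List ℕ := [0, 1, 2, 3, 4, 5, 6, 7, 14, 15, 21]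

/-- Weights of types together with a bound for the weight of a stable set. -/
def facetsOne : List (ℕ × List ℕ) :=
  [(1, [1, 1, 0, 0, 0, 0, 0, 0, 0, 0, 0, 0, 0, 0, 0, 1, 1, 0, 0, 0, 0, 1]),
   (1, [0, 1, 1, 0, 0, 0, 0, 0, 0, 0, 0, 0, 0, 0, 0, 1, 1, 0, 0, 0, 0, 1]),
   (1, [0, 0, 1, 1, 0, 0, 0, 0, 0, 0, 0, 0, 0, 0, 0, 1, 1, 0, 0, 0, 0, 1]),
   (1, [0, 0, 0, 0, 1, 1, 0, 0, 0, 0, 0, 0, 0, 0, 0, 0, 0, 0, 0, 1, 0, 1]),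
   (1, [0, 0, 0, 0, 0, 1, 1, 0, 0, 0, 0, 0, 0, 0, 0, 0, 0, 0, 0, 1, 0, 1]),
   (1, [1, 0, 0, 0, 0, 0, 1, 0, 0, 0, 1, 0, 0, 0, 0, 1, 0, 0, 0, 1, 0, 1]),
   (1, [0, 0, 0, 1, 1, 0, 0, 1, 0, 0, 0, 0, 0, 0, 0, 0, 1, 0, 0, 1, 0, 1]),
   (1, [1, 0, 0, 0, 0, 0, 0, 1, 0, 0, 1, 0, 0, 0, 0, 1, 1, 0, 0, 1, 0, 1]),
   (1, [0, 0, 0, 1, 0, 0, 0, 1, 0, 0, 1, 0, 0, 0, 0, 1, 1, 0, 0, 1, 0, 1]),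
   (2, [1, 1, 1, 1, 0, 0, 0, 1, 0, 0, 1, 0, 0, 0, 0, 2, 2, 0, 0, 1, 0, 2]),
   (2, [1, 0, 0, 0, 1, 1, 1, 1, 0, 0, 1, 0, 0, 0, 0, 1, 1, 0, 0, 2, 0, 2]),
   (2, [0, 0, 0, 1, 1, 1, 1, 1, 0, 0, 1, 0, 0, 0, 0, 1, 1, 0, 0, 2, 0, 2]),
   (3, [1, 1, 1, 1, 1, 1, 1, 1, 0, 0, 1, 0, 0, 0, 0, 2, 2, 0, 0, 2, 0, 3])]

/-- Weights of types for the second family, together with bounds for the weight of a stable set. -/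
def facetsTwo : List (ℕ × List ℕ) :=
  [(1, [0, 0, 0, 0, 1, 1, 0, 0, 0, 0, 0, 0, 0, 0, 0, 0, 0, 0, 0, 0, 0, 1]),
   (1, [0, 0, 0, 1, 1, 0, 0, 1, 0, 0, 0, 0, 0, 0, 0, 0, 0, 0, 0, 0, 0, 1]),
   (1, [0, 0, 0, 0, 0, 1, 1, 0, 0, 0, 0, 0, 0, 0, 1, 0, 0, 0, 0, 0, 0, 1]),
   (1, [0, 0, 1, 1, 0, 0, 0, 0, 0, 0, 0, 0, 0, 0, 0, 1, 0, 0, 0, 0, 0, 1]),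
   (1, [1, 0, 0, 0, 0, 0, 0, 1, 0, 0, 0, 0, 0, 0, 0, 1, 0, 0, 0, 0, 0, 1]),
   (1, [0, 0, 0, 1, 0, 0, 0, 1, 0, 0, 0, 0, 0, 0, 0, 1, 0, 0, 0, 0, 0, 1]),
   (1, [1, 1, 0, 0, 0, 0, 0, 0, 0, 0, 0, 0, 0, 0, 1, 1, 0, 0, 0, 0, 0, 1]),
   (1, [0, 1, 1, 0, 0, 0, 0, 0, 0, 0, 0, 0, 0, 0, 1, 1, 0, 0, 0, 0, 0, 1]),
   (1, [1, 0, 0, 0, 0, 0, 1, 0, 0, 0, 0, 0, 0, 0, 1, 1, 0, 0, 0, 0, 0, 1]),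
   (2, [0, 0, 1, 1, 1, 1, 0, 0, 0, 0, 0, 0, 0, 0, 1, 1, 0, 0, 0, 0, 0, 2]),
   (2, [1, 0, 0, 0, 1, 1, 1, 1, 0, 0, 0, 0, 0, 0, 1, 1, 0, 0, 0, 0, 0, 2]),
   (2, [0, 0, 0, 1, 1, 1, 1, 1, 0, 0, 0, 0, 0, 0, 1, 1, 0, 0, 0, 0, 0, 2]),
   (2, [1, 1, 1, 1, 0, 0, 0, 1, 0, 0, 0, 0, 0, 0, 1, 2, 0, 0, 0, 0, 0, 2]),
   (3, [1, 1, 1, 1, 1, 1, 1, 1, 0, 0, 0, 0, 0, 0, 2, 2, 0, 0, 0, 0, 0, 3])]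

/-- No stable set of types from `L` has a weight that exceeds the bound of the facet. -/
def facetValid (L : List ℕ) (p : ℕ × List ℕ) : Bool :=
  (22 :: L).all fun a => (22 :: L).all fun b => typeAdj a b || (22 :: L).all fun e =>
    typeAdj a e || typeAdj b e || decide (p.2.getD a 0 + p.2.getD b 0 + p.2.getD e 0 ≤ p.1)

/-- This makes the facets admissible weights in `CountingBound`. Triples cover all stable sets that
matter, since smaller ones are filled up with the dummy type. -/
theorem facetsOne_valid : facetsOne.all (facetValid typesOne) = true := by decide +kernel

theorem facetsTwo_valid : facetsTwo.all (facetValid typesTwo) = true := by decide +kernel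

/-! ### Integral weighted colorings of the two type graphs -/

/-- The union of four intervals. -/
def fourIco (l₁ u₁ l₂ u₂ l₃ u₃ l₄ u₄ : ℕ) : Finset ℕ :=
  Finset.Ico l₁ u₁ ∪ (Finset.Ico l₂ u₂ ∪ (Finset.Ico l₃ u₃ ∪ Finset.Ico l₄ u₄))

theorem mem_fourIco {l₁ u₁ l₂ u₂ l₃ u₃ l₄ u₄ x : ℕ} :
    x ∈ fourIco l₁ u₁ l₂ u₂ l₃ u₃ l₄ u₄ ↔
      (l₁ ≤ x ∧ x < u₁) ∨ (l₂ ≤ x ∧ x < u₂) ∨ (l₃ ≤ x ∧ x < u₃) ∨ (l₄ ≤ x ∧ x < u₄) := by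
  simp [fourIco]

theorem card_fourIco {l₁ u₁ l₂ u₂ l₃ u₃ l₄ u₄ : ℕ} (h₁ : u₁ ≤ l₂) (h₂ : l₂ ≤ u₂) (h₃ : u₂ ≤ l₃)
    (h₄ : l₃ ≤ u₃) (h₅ : u₃ ≤ l₄) :
    (fourIco l₁ u₁ l₂ u₂ l₃ u₃ l₄ u₄).card = (u₁ - l₁) + (u₂ - l₂) + (u₃ - l₃) + (u₄ - l₄) := by
  unfold fourIco
  rw [Finset.card_union_of_disjoint, Finset.card_union_of_disjoint, Finset.card_union_of_disjoint]
  · simp only [Nat.card_Ico]; omega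
  all_goals
    rw [Finset.disjoint_left]; intro x hx; simp at hx ⊢; omega

/-- Distinct adjacent types of `L` get disjoint sets of at least `w τ` of the colors below `q`. -/
def TypeColorable (L : List ℕ) (w : ℕ → ℕ) (q : ℕ) : Prop :=
  ∃ X : ℕ → Finset ℕ, (∀ τ ∈ L, X τ ⊆ Finset.range q ∧ w τ ≤ (X τ).card) ∧
    ∀ τ ∈ L, ∀ σ ∈ L, τ ≠ σ → typeAdj τ σ = true → Disjoint (X τ) (X σ)

theorem typeColorable_of_lt {L : List ℕ} {w : ℕ → ℕ} {q : ℕ}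
    (hsymm : ∀ τ ∈ L, ∀ σ ∈ L, typeAdj τ σ = typeAdj σ τ)
    (X : ℕ → Finset ℕ) (h : ∀ τ ∈ L, X τ ⊆ Finset.range q ∧ w τ ≤ (X τ).card)
    (hd : ∀ τ ∈ L, ∀ σ ∈ L, τ < σ → typeAdj τ σ = true → Disjoint (X τ) (X σ)) :
    TypeColorable L w q := by
  refine ⟨X, h, fun τ hτ σ hσ hne ha => ?_⟩
  rcases lt_or_gt_of_ne hne with hlt | hlt
  · exact hd τ hτ σ hσ hlt ha
  · exact (hd σ hσ τ hτ hlt (by rw [hsymm σ hσ τ hτ]; exact ha)).symm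

/-- The types `0, 7, 10, 15, 16, 19, 21` form a clique and receive disjoint intervals of colors.
What remains is the path `1, …, 6`, which may use the `r` free colors and reuse the color of a
clique type on path vertices that are not adjacent to it. -/
theorem typeColorable_typesOne (w : ℕ → ℕ) (q : ℕ)
    (H : ∀ p ∈ facetsOne, (typesOne.map fun τ => p.2.getD τ 0 * w τ).sum ≤ p.1 * q) :
    TypeColorable typesOne w q := by
  simp only [facetsOne, typesOne, List.forall_mem_cons, List.map_cons, List.map_nil, List.sum_cons,
    List.sum_nil, List.getD_cons_zero, List.getD_cons_succ, Nat.zero_mul, Nat.one_mul,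
    Nat.zero_add, Nat.add_zero] at H
  -- The facet of the clique shows that `r` is not negative.
  obtain ⟨r, hr⟩ : ∃ r, r + w 0 + w 7 + w 10 + w 15 + w 16 + w 19 + w 21 = q :=
    ⟨q - (w 0 + w 7 + w 10 + w 15 + w 16 + w 19 + w 21), by omega⟩
  -- Type `0` misses `2, 3, 4, 5`; type `7` misses `1, 2, 5, 6`; type `10` misses `1, 2, 4, 5`;
  -- types `15`, `16`, `19` miss `4, 5`, `5, 6` and `1, 2`. The weights of `7` and `10` count in two
  -- zones, which is harmless: the two path edges that share them have no edge in between.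
  obtain ⟨t₁, t₂, t₃, t₄, t₅, t₆, p₂, p₃, p₄, p₅, y₁, y₂, m₃, m₄, z₄, z₅, u₅, u₆, hdem, hzone⟩ := exists_zone_distribution (w 1) (w 2) (w 3) (w 4)
    (w 5) (w 6) (w 0) r (w 7 + w 10 + w 19) 0 (w 10 + w 15) (w 7 + w 16) (by omega) (by omega)
    (by omega) (by omega) (by omega) (by omega) (by omega) (by omega) (by omega) (by omega)
    (by omega) (by omega) (by omega)
  -- The clique types are put in the order `0, 16, 7, 19, 10, 15`, so that every zone, also the
  -- overlapping ones, is a single interval.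
  obtain ⟨o, ho⟩ : ∃ o : ℕ → ℕ, o 1 = w 0 ∧ o 2 = o 1 + w 16 ∧ o 3 = o 2 + w 7 ∧
      o 4 = o 3 + w 19 ∧ o 5 = o 4 + w 10 ∧ o 6 = o 5 + w 15 ∧ o 7 = o 6 + r :=
    ⟨fun i => match i with
      | 1 => w 0
      | 2 => w 0 + w 16
      | 3 => w 0 + w 16 + w 7
      | 4 => w 0 + w 16 + w 7 + w 19
      | 5 => w 0 + w 16 + w 7 + w 19 + w 10
      | 6 => w 0 + w 16 + w 7 + w 19 + w 10 + w 15
      | _ => w 0 + w 16 + w 7 + w 19 + w 10 + w 15 + r, rfl, rfl, rfl, rfl, rfl, rfl, rfl⟩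
  generalize o 1 = o₁, o 2 = o₂, o 3 = o₃, o 4 = o₄, o 5 = o₅, o 6 = o₆, o 7 = o₇ at ho
  obtain ⟨_, _, _, _, _, _, _⟩ := ho
  -- Consecutive path vertices take their colors from opposite ends of a common zone, so they are
  -- disjoint as soon as their shares fit into the zone.
  let X : ℕ → Finset ℕ := fun τ => match τ with
    | 0 => fourIco 0 0 0 0 0 0 0 o₁
    | 1 => fourIco 0 0 0 0 o₂ (o₂ + y₁) o₆ (o₆ + t₁)
    | 2 => fourIco 0 0 0 p₂ (o₅ - y₂) o₅ (o₇ - t₂) o₇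
    | 3 => fourIco 0 0 0 0 (o₁ - p₃) o₁ o₆ (o₆ + t₃)
    | 4 => fourIco 0 0 0 p₄ o₄ (o₄ + z₄) (o₇ - t₄) o₇
    | 5 => fourIco (o₁ - p₅) o₁ o₁ (o₁ + u₅) (o₆ - z₅) o₆ o₆ (o₆ + t₅)
    | 6 => fourIco 0 0 0 0 (o₃ - u₆) o₃ (o₇ - t₆) o₇
    | 7 => fourIco 0 0 0 0 0 0 o₂ o₃
    | 10 => fourIco 0 0 0 0 0 0 o₄ o₅
    | 15 => fourIco 0 0 0 0 0 0 o₅ o₆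
    | 16 => fourIco 0 0 0 0 0 0 o₁ o₂
    | 19 => fourIco 0 0 0 0 0 0 o₃ o₄
    | _ => fourIco 0 0 0 0 0 0 o₇ q
  clear H
  refine typeColorable_of_lt (by decide) X ?_ ?_
  · simp only [typesOne, List.forall_mem_cons, X]
    refine ⟨?_, ?_, ?_, ?_, ?_, ?_, ?_, ?_, ?_, ?_, ?_, ?_, ?_, List.forall_mem_nil _⟩ <;> refine ⟨fun x hx => ?_, ?_⟩
    all_goals first
      | (rw [mem_fourIco] at hx
         rw [Finset.mem_range]
         omega)
      | (rw [card_fourIco] <;> omega)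
  · simp only [Finset.disjoint_left]
    simp +decide only [typesOne, List.forall_mem_cons, X, mem_fourIco, forall_const, false_imp_iff,
      List.not_mem_nil, imp_true_iff, and_true, true_and, Nat.not_lt_zero, and_false, false_or,
      zero_le]
    clear hdem
    and_intros <;> intro x hx <;> omega

/-- As before, except that `7` and `14` are not adjacent, so that `0, 7, 14, 15, 21` is not a
clique: `7` and `14` share colors when there are too few. -/
theorem typeColorable_typesTwo (w : ℕ → ℕ) (q : ℕ)
    (H : ∀ p ∈ facetsTwo, (typesTwo.map fun τ => p.2.getD τ 0 * w τ).sum ≤ p.1 * q) :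
    TypeColorable typesTwo w q := by
  simp only [facetsTwo, typesTwo, List.forall_mem_cons, List.map_cons, List.map_nil, List.sum_cons,
    List.sum_nil, List.getD_cons_zero, List.getD_cons_succ, Nat.zero_mul, Nat.one_mul,
    Nat.zero_add, Nat.add_zero] at H
  -- `x` is the number of colors shared by `7` and `14`, taken as small as possible; either nothing
  -- is shared or no color is free. A shared color is useless for the path, whose vertices are all
  -- adjacent to `7` or to `14`, so only `e` and `f` enter the zones.
  obtain ⟨x, r, e, f, hr, he, hf, hxr⟩ : ∃ x r e f, r + w 0 + w 7 + w 14 + w 15 + w 21 = q + x ∧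
      e + x = w 7 ∧ f + x = w 14 ∧ (x = 0 ∨ r = 0) := by
    refine ⟨w 0 + w 7 + w 14 + w 15 + w 21 - q, q - (w 0 + w 7 + w 14 + w 15 + w 21),
      w 7 - (w 0 + w 7 + w 14 + w 15 + w 21 - q), w 14 - (w 0 + w 7 + w 14 + w 15 + w 21 - q), ?_⟩
    omega
  obtain ⟨t₁, t₂, t₃, t₄, t₅, t₆, p₂, p₃, p₄, p₅, y₁, y₂, m₃, m₄, z₄, z₅, u₅, u₆, hdem, hzone⟩ := exists_zone_distribution (w 1) (w 2) (w 3) (w 4)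
    (w 5) (w 6) (w 0) r e f (w 15) e (by omega) (by omega)
    (by omega) (by omega) (by omega) (by omega) (by omega) (by omega) (by omega) (by omega)
    (by omega) (by omega) (by omega)
  obtain ⟨o, ho⟩ : ∃ o : ℕ → ℕ, o 1 = w 0 ∧ o 2 = o 1 + f ∧ o 3 = o 2 + x ∧
      o 4 = o 3 + e ∧ o 5 = o 4 + w 15 ∧ o 6 = o 5 + r :=
    ⟨fun i => match i with
      | 1 => w 0
      | 2 => w 0 + f
      | 3 => w 0 + f + x
      | 4 => w 0 + f + x + e
      | 5 => w 0 + f + x + e + w 15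
      | _ => w 0 + f + x + e + w 15 + r, rfl, rfl, rfl, rfl, rfl, rfl⟩
  generalize o 1 = o₁, o 2 = o₂, o 3 = o₃, o 4 = o₄, o 5 = o₅, o 6 = o₆ at ho
  obtain ⟨_, _, _, _, _, _⟩ := ho
  let X : ℕ → Finset ℕ := fun τ => match τ with
    | 0 => fourIco 0 0 0 0 0 0 0 o₁
    | 1 => fourIco 0 0 0 0 o₃ (o₃ + y₁) o₅ (o₅ + t₁)
    | 2 => fourIco 0 0 0 p₂ (o₄ - y₂) o₄ (o₆ - t₂) o₆
    | 3 => fourIco 0 0 (o₁ - p₃) o₁ o₁ (o₁ + m₃) o₅ (o₅ + t₃)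
    | 4 => fourIco 0 p₄ (o₂ - m₄) o₂ o₄ (o₄ + z₄) (o₆ - t₄) o₆
    | 5 => fourIco (o₁ - p₅) o₁ o₃ (o₃ + u₅) (o₅ - z₅) o₅ o₅ (o₅ + t₅)
    | 6 => fourIco 0 0 0 0 (o₄ - u₆) o₄ (o₆ - t₆) o₆
    | 7 => fourIco 0 0 0 0 0 0 o₂ o₄
    | 14 => fourIco 0 0 0 0 0 0 o₁ o₃
    | 15 => fourIco 0 0 0 0 0 0 o₄ o₅
    | _ => fourIco 0 0 0 0 0 0 o₆ q
  clear H
  refine typeColorable_of_lt (by decide) X ?_ ?_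
  · simp only [typesTwo, List.forall_mem_cons, X]
    refine ⟨?_, ?_, ?_, ?_, ?_, ?_, ?_, ?_, ?_, ?_, ?_, List.forall_mem_nil _⟩ <;> refine ⟨fun x hx => ?_, ?_⟩
    all_goals first
      | (rw [mem_fourIco] at hx
         rw [Finset.mem_range]
         omega)
      | (rw [card_fourIco] <;> omega)
  · simp only [Finset.disjoint_left]
    simp +decide only [typesTwo, List.forall_mem_cons, X, mem_fourIco, forall_const, false_imp_iff,
      List.not_mem_nil, imp_true_iff, and_true, true_and, Nat.not_lt_zero, and_false, false_or,
      zero_le]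
    clear hdem
    and_intros <;> intro x hx <;> omega

/-! ### The structure of the graphs -/

section Forbidden

variable {V : Type*} {G : SimpleGraph V}

theorem isIndContained_bot_four {a b c d : V} (hab : a ≠ b) (hac : a ≠ c) (had : a ≠ d)
    (hbc : b ≠ c) (hbd : b ≠ d) (hcd : c ≠ d) (nab : ¬ G.Adj a b) (nac : ¬ G.Adj a c)
    (nad : ¬ G.Adj a d) (nbc : ¬ G.Adj b c) (nbd : ¬ G.Adj b d) (ncd : ¬ G.Adj c d) :
    (⊥ : SimpleGraph (Fin 4)).IsIndContained G := by
  have key : ∀ i j : Fin 4, G.Adj (![a, b, c, d] i) (![a, b, c, d] j) ↔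
      (⊥ : SimpleGraph (Fin 4)).Adj i j := by
    intro i j
    fin_cases i <;> fin_cases j <;> simp [nab, nac, nad, nbc, nbd, ncd, G.adj_comm b a,
      G.adj_comm c a, G.adj_comm d a, G.adj_comm c b, G.adj_comm d b, G.adj_comm d c]
  refine ⟨⟨⟨![a, b, c, d], ?_⟩, fun {i j} => key i j⟩⟩
  intro i j
  fin_cases i <;> fin_cases j <;> simp [hab, hac, had, hbc, hbd, hcd, hab.symm, hac.symm,
    had.symm, hbc.symm, hbd.symm, hcd.symm]

theorem isIndContained_cycleGraph_four {a b c d : V} (hac : a ≠ c) (hbd : b ≠ d)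
    (nac : ¬ G.Adj a c) (nbd : ¬ G.Adj b d) (ab : G.Adj a b) (bc : G.Adj b c) (cd : G.Adj c d)
    (da : G.Adj d a) : (SimpleGraph.cycleGraph 4).IsIndContained G := by
  have key : ∀ i j : Fin 4, G.Adj (![a, b, c, d] i) (![a, b, c, d] j) ↔
      (SimpleGraph.cycleGraph 4).Adj i j := by
    intro i j
    rw [SimpleGraph.cycleGraph_adj]
    fin_cases i <;> fin_cases j <;> simp [nac, nbd, ab, bc, cd, da, ab.symm, bc.symm, cd.symm,
      da.symm, G.adj_comm c a, G.adj_comm d b] <;> decide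
  refine ⟨⟨⟨![a, b, c, d], ?_⟩, fun {i j} => key i j⟩⟩
  intro i j
  fin_cases i <;> fin_cases j <;> simp [ab.ne, hac, da.ne', bc.ne, hbd, cd.ne, ab.ne', hac.symm,
    da.ne, bc.ne', hbd.symm, cd.ne']

theorem isIndContained_cycleGraph_six {a b c d e f : V} (ab : G.Adj a b) (bc : G.Adj b c)
    (cd : G.Adj c d) (de : G.Adj d e) (ef : G.Adj e f) (fa : G.Adj f a) (ac : ¬ G.Adj a c)
    (ad : ¬ G.Adj a d) (ae : ¬ G.Adj a e) (bd : ¬ G.Adj b d) (be : ¬ G.Adj b e)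
    (bf : ¬ G.Adj b f) (ce : ¬ G.Adj c e) (cf : ¬ G.Adj c f) (df : ¬ G.Adj d f) :
    (SimpleGraph.cycleGraph 6).IsIndContained G := by
  have key : ∀ i j : Fin 6, G.Adj (![a, b, c, d, e, f] i) (![a, b, c, d, e, f] j) ↔
      (SimpleGraph.cycleGraph 6).Adj i j := by
    intro i j
    rw [SimpleGraph.cycleGraph_adj]
    fin_cases i <;> fin_cases j <;> simp [ab, bc, cd, de, ef, fa, ac, ad, ae, bd, be, bf, ce, cf,
      df, ab.symm, bc.symm, cd.symm, de.symm, ef.symm, fa.symm, G.adj_comm c a, G.adj_comm d a,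
      G.adj_comm e a, G.adj_comm d b, G.adj_comm e b, G.adj_comm f b, G.adj_comm e c,
      G.adj_comm f c, G.adj_comm f d] <;> decide
  refine ⟨⟨⟨![a, b, c, d, e, f], ?_⟩, fun {i j} => key i j⟩⟩
  intro i j hij
  by_contra hne
  -- Distinct vertices of `C_6` have distinct neighborhoods, so injectivity follows from the
  -- adjacencies alone. This fails for `C_4`, where the opposite vertices are assumed to differ.
  have : ∀ i j : Fin 6, i ≠ j → ∃ k, ¬ ((SimpleGraph.cycleGraph 6).Adj i k ↔
      (SimpleGraph.cycleGraph 6).Adj j k) := by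
    simp only [SimpleGraph.cycleGraph_adj]; decide
  obtain ⟨k, hk⟩ := this i j hne
  exact hk (by rw [← key, ← key, hij])

end Forbidden

/-! ### Traces on the seven-cycle -/

/-- Two positions on the cycle are consecutive. -/
def consecutive (i j : Fin 7) : Bool := j = i + 1 || i = j + 1

/-- The traces of a vertex outside of the cycle that create no forbidden subgraph. -/
def traceFree (f : Fin 7 → Bool) : Bool :=
  decide (∀ i, !(f i && f (i + 2) && !f (i + 1))) &&
  decide (∀ i, !(f i && f (i + 4) && !f (i + 1) && !f (i + 2) && !f (i + 3))) &&
  decide (∀ i, f i || f (i + 2) || f (i + 4))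

/-- The three conditions forbid gaps of length one, of length three, and of length at least five.
With gaps of length two and four only, a trace consists of three or five consecutive positions, has
the form `{i, i + 3, i + 4}`, or is everything. -/
theorem exists_type_of_traceFree : ∀ f : Fin 7 → Bool, traceFree f = true →
    ∃ τ < 22, ∀ j : Fin 7, f j = typeTrace τ j := by
  decide +kernel

/-- The traces of two distinct vertices outside of the cycle, adjacent or not according to `b`,
that create no forbidden subgraph. -/
def tracePairFree (f g : Fin 7 → Bool) (b : Bool) : Bool :=
  if b then
    decide (∀ i, !(f i && !f (i + 1) && g (i + 1) && !g i)) &&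
    decide (∀ i, !(g i && !g (i + 1) && f (i + 1) && !f i)) &&
    decide (∀ i, !(f i && !f (i + 1) && !f (i + 2) && !f (i + 3) &&
      !g i && !g (i + 1) && !g (i + 2) && g (i + 3))) &&
    decide (∀ i, !(g i && !g (i + 1) && !g (i + 2) && !g (i + 3) &&
      !f i && !f (i + 1) && !f (i + 2) && f (i + 3)))
  else
    decide (∀ i, !(f i && g i && f (i + 2) && g (i + 2))) &&
    decide (∀ i, !(f i && g i && f (i + 3) && g (i + 3))) &&
    decide (∀ i, f i || g i || f (i + 2) || g (i + 2)) &&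
    decide (∀ i, f i || g i || f (i + 3) || g (i + 3)) &&
    decide (∀ p, ∀ q, !((q = p + 2 || q = p + 3) && f p && g p &&
      f q && !f (q + 1) && !f (q + 2) && !g q && !g (q + 1) && g (q + 2))) &&
    decide (∀ p, ∀ q, !((q = p + 2 || q = p + 3) && f p && g p &&
      g q && !g (q + 1) && !g (q + 2) && !f q && !f (q + 1) && f (q + 2))) &&
    decide (∀ p, !(f p && !f (p + 1) && !f (p + 3) && f (p + 4) &&
      !g p && g (p + 1) && g (p + 3) && !g (p + 4))) &&
    decide (∀ p, !(g p && !g (p + 1) && !g (p + 3) && g (p + 4) &&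
      !f p && f (p + 1) && f (p + 3) && !f (p + 4))) &&
    decide (∀ p, !(f p && !f (p + 1) && f (p + 3) && !f (p + 4) &&
      !g p && g (p + 1) && !g (p + 3) && g (p + 4))) &&
    decide (∀ p, !(g p && !g (p + 1) && g (p + 3) && !g (p + 4) &&
      !f p && f (p + 1) && !f (p + 3) && f (p + 4)))

/-- Two types that can occur together. -/
def typeCompatible (τ σ : ℕ) : Bool :=
  tracePairFree (fun i => typeTrace τ i) (fun i => typeTrace σ i) (typeAdj τ σ)

/-- For every pair of types at least one of the two values of `b` creates an obstruction, so
adjacency off the cycle is a function of the types. -/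
theorem typeAdj_of_tracePairFree : ∀ τ < 22, ∀ σ < 22, ∀ b,
    tracePairFree (fun i => typeTrace τ i) (fun i => typeTrace σ i) b = true →
      b = typeAdj τ σ := by
  decide +kernel

theorem typeTrace_injective : ∀ τ < 22, ∀ σ < 22,
    (∀ j : Fin 7, typeTrace τ j = typeTrace σ j) → τ = σ := by
  decide +kernel

theorem typeAdj_comm : ∀ τ < 23, ∀ σ < 23, typeAdj τ σ = typeAdj σ τ := by
  decide +kernel

theorem typeAdj_self : ∀ τ < 22, typeAdj τ τ = true := by
  decide +kernel

theorem typeCompatible_self : ∀ τ < 22, typeCompatible τ τ = true := by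
  decide +kernel

/-- Pairs that involve a vertex of the cycle are not covered by the analysis of two outside
vertices; this supplies their compatibility. -/
theorem typeCompatible_of_lt_seven : ∀ τ < 7, ∀ σ < 22,
    typeCompatible τ σ = true ∧ typeCompatible σ τ = true := by
  decide +kernel

/-- The type of a vertex encodes its closed trace on a fixed induced cycle. Each condition in
`traceFree` and `tracePairFree` is violated only if an explicit forbidden induced subgraph occurs.
-/
theorem exists_typing {V : Type*} {G : SimpleGraph V}
    (h₁ : ¬ (⊥ : SimpleGraph (Fin 4)).IsIndContained G)
    (h₄ : ¬ (SimpleGraph.cycleGraph 4).IsIndContained G)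
    (h₆ : ¬ (SimpleGraph.cycleGraph 6).IsIndContained G)
    (h₇ : (SimpleGraph.cycleGraph 7).IsIndContained G) :
    ∃ ty : V → ℕ, (∀ x, ty x < 22) ∧
      (∀ x y, x ≠ y → (G.Adj x y ↔ typeAdj (ty x) (ty y) = true)) ∧
      ∀ x y, typeCompatible (ty x) (ty y) = true := by
  classical
  obtain ⟨e⟩ := h₇
  have hadj : ∀ i j, G.Adj (e i) (e j) ↔ consecutive i j = true := by
    intro i j
    rw [e.map_adj_iff, SimpleGraph.cycleGraph_adj]
    revert i j; decide
  have hinj : ∀ i j, e i = e j ↔ i = j := fun i j => e.injective.eq_iff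
  let f : V → Fin 7 → Bool := fun x i => decide (x = e i ∨ G.Adj x (e i))
  have hout : ∀ x, (∀ i, x ≠ e i) → ∀ i, (f x i = true ↔ G.Adj x (e i)) := by
    intro x hx i
    simp [f, hx i]
  have hfin : ∀ i j, f (e i) j = typeTrace i j := by
    intro i j
    have : f (e i) j = (decide (i = j) || consecutive i j) := by
      simp only [f, hadj, hinj, Bool.decide_or, Bool.decide_eq_true]
    rw [this]
    clear this
    revert i j
    clear * -
    decide
  have hnot : ∀ b : Bool, ((!b) = true) ↔ ¬ (b = true) := by decide
  have c1 : ∀ i : Fin 7, consecutive i (i + 1) = true := by decide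
  have c1' : ∀ i : Fin 7, consecutive (i + 1) i = true := by decide
  have c12 : ∀ i : Fin 7, consecutive (i + 1) (i + 2) = true := by decide
  have c23 : ∀ i : Fin 7, consecutive (i + 2) (i + 3) = true := by decide
  have c34 : ∀ i : Fin 7, consecutive (i + 3) (i + 4) = true := by decide
  have n2 : ∀ i : Fin 7, ¬ consecutive i (i + 2) = true := by decide
  have n3 : ∀ i : Fin 7, ¬ consecutive i (i + 3) = true := by decide
  have n4 : ∀ i : Fin 7, ¬ consecutive i (i + 4) = true := by decide
  have n13 : ∀ i : Fin 7, ¬ consecutive (i + 1) (i + 3) = true := by decide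
  have n14 : ∀ i : Fin 7, ¬ consecutive (i + 1) (i + 4) = true := by decide
  have n24 : ∀ i : Fin 7, ¬ consecutive (i + 2) (i + 4) = true := by decide
  have d2 : ∀ i : Fin 7, i ≠ i + 2 := by decide
  have d3 : ∀ i : Fin 7, i ≠ i + 3 := by decide
  have d4 : ∀ i : Fin 7, i ≠ i + 4 := by decide
  have d24 : ∀ i : Fin 7, i + 2 ≠ i + 4 := by decide
  have hone : ∀ x, (∀ i, x ≠ e i) → traceFree (f x) = true := by
    intro x hx
    have hf := hout x hx
    have hx' : ∀ i, e i ≠ x := fun i => (hx i).symm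
    simp only [traceFree, Bool.and_eq_true, decide_eq_true_eq, hnot, Bool.or_eq_true, hf, not_and,
      not_not, and_imp]
    refine ⟨⟨fun i a₀ a₂ => ?_, fun i a₀ a₄ a₁ a₂ => ?_⟩, fun i => ?_⟩
    · by_contra a₁
      exact h₄ (isIndContained_cycleGraph_four (hx _) ((hinj _ _).not.2 (d2 i)) a₁
        ((hadj _ _).not.2 (n2 i)) a₀ ((hadj _ _).2 (c1 i)) ((hadj _ _).2 (c12 i)) a₂.symm)
    · by_contra a₃
      exact h₆ (isIndContained_cycleGraph_six a₀ ((hadj _ _).2 (c1 i)) ((hadj _ _).2 (c12 i))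
        ((hadj _ _).2 (c23 i)) ((hadj _ _).2 (c34 i)) a₄.symm a₁ a₂ a₃ ((hadj _ _).not.2 (n2 i))
        ((hadj _ _).not.2 (n3 i)) ((hadj _ _).not.2 (n4 i)) ((hadj _ _).not.2 (n13 i))
        ((hadj _ _).not.2 (n14 i)) ((hadj _ _).not.2 (n24 i)))
    · by_contra hcon
      simp only [not_or] at hcon
      exact h₁ (isIndContained_bot_four (hx _) (hx _) (hx _) ((hinj _ _).not.2 (d2 i))
        ((hinj _ _).not.2 (d4 i)) ((hinj _ _).not.2 (d24 i)) hcon.1.1 hcon.1.2 hcon.2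
        ((hadj _ _).not.2 (n2 i)) ((hadj _ _).not.2 (n4 i)) ((hadj _ _).not.2 (n24 i)))
  -- For adjacent `x` and `y`, a path of one or three cycle edges from a neighbor of `x` to a
  -- neighbor of `y` closes up to a `C_4` or a `C_6`.
  have key1 : ∀ x y, x ≠ y → (∀ i, x ≠ e i) → (∀ i, y ≠ e i) → G.Adj x y →
      (∀ i, G.Adj x (e i) → ¬ G.Adj x (e (i + 1)) → G.Adj y (e (i + 1)) → G.Adj y (e i)) ∧
      (∀ i, G.Adj x (e i) → ¬ G.Adj x (e (i + 1)) → ¬ G.Adj x (e (i + 2)) →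
        ¬ G.Adj x (e (i + 3)) → ¬ G.Adj y (e i) → ¬ G.Adj y (e (i + 1)) →
        ¬ G.Adj y (e (i + 2)) → ¬ G.Adj y (e (i + 3))) := by
    intro x y hxy hx hy a
    constructor
    · intro i x₀ x₁ y₁
      by_contra y₀
      exact h₄ (isIndContained_cycleGraph_four (hx _) (hy _).symm x₁ (fun h => y₀ h.symm) x₀
        ((hadj _ _).2 (c1 i)) y₁.symm a.symm)
    · intro i x₀ x₁ x₂ x₃ y₀ y₁ y₂ y₃
      exact h₆ (isIndContained_cycleGraph_six x₀ ((hadj _ _).2 (c1 i)) ((hadj _ _).2 (c12 i))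
        ((hadj _ _).2 (c23 i)) y₃.symm a.symm x₁ x₂ x₃ ((hadj _ _).not.2 (n2 i))
        ((hadj _ _).not.2 (n3 i)) (fun h => y₀ h.symm) ((hadj _ _).not.2 (n13 i))
        (fun h => y₁ h.symm) (fun h => y₂ h.symm))
  -- For non-adjacent `x` and `y`, two vertex-disjoint connections through the cycle form a `C_6`:
  -- with one and three inner vertices in the first case, with two inner vertices each in the
  -- others.
  have key2 : ∀ x y, x ≠ y → (∀ i, x ≠ e i) → (∀ i, y ≠ e i) → ¬ G.Adj x y →
      (∀ p q, (q = p + 2 ∨ q = p + 3) → G.Adj x (e p) → G.Adj y (e p) → G.Adj x (e q) →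
        ¬ G.Adj x (e (q + 1)) → ¬ G.Adj x (e (q + 2)) → ¬ G.Adj y (e q) →
        ¬ G.Adj y (e (q + 1)) → ¬ G.Adj y (e (q + 2))) ∧
      (∀ p, G.Adj x (e p) → ¬ G.Adj x (e (p + 1)) → ¬ G.Adj x (e (p + 3)) →
        G.Adj x (e (p + 4)) → ¬ G.Adj y (e p) → G.Adj y (e (p + 1)) → G.Adj y (e (p + 3)) →
        G.Adj y (e (p + 4))) ∧
      (∀ p, G.Adj x (e p) → ¬ G.Adj x (e (p + 1)) → G.Adj x (e (p + 3)) →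
        ¬ G.Adj x (e (p + 4)) → ¬ G.Adj y (e p) → G.Adj y (e (p + 1)) →
        ¬ G.Adj y (e (p + 3)) → ¬ G.Adj y (e (p + 4))) := by
    intro x y hxy hx hy a
    refine ⟨?_, ?_, ?_⟩
    · intro p q hq xp yp xq xq₁ xq₂ yq yq₁ yq₂
      have m : ¬ consecutive p q = true ∧ ¬ consecutive p (q + 1) = true ∧
          ¬ consecutive p (q + 2) = true := by
        clear * - hq; revert p q; decide
      exact h₆ (isIndContained_cycleGraph_six xq ((hadj _ _).2 (c1 q)) ((hadj _ _).2 (c12 q))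
        yq₂.symm yp xp.symm xq₁ xq₂ a ((hadj _ _).not.2 (n2 q)) (fun h => yq h.symm)
        (fun h => m.1 ((hadj _ _).1 h.symm)) (fun h => yq₁ h.symm)
        (fun h => m.2.1 ((hadj _ _).1 h.symm)) (fun h => m.2.2 ((hadj _ _).1 h.symm)))
    · intro p x₀ x₁ x₃ x₄ y₀ y₁ y₃
      by_contra y₄
      exact h₆ (isIndContained_cycleGraph_six x₀ ((hadj _ _).2 (c1 p)) y₁.symm y₃
        ((hadj _ _).2 (c34 p)) x₄.symm x₁ a x₃ (fun h => y₀ h.symm) ((hadj _ _).not.2 (n3 p))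
        ((hadj _ _).not.2 (n4 p)) ((hadj _ _).not.2 (n13 p)) ((hadj _ _).not.2 (n14 p)) y₄)
    · intro p x₀ x₁ x₃ x₄ y₀ y₁ y₃ y₄
      exact h₆ (isIndContained_cycleGraph_six x₀ ((hadj _ _).2 (c1 p)) y₁.symm y₄
        ((hadj _ _).2 (c34 p)).symm x₃.symm x₁ a x₄ (fun h => y₀ h.symm)
        ((hadj _ _).not.2 (n4 p)) ((hadj _ _).not.2 (n3 p)) ((hadj _ _).not.2 (n14 p))
        ((hadj _ _).not.2 (n13 p)) y₃)
  -- Two non-consecutive positions together with non-adjacent `x` and `y` form a `C_4` if all four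
  -- connections are present, and a `4K_1` if all are absent.
  have key3 : ∀ x y, x ≠ y → (∀ i, x ≠ e i) → (∀ i, y ≠ e i) → ¬ G.Adj x y →
      ∀ i j, i ≠ j → ¬ consecutive i j = true →
      ¬ (G.Adj x (e i) ∧ G.Adj y (e i) ∧ G.Adj x (e j) ∧ G.Adj y (e j)) ∧
      (G.Adj x (e i) ∨ G.Adj y (e i) ∨ G.Adj x (e j) ∨ G.Adj y (e j)) := by
    intro x y hxy hx hy a i j hij hc
    constructor
    · rintro ⟨x₀, y₀, x₁, y₁⟩
      exact h₄ (isIndContained_cycleGraph_four hxy ((hinj _ _).not.2 hij) a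
        ((hadj _ _).not.2 hc) x₀ y₀.symm y₁ x₁.symm)
    · by_contra hcon
      simp only [not_or] at hcon
      exact h₁ (isIndContained_bot_four hxy (hx _) (hx _) (hy _) (hy _) ((hinj _ _).not.2 hij) a
        hcon.1 hcon.2.2.1 hcon.2.1 hcon.2.2.2 ((hadj _ _).not.2 hc))
  have htwo : ∀ x y, x ≠ y → (∀ i, x ≠ e i) → (∀ i, y ≠ e i) →
      tracePairFree (f x) (f y) (decide (G.Adj x y)) = true := by
    intro x y hxy hx hy
    have hf := hout x hx
    have hg := hout y hy
    by_cases a : G.Adj x y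
    · obtain ⟨k₁, k₂⟩ := key1 x y hxy hx hy a
      obtain ⟨k₃, k₄⟩ := key1 y x hxy.symm hy hx a.symm
      simp only [tracePairFree, a, decide_true, if_true, Bool.and_eq_true, decide_eq_true_eq,
        hnot, hf, hg, not_and, not_not, and_imp]
      exact ⟨⟨⟨k₁, k₃⟩, k₂⟩, k₄⟩
    · obtain ⟨k₁, k₂, k₃⟩ := key2 x y hxy hx hy a
      obtain ⟨k₄, k₅, k₆⟩ := key2 y x hxy.symm hy hx (fun h => a h.symm)
      have k := key3 x y hxy hx hy a
      simp only [tracePairFree, a, decide_false, Bool.and_eq_true, decide_eq_true_eq,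
        hnot, hf, hg, not_and, not_not, and_imp, Bool.or_eq_true, or_assoc, Bool.false_eq_true,
        if_false]
      exact ⟨⟨⟨⟨⟨⟨⟨⟨⟨fun i b₁ b₂ b₃ b₄ => (k i _ (d2 i) (n2 i)).1 ⟨b₁, b₂, b₃, b₄⟩,
        fun i b₁ b₂ b₃ b₄ => (k i _ (d3 i) (n3 i)).1 ⟨b₁, b₂, b₃, b₄⟩⟩,
        fun i => (k i _ (d2 i) (n2 i)).2⟩, fun i => (k i _ (d3 i) (n3 i)).2⟩, k₁⟩,
        fun p q h b₁ b₂ => k₄ p q h b₂ b₁⟩, k₂⟩, k₅⟩, k₃⟩, k₆⟩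
  have hty : ∀ x, ∃ τ < 22, ∀ j : Fin 7, f x j = typeTrace τ j := by
    intro x
    by_cases hx : ∀ i, x ≠ e i
    · exact exists_type_of_traceFree _ (hone x hx)
    · push Not at hx
      obtain ⟨i, rfl⟩ := hx
      exact ⟨i, by omega, hfin i⟩
  choose ty hlt hty using hty
  have htye : ∀ i, ty (e i) = i := fun i => typeTrace_injective _ (hlt _) _ (by omega)
    (fun j => by rw [← hty, hfin])
  have hin : ∀ i y, e i ≠ y → (G.Adj (e i) y ↔ typeAdj (ty (e i)) (ty y) = true) := by
    intro i y hne
    rw [htye, typeAdj, if_pos i.2, ← hty, G.adj_comm]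
    simp [f, hne.symm]
  refine ⟨ty, hlt, ?_, ?_⟩
  · intro x y hxy
    by_cases hx : ∀ i, x ≠ e i
    · by_cases hy : ∀ i, y ≠ e i
      · have := htwo x y hxy hx hy
        rw [funext (hty x), funext (hty y)] at this
        rw [← typeAdj_of_tracePairFree _ (hlt x) _ (hlt y) _ this, decide_eq_true_eq]
      · push Not at hy
        obtain ⟨i, rfl⟩ := hy
        rw [G.adj_comm, hin i x hxy.symm, typeAdj_comm _ ((hlt _).trans (by decide)) _
          ((hlt _).trans (by decide))]
    · push Not at hx
      obtain ⟨i, rfl⟩ := hx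
      exact hin i y hxy
  · intro x y
    by_cases hxy : x = y
    · rw [hxy]; exact typeCompatible_self _ (hlt y)
    by_cases hx : ∀ i, x ≠ e i
    · by_cases hy : ∀ i, y ≠ e i
      · have := htwo x y hxy hx hy
        rw [funext (hty x), funext (hty y)] at this
        have h := typeAdj_of_tracePairFree _ (hlt x) _ (hlt y) _ this
        rwa [h] at this
      · push Not at hy
        obtain ⟨i, rfl⟩ := hy
        exact (typeCompatible_of_lt_seven _ (by rw [htye]; exact i.2) _ (hlt x)).2
    · push Not at hx
      obtain ⟨i, rfl⟩ := hx
      exact (typeCompatible_of_lt_seven _ (by rw [htye]; exact i.2) _ (hlt y)).1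

/-! ### Reduction to two families of types by symmetry -/

/-- The action of a rotation, possibly preceded by a reflection, of the cycle on types. -/
def typeMap (r : ℕ) (b : Bool) (τ : ℕ) : ℕ :=
  if τ < 21 then τ / 7 * 7 + ((if b then 7 - τ % 7 else τ % 7) + r) % 7 else τ

theorem typeAdj_typeMap : ∀ r < 7, ∀ b, ∀ τ < 22, ∀ σ < 22,
    typeAdj (typeMap r b τ) (typeMap r b σ) = typeAdj τ σ := by
  decide +kernel

set_option synthInstance.maxHeartbeats 400000 in
set_option synthInstance.maxSize 2000 in
theorem typeMap_mem_of_lt_seven : ∀ r < 7, ∀ b, ∀ τ < 22, τ < 7 ∨ τ = 21 →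
    typeMap r b τ ∈ typesOne ∧ typeMap r b τ ∈ typesTwo := by
  decide +kernel

set_option synthInstance.maxHeartbeats 400000 in
set_option synthInstance.maxSize 2000 in
-- Two distinct types of the form `{i, i + 3, i + 4}` are so restrictive that every type compatible
-- with both of them fits into the first family under one common symmetry.
theorem exists_typeMap_two : ∀ i j : Fin 7, i ≠ j → typeCompatible (7 + i) (7 + j) = true →
    ∃ r < 7, ∃ b, ∀ τ < 22, typeCompatible τ (7 + i) = true → typeCompatible τ (7 + j) = true →
      typeMap r b τ ∈ typesOne := by
  decide +kernel

set_option synthInstance.maxHeartbeats 400000 in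
set_option synthInstance.maxSize 2000 in
theorem exists_typeMap_one : ∀ τ < 14, τ = 0 ∨ 7 ≤ τ → ∀ d : Fin 7 → Bool,
    (∀ j, d j = true → typeCompatible (14 + j) τ = true) →
    (∀ j, d j = true → ∀ l, d l = true → typeCompatible (14 + j) (14 + l) = true) →
    ∃ r < 7, ∃ b, (typeMap r b τ ∈ typesOne ∧
        ∀ j, d j = true → typeMap r b (14 + j) ∈ typesOne) ∨
      (typeMap r b τ ∈ typesTwo ∧ ∀ j, d j = true → typeMap r b (14 + j) ∈ typesTwo) := by
  decide +kernel

/-- The types below 7 and the type 21 lie in both families after any symmetry, so only the types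
from 7 to 20 matter; the cases are split by the number of types from 7 to 13. -/
theorem exists_typeMap (S : Set ℕ) (hlt : ∀ τ ∈ S, τ < 22)
    (hS : ∀ τ ∈ S, ∀ σ ∈ S, typeCompatible τ σ = true) :
    ∃ r < 7, ∃ b, (∀ τ ∈ S, typeMap r b τ ∈ typesOne) ∨ (∀ τ ∈ S, typeMap r b τ ∈ typesTwo) := by
  classical
  by_cases h : ∃ τ ∈ S, ∃ σ ∈ S, 7 ≤ τ ∧ τ < 14 ∧ 7 ≤ σ ∧ σ < 14 ∧ τ ≠ σ
  · obtain ⟨τ, hτ, σ, hσ, h₁, h₂, h₃, h₄, hne⟩ := h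
    obtain ⟨i, rfl⟩ : ∃ i : Fin 7, τ = 7 + i := ⟨⟨τ - 7, by omega⟩, by simp; omega⟩
    obtain ⟨j, rfl⟩ : ∃ j : Fin 7, σ = 7 + j := ⟨⟨σ - 7, by omega⟩, by simp; omega⟩
    obtain ⟨r, hr, b, H⟩ := exists_typeMap_two i j (by rintro rfl; exact hne rfl) (hS _ hτ _ hσ)
    exact ⟨r, hr, b, Or.inl fun υ hυ => H υ (hlt _ hυ) (hS _ hυ _ hτ) (hS _ hυ _ hσ)⟩
  obtain ⟨τ, hτ, hτ', huniq⟩ : ∃ τ < 14, (τ = 0 ∨ 7 ≤ τ ∧ τ ∈ S) ∧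
      ∀ σ ∈ S, 7 ≤ σ → σ < 14 → σ = τ := by
    by_cases h' : ∃ τ ∈ S, 7 ≤ τ ∧ τ < 14
    · obtain ⟨τ, hτ, h₁, h₂⟩ := h'
      refine ⟨τ, h₂, Or.inr ⟨h₁, hτ⟩, fun σ hσ h₃ h₄ => ?_⟩
      by_contra hne
      exact h ⟨σ, hσ, τ, hτ, h₃, h₄, h₁, h₂, hne⟩
    · exact ⟨0, by omega, Or.inl rfl, fun σ hσ h₃ h₄ => absurd ⟨σ, hσ, h₃, h₄⟩ h'⟩
  obtain ⟨r, hr, b, H⟩ := exists_typeMap_one τ hτ (hτ'.imp id And.left)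
    (fun j => decide (14 + (j : ℕ) ∈ S))
    (fun j hj => by
      rcases hτ' with rfl | h'
      · exact (typeCompatible_of_lt_seven 0 (by omega) _ (by omega)).2
      · exact hS _ (by simpa using hj) _ h'.2)
    (fun j hj l hl => hS _ (by simpa using hj) _ (by simpa using hl))
  refine ⟨r, hr, b, ?_⟩
  have split : ∀ σ ∈ S, (σ < 7 ∨ σ = 21) ∨ σ = τ ∨ ∃ j : Fin 7, σ = 14 + j := by
    intro σ hσ
    have := hlt σ hσ
    by_cases h₁ : σ < 7 ∨ σ = 21
    · exact Or.inl h₁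
    by_cases h₂ : σ < 14
    · exact Or.inr (Or.inl (huniq σ hσ (by omega) h₂))
    · exact Or.inr (Or.inr ⟨⟨σ - 14, by omega⟩, by simp; omega⟩)
  rcases H with ⟨H₁, H₂⟩ | ⟨H₁, H₂⟩
  · left
    intro σ hσ
    rcases split σ hσ with h' | rfl | ⟨j, rfl⟩
    · exact (typeMap_mem_of_lt_seven r hr b σ (hlt σ hσ) h').1
    · exact H₁
    · exact H₂ j (by simpa using hσ)
  · right
    intro σ hσ
    rcases split σ hσ with h' | rfl | ⟨j, rfl⟩
    · exact (typeMap_mem_of_lt_seven r hr b σ (hlt σ hσ) h').2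
    · exact H₁
    · exact H₂ j (by simpa using hσ)

theorem exists_standard_typing {V : Type*} {G : SimpleGraph V}
    (h₁ : ¬ (⊥ : SimpleGraph (Fin 4)).IsIndContained G)
    (h₄ : ¬ (SimpleGraph.cycleGraph 4).IsIndContained G)
    (h₆ : ¬ (SimpleGraph.cycleGraph 6).IsIndContained G)
    (h₇ : (SimpleGraph.cycleGraph 7).IsIndContained G) :
    ∃ ty : V → ℕ, ((∀ x, ty x ∈ typesOne) ∨ ∀ x, ty x ∈ typesTwo) ∧
      ∀ x y, x ≠ y → (G.Adj x y ↔ typeAdj (ty x) (ty y) = true) := by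
  obtain ⟨ty, hlt, hadj, hcomp⟩ := exists_typing h₁ h₄ h₆ h₇
  obtain ⟨r, hr, b, H⟩ := exists_typeMap (Set.range ty) (by rintro _ ⟨x, rfl⟩; exact hlt x)
    (by rintro _ ⟨x, rfl⟩ _ ⟨y, rfl⟩; exact hcomp x y)
  refine ⟨fun x => typeMap r b (ty x), ?_, fun x y hxy => ?_⟩
  · exact H.imp (fun h x => h _ ⟨x, rfl⟩) (fun h x => h _ ⟨x, rfl⟩)
  · rw [hadj x y hxy, typeAdj_typeMap r hr b _ (hlt x) _ (hlt y)]

/-! ### Twin classes and weighted stable sets -/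

/-- The numbers `u` and `v` are equal or adjacent vertices of `G`. -/
def ClosedAdj {n : ℕ} (G : SimpleGraph (Fin n)) (u v : ℕ) : Prop :=
  ∃ (hu : u < n) (hv : v < n), u = v ∨ G.Adj ⟨u, hu⟩ ⟨v, hv⟩

theorem ClosedAdj.symm {n : ℕ} {G : SimpleGraph (Fin n)} {u v : ℕ} (h : ClosedAdj G u v) :
    ClosedAdj G v u := by
  obtain ⟨hu, hv, h⟩ := h
  exact ⟨hv, hu, h.imp Eq.symm fun h => h.symm⟩

theorem closedAdj_self {n : ℕ} {G : SimpleGraph (Fin n)} {u : ℕ} (h : u < n) : ClosedAdj G u u :=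
  ⟨h, h, Or.inl rfl⟩

/-- The vertices `R 0, …, R (k - 1)` have pairwise distinct closed neighborhoods, and `R k` is no
vertex. -/
structure IsRepFamily {n : ℕ} (G : SimpleGraph (Fin n)) (k : ℕ) (R : ℕ → ℕ) : Prop where
  lt : ∀ i < k, R i < n
  dummy : R k = n
  ne : ∀ i < k, ∀ j < k, i ≠ j → ∃ u, ¬ (ClosedAdj G (R i) u ↔ ClosedAdj G (R j) u)

/-- The representatives with the numbers `a`, `b` and `e` are stable. -/
def StableTriple {n : ℕ} (G : SimpleGraph (Fin n)) (R : ℕ → ℕ) (a b e : ℕ) : Prop :=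
  ¬ ClosedAdj G (R a) (R b) ∧ ¬ ClosedAdj G (R a) (R e) ∧ ¬ ClosedAdj G (R b) (R e)

/-- Stable sets of representatives have weight at most `r`. -/
def WeightBound {n : ℕ} (G : SimpleGraph (Fin n)) (k : ℕ) (R : ℕ → ℕ) (c : ℕ → ℕ) (r : ℕ) : Prop :=
  ∀ a ≤ k, ∀ b ≤ k, ∀ e ≤ k, StableTriple G R a b e → c a + c b + c e ≤ r

/-- The weighted counting bound for the number `q` of colors holds for all weights up to `3`. -/
def CountingBound {n : ℕ} (G : SimpleGraph (Fin n)) (k : ℕ) (R : ℕ → ℕ) (w : ℕ → ℕ) (q : ℕ) :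
    Prop :=
  ∀ c : ℕ → ℕ, (∀ i, c i ≤ 3) → c k = 0 → ∀ r, WeightBound G k R c r →
    ∑ i ∈ Finset.range k, c i * w i ≤ r * q

section Classes

variable {n : ℕ} {G : SimpleGraph (Fin n)} {k : ℕ} {R : ℕ → ℕ}

/-- Representatives of equal type would be twins, hence the injectivity. The dummy class gets the
dummy type 22; neither is adjacent to anything, not even to itself in the closed sense, so adjacency
also matches there. -/
theorem IsRepFamily.exists_types (hR : IsRepFamily G k R)
    (h₁ : ¬ (⊥ : SimpleGraph (Fin 4)).IsIndContained G)
    (h₄ : ¬ (SimpleGraph.cycleGraph 4).IsIndContained G)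
    (h₆ : ¬ (SimpleGraph.cycleGraph 6).IsIndContained G)
    (h₇ : (SimpleGraph.cycleGraph 7).IsIndContained G) :
    ∃ T : ℕ → ℕ, ((∀ a < k, T a ∈ typesOne) ∨ ∀ a < k, T a ∈ typesTwo) ∧
      (∀ a, k ≤ a → T a = 22) ∧
      (∀ a < k, ∀ b < k, T a = T b → a = b) ∧
      ∀ a ≤ k, ∀ b ≤ k, (ClosedAdj G (R a) (R b) ↔ typeAdj (T a) (T b) = true) := by
  obtain ⟨ty, hmem, hadj⟩ := exists_standard_typing h₁ h₄ h₆ h₇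
  have hlt : ∀ x, ty x < 22 := by
    have e₁ : ∀ τ ∈ typesOne, τ < 22 := by decide
    have e₂ : ∀ τ ∈ typesTwo, τ < 22 := by decide
    intro x
    rcases hmem with h | h
    · exact e₁ _ (h x)
    · exact e₂ _ (h x)
  have hclosed : ∀ u v (hu : u < n) (hv : v < n),
      ClosedAdj G u v ↔ typeAdj (ty ⟨u, hu⟩) (ty ⟨v, hv⟩) = true := by
    intro u v hu hv
    by_cases huv : u = v
    · subst huv
      simp [closedAdj_self hu, typeAdj_self _ (hlt _)]
    · rw [← hadj _ _ (by simpa using huv)]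
      exact ⟨fun ⟨_, _, h⟩ => h.resolve_left huv, fun h => ⟨hu, hv, Or.inr h⟩⟩
  refine ⟨fun a => if h : a < k then ty ⟨R a, hR.lt a h⟩ else 22, ?_, ?_, ?_, ?_⟩
  · refine hmem.imp (fun h a ha => ?_) (fun h a ha => ?_) <;> simpa [ha] using h _
  · intro a ha
    simp [not_lt.2 ha]
  · intro a ha b hb hab
    simp only [ha, hb, dif_pos] at hab
    by_contra hne
    obtain ⟨u, hu⟩ := hR.ne a ha b hb hne
    by_cases hun : u < n
    · exact hu (by rw [hclosed _ _ (hR.lt a ha) hun, hclosed _ _ (hR.lt b hb) hun, hab])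
    · exact hu ⟨fun ⟨_, h, _⟩ => absurd h hun, fun ⟨_, h, _⟩ => absurd h hun⟩
  · have d₁ : ∀ τ < 23, typeAdj 22 τ = false := by decide
    have d₂ : ∀ τ < 23, typeAdj τ 22 = false := by decide
    have hlt' : ∀ a, (if h : a < k then ty ⟨R a, hR.lt a h⟩ else 22) < 23 := by
      intro a
      split_ifs with h
      · exact (hlt _).trans (by decide)
      · decide
    intro a ha b hb
    rcases ha.lt_or_eq with ha | rfl
    · rcases hb.lt_or_eq with hb | rfl
      · simp only [hclosed _ _ (hR.lt a ha) (hR.lt b hb), ha, hb, dif_pos]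
      · simp only [lt_irrefl, dif_neg, not_false_iff]
        rw [d₂ _ (hlt' a)]
        simp only [Bool.false_eq_true, iff_false]
        rintro ⟨_, h, _⟩
        rw [hR.dummy] at h
        exact lt_irrefl _ h
    · simp only [lt_irrefl, dif_neg, not_false_iff]
      rw [d₁ _ (hlt' b)]
      simp only [Bool.false_eq_true, iff_false]
      rintro ⟨h, _, _⟩
      rw [hR.dummy] at h
      exact lt_irrefl _ h

theorem IsRepFamily.card_le (hR : IsRepFamily G k R)
    (h₁ : ¬ (⊥ : SimpleGraph (Fin 4)).IsIndContained G)
    (h₄ : ¬ (SimpleGraph.cycleGraph 4).IsIndContained G)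
    (h₆ : ¬ (SimpleGraph.cycleGraph 6).IsIndContained G)
    (h₇ : (SimpleGraph.cycleGraph 7).IsIndContained G) : k ≤ 13 := by
  obtain ⟨T, hT, -, hinj, -⟩ := hR.exists_types h₁ h₄ h₆ h₇
  have main : ∀ L : List ℕ, (∀ a < k, T a ∈ L) → k ≤ L.length := by
    intro L hL
    calc k = (Finset.range k).card := (Finset.card_range k).symm
      _ ≤ L.toFinset.card := Finset.card_le_card_of_injOn T
          (fun a ha => by simpa using hL a (by simpa using ha))
          (fun a ha b hb h => hinj a (by simpa using ha) b (by simpa using hb) h)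
      _ ≤ L.length := L.toFinset_card_le
  rcases hT with h | h
  · exact main _ h
  · exact (main _ h).trans (by decide)

/-- This is the converse of the counting argument. The facets are pulled back along the typing of
the classes to weights bounded by 3, for which `H` applies, and the resulting coloring of types is
pulled back to the classes. -/
theorem CountingBound.exists_colors {w : ℕ → ℕ} {q : ℕ} (H : CountingBound G k R w q)
    (hR : IsRepFamily G k R)
    (h₁ : ¬ (⊥ : SimpleGraph (Fin 4)).IsIndContained G)
    (h₄ : ¬ (SimpleGraph.cycleGraph 4).IsIndContained G)
    (h₆ : ¬ (SimpleGraph.cycleGraph 6).IsIndContained G)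
    (h₇ : (SimpleGraph.cycleGraph 7).IsIndContained G) :
    ∃ X : ℕ → Finset ℕ, (∀ a < k, X a ⊆ Finset.range q ∧ w a ≤ (X a).card) ∧
      ∀ a < k, ∀ b < k, a ≠ b → ClosedAdj G (R a) (R b) → Disjoint (X a) (X b) := by
  obtain ⟨T, hT, hdummy, hinj, hadj⟩ := hR.exists_types h₁ h₄ h₆ h₇
  -- Types that do not occur get weight zero, so the facets can be used for the whole family.
  let w' : ℕ → ℕ := fun τ => ∑ i ∈ Finset.range k with T i = τ, w i
  have hw' : ∀ a < k, w a ≤ w' (T a) := fun a ha =>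
    Finset.single_le_sum (f := w) (fun _ _ => Nat.zero_le _) (by simp [ha])
  have main : ∀ (L : List ℕ) (F : List (ℕ × List ℕ)), L.Nodup → (∀ a < k, T a ∈ L) →
      F.all (facetValid L) = true → (∀ p ∈ F, ∀ i, p.2.getD i 0 ≤ 3) →
      (∀ p ∈ F, p.2.getD 22 0 = 0) →
      ∀ p ∈ F, (L.map fun τ => p.2.getD τ 0 * w' τ).sum ≤ p.1 * q := by
    intro L F hL hmem hval hle hzero p hp
    have hmem' : ∀ a ≤ k, T a ∈ 22 :: L := by
      intro a ha
      rcases ha.lt_or_eq with ha | rfl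
      · exact List.mem_cons_of_mem _ (hmem a ha)
      · rw [hdummy _ le_rfl]; exact List.mem_cons_self
    have h := H (fun i => p.2.getD (T i) 0) (fun i => hle p hp _)
      (by simp only [hdummy k le_rfl]; exact hzero p hp) p.1 (by
        intro a ha b hb e he ⟨hab, hae, hbe⟩
        rw [hadj a ha b hb] at hab
        rw [hadj a ha e he] at hae
        rw [hadj b hb e he] at hbe
        have hv := List.all_eq_true.1 hval p hp
        have := List.all_eq_true.1 (List.all_eq_true.1 hv _ (hmem' a ha)) _ (hmem' b hb)
        simp only [hab, Bool.false_or] at this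
        have := List.all_eq_true.1 this _ (hmem' e he)
        simpa [hae, hbe] using this)
    refine le_trans (le_of_eq ?_) h
    rw [← List.sum_toFinset _ hL, ← Finset.sum_fiberwise_of_maps_to
      (g := T) (t := L.toFinset) (s := Finset.range k)
      (fun i hi => by simpa using hmem i (by simpa using hi))]
    refine Finset.sum_congr rfl fun τ _ => ?_
    simp only [w', Finset.mul_sum]
    refine Finset.sum_congr rfl fun i hi => ?_
    rw [(Finset.mem_filter.1 hi).2]
  have pull : ∀ L : List ℕ, (∀ a < k, T a ∈ L) → TypeColorable L w' q →
      ∃ X : ℕ → Finset ℕ, (∀ a < k, X a ⊆ Finset.range q ∧ w a ≤ (X a).card) ∧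
      ∀ a < k, ∀ b < k, a ≠ b → ClosedAdj G (R a) (R b) → Disjoint (X a) (X b) := by
    rintro L hL ⟨X, hX, hd⟩
    refine ⟨fun a => X (T a), fun a ha => ⟨(hX _ (hL a ha)).1, (hw' a ha).trans (hX _ (hL a ha)).2⟩,
      fun a ha b hb hne hab => hd _ (hL a ha) _ (hL b hb) (fun h => hne (hinj a ha b hb h)) ?_⟩
    rwa [← hadj a ha.le b hb.le]
  have big : ∀ (l : List ℕ) (i : ℕ), (∀ x ∈ l, x ≤ 3) → l.getD i 0 ≤ 3 := by
    intro l i hl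
    rw [List.getD_eq_getElem?_getD]
    rcases h : l[i]? with _ | x
    · simp
    · exact hl x (List.mem_of_getElem? h)
  rcases hT with h | h
  · exact pull _ h (typeColorable_typesOne w' q (main _ _ (by decide) h facetsOne_valid
      (fun p hp i => big _ _ ((by decide : ∀ p ∈ facetsOne, ∀ x ∈ p.2, x ≤ 3) p hp))
      (by decide)))
  · exact pull _ h (typeColorable_typesTwo w' q (main _ _ (by decide) h facetsTwo_valid
      (fun p hp i => big _ _ ((by decide : ∀ p ∈ facetsTwo, ∀ x ∈ p.2, x ≤ 3) p hp))
      (by decide)))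

theorem card_le_three_of_independent (h₁ : ¬ (⊥ : SimpleGraph (Fin 4)).IsIndContained G)
    (S : Finset (Fin n)) (hS : ∀ u ∈ S, ∀ v ∈ S, ¬ G.Adj u v) : S.card ≤ 3 := by
  by_contra h
  obtain ⟨S', hS', hcard⟩ := Finset.exists_subset_card_eq (show 4 ≤ S.card by omega)
  obtain ⟨a, b, c, d, hab, hac, had, hbc, hbd, hcd, rfl⟩ := Finset.card_eq_four.1 hcard
  have m : ∀ x ∈ ({a, b, c, d} : Finset (Fin n)), x ∈ S := fun x hx => hS' hx
  simp only [Finset.mem_insert, Finset.mem_singleton, forall_eq_or_imp, forall_eq] at m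
  obtain ⟨ma, mb, mc, md⟩ := m
  exact h₁ (isIndContained_bot_four hab hac had hbc hbd hcd (hS _ ma _ mb) (hS _ ma _ mc)
    (hS _ ma _ md) (hS _ mb _ mc) (hS _ mb _ md) (hS _ mc _ md))

/-- Stable sets of at most three members are stored as triples, with the dummy class `k` in the
empty places. The form with `S : Finset ι` and `f` serves for sets of classes as well as for color
classes of vertices. -/
theorem IsRepFamily.exists_triple {ι : Type*} (hR : IsRepFamily G k R) (S : Finset ι) (f : ι → ℕ)
    (hcard : S.card ≤ 3) (hf : ∀ x ∈ S, f x < k)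
    (hS : ∀ x ∈ S, ∀ y ∈ S, x ≠ y → ¬ ClosedAdj G (R (f x)) (R (f y))) :
    ∃ a ≤ k, ∃ b ≤ k, ∃ e ≤ k, StableTriple G R a b e ∧
      (∀ z, z = a ∨ z = b ∨ z = e → z = k ∨ ∃ x ∈ S, z = f x) ∧
      ∀ c : ℕ → ℕ, c k = 0 → ∑ x ∈ S, c (f x) = c a + c b + c e := by
  classical
  have hk : ∀ v, ¬ ClosedAdj G (R k) v := fun v ⟨h, _⟩ => by simp [hR.dummy] at h
  have hk' : ∀ v, ¬ ClosedAdj G v (R k) := fun v ⟨_, h, _⟩ => by simp [hR.dummy] at h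
  have : S.card = 0 ∨ S.card = 1 ∨ S.card = 2 ∨ S.card = 3 := by omega
  rcases this with h | h | h | h
  · rw [Finset.card_eq_zero] at h
    subst h
    exact ⟨k, le_rfl, k, le_rfl, k, le_rfl, ⟨hk _, hk _, hk _⟩, by simp, fun c hc => by simp [hc]⟩
  · obtain ⟨x, rfl⟩ := Finset.card_eq_one.1 h
    simp only [Finset.mem_singleton, forall_eq] at hf
    refine ⟨f x, hf.le, k, le_rfl, k, le_rfl, ⟨hk' _, hk' _, hk _⟩, ?_, fun c hc => by simp [hc]⟩
    rintro z (rfl | rfl | rfl) <;> simp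
  · obtain ⟨x, y, hxy, rfl⟩ := Finset.card_eq_two.1 h
    simp only [Finset.mem_insert, Finset.mem_singleton, forall_eq_or_imp, forall_eq] at hf hS
    refine ⟨f x, hf.1.le, f y, hf.2.le, k, le_rfl, ⟨hS.1.2 hxy, hk' _, hk' _⟩, ?_,
      fun c hc => by simp [hc, Finset.sum_pair hxy]⟩
    rintro z (rfl | rfl | rfl) <;> simp
  · obtain ⟨x, y, z, hxy, hxz, hyz, rfl⟩ := Finset.card_eq_three.1 h
    simp only [Finset.mem_insert, Finset.mem_singleton, forall_eq_or_imp, forall_eq] at hf hS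
    refine ⟨f x, hf.1.le, f y, hf.2.1.le, f z, hf.2.2.le, ⟨hS.1.2.1 hxy, hS.1.2.2 hxz,
      hS.2.1.2.2 hyz⟩, ?_, fun c hc => ?_⟩
    · rintro t (rfl | rfl | rfl) <;> simp
    · rw [Finset.sum_insert (by simp [hxy, hxz]), Finset.sum_pair hyz, add_assoc]

/-- The triple is the set of classes that use the last color `g` in a coloring with `g + 1` colors.
Each of the `g` other colors contributes at most `r` to the weighted sum. -/
theorem CountingBound.exists_stableTriple {w : ℕ → ℕ} {g : ℕ} (H : CountingBound G k R w (g + 1))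
    (hR : IsRepFamily G k R)
    (h₁ : ¬ (⊥ : SimpleGraph (Fin 4)).IsIndContained G)
    (h₄ : ¬ (SimpleGraph.cycleGraph 4).IsIndContained G)
    (h₆ : ¬ (SimpleGraph.cycleGraph 6).IsIndContained G)
    (h₇ : (SimpleGraph.cycleGraph 7).IsIndContained G) :
    ∃ a ≤ k, ∃ b ≤ k, ∃ e ≤ k, StableTriple G R a b e ∧
      (∀ z < k, z = a ∨ z = b ∨ z = e → 0 < w z) ∧
      ∀ c : ℕ → ℕ, c k = 0 → ∀ r, WeightBound G k R c r →
        ∑ i ∈ Finset.range k, c i * w i ≤ r * g + (c a + c b + c e) := by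
  classical
  obtain ⟨X, hX, hd⟩ := H.exists_colors hR h₁ h₄ h₆ h₇
  have hcard : ∀ S : Finset ℕ, (∀ x ∈ S, x < k) →
      (∀ x ∈ S, ∀ y ∈ S, x ≠ y → ¬ ClosedAdj G (R x) (R y)) → S.card ≤ 3 := by
    intro S hS hst
    let S' : Finset (Fin n) := S.attach.image fun x : {x // x ∈ S} => ⟨R x, hR.lt x (hS x x.2)⟩
    have hinj : ∀ x ∈ S, ∀ y ∈ S, R x = R y → x = y := by
      intro x hx y hy hxy
      by_contra hne
      exact hst x hx y hy hne (by rw [hxy]; exact closedAdj_self (hR.lt y (hS y hy)))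
    have : S'.card = S.card := by
      rw [Finset.card_image_of_injective, Finset.card_attach]
      intro x y hxy
      exact Subtype.ext (hinj _ x.2 _ y.2 (by simpa using hxy))
    rw [← this]
    refine card_le_three_of_independent h₁ S' ?_
    intro u hu v hv huv
    simp only [S', Finset.mem_image, Finset.mem_attach, true_and, Subtype.exists] at hu hv
    obtain ⟨x, hx, rfl⟩ := hu
    obtain ⟨y, hy, rfl⟩ := hv
    have hne : x ≠ y := by rintro rfl; exact huv.ne rfl
    exact hst x hx y hy hne ⟨_, _, Or.inr huv⟩
  have hst : ∀ t, ∀ x < k, ∀ y < k, t ∈ X x → t ∈ X y → x ≠ y → ¬ ClosedAdj G (R x) (R y) := by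
    intro t x hx y hy htx hty hne hadj
    exact Finset.disjoint_left.1 (hd x hx y hy hne hadj) htx hty
  -- The sets `X i` may be larger than `w i`; empty classes are left out, since nothing can be
  -- removed from them.
  let S : Finset ℕ := (Finset.range k).filter fun i => g ∈ X i ∧ 0 < w i
  have hS : ∀ x ∈ S, ∀ y ∈ S, x ≠ y → ¬ ClosedAdj G (R x) (R y) := by
    intro x hx y hy
    simp only [S, Finset.mem_filter, Finset.mem_range] at hx hy
    exact hst g x hx.1 y hy.1 hx.2.1 hy.2.1
  have hSk : ∀ x ∈ S, x < k := fun x hx => by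
    simp only [S, Finset.mem_filter, Finset.mem_range] at hx; exact hx.1
  obtain ⟨a, ha, b, hb, e, he, hst', hmem, hsum⟩ :=
    hR.exists_triple S id (hcard S hSk hS) hSk hS
  refine ⟨a, ha, b, hb, e, he, hst', ?_, ?_⟩
  · intro z hz h
    rcases hmem z h with h | ⟨x, hx, rfl⟩
    · omega
    · simp only [S, Finset.mem_filter] at hx
      exact hx.2.2
  · intro c hc r hr
    have step : ∀ i ∈ Finset.range k, c i * w i ≤
        ∑ t ∈ Finset.range g, (if t ∈ X i then c i else 0) + if i ∈ S then c i else 0 := by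
      intro i hi
      have hik := Finset.mem_range.1 hi
      have hcount : w i ≤ ((Finset.range g).filter (· ∈ X i)).card + if i ∈ S then 1 else 0 := by
        by_cases hiS : i ∈ S
        · rw [if_pos hiS]
          refine (hX i hik).2.trans ?_
          have : X i ⊆ insert g ((Finset.range g).filter (· ∈ X i)) := by
            intro t ht
            have := Finset.mem_range.1 ((hX i hik).1 ht)
            simp only [Finset.mem_insert, Finset.mem_filter, Finset.mem_range]
            rcases Nat.lt_succ_iff_lt_or_eq.1 this with h | h
            · exact Or.inr ⟨h, ht⟩
            · exact Or.inl h
          exact (Finset.card_le_card this).trans (Finset.card_insert_le _ _)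
        · rw [if_neg hiS, add_zero]
          by_cases hw : 0 < w i
          · have hg : g ∉ X i := fun h => hiS (by simp [S, hik, h, hw])
            refine (hX i hik).2.trans (Finset.card_le_card ?_)
            intro t ht
            have := Finset.mem_range.1 ((hX i hik).1 ht)
            simp only [Finset.mem_filter, Finset.mem_range]
            rcases Nat.lt_succ_iff_lt_or_eq.1 this with h | h
            · exact ⟨h, ht⟩
            · exact absurd (h ▸ ht) hg
          · omega
      calc c i * w i ≤ c i * (((Finset.range g).filter (· ∈ X i)).card + if i ∈ S then 1 else 0) :=
            Nat.mul_le_mul_left _ hcount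
        _ = _ := by
            rw [mul_add, ← Finset.sum_filter, Finset.sum_const, smul_eq_mul, mul_comm (c i)]
            split_ifs <;> simp
    refine (Finset.sum_le_sum step).trans ?_
    rw [Finset.sum_add_distrib, Finset.sum_comm]
    refine Nat.add_le_add ?_ (le_of_eq ?_)
    · calc ∑ t ∈ Finset.range g, ∑ i ∈ Finset.range k, (if t ∈ X i then c i else 0)
          ≤ ∑ _t ∈ Finset.range g, r := by
            refine Finset.sum_le_sum fun t _ => ?_
            rw [← Finset.sum_filter]
            have hmemt : ∀ x ∈ (Finset.range k).filter (fun i => t ∈ X i), x < k ∧ t ∈ X x := by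
              intro x hx
              simpa using hx
            have hstt : ∀ x ∈ (Finset.range k).filter (fun i => t ∈ X i),
                ∀ y ∈ (Finset.range k).filter (fun i => t ∈ X i), x ≠ y →
                ¬ ClosedAdj G (R x) (R y) := fun x hx y hy =>
              hst t x (hmemt x hx).1 y (hmemt y hy).1 (hmemt x hx).2 (hmemt y hy).2
            obtain ⟨a, ha, b, hb, e, he, hst', -, hsum⟩ := hR.exists_triple _ id
              (hcard _ (fun x hx => (hmemt x hx).1) hstt) (fun x hx => (hmemt x hx).1) hstt
            exact (hsum c hc).le.trans (hr a ha b hb e he hst')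
        _ = r * g := by simp [mul_comm]
    · have := hsum c hc
      simp only [id] at this
      rw [← this, ← Finset.sum_filter]
      congr 1
      ext i
      simp only [S, Finset.mem_filter, Finset.mem_range]
      tauto

/-- Double counting: every color class of a proper coloring is a stable set, so it has weight at
most `r`. Passing to representatives is harmless, since twins have the same closed neighborhood. -/
theorem WeightBound.sum_le_of_coloring {c : ℕ → ℕ} {r : ℕ} (hr : WeightBound G k R c r)
    (hc : c k = 0) (hR : IsRepFamily G k R) (h₁ : ¬ (⊥ : SimpleGraph (Fin 4)).IsIndContained G)
    {cls : Fin n → ℕ} (hcls : ∀ v, cls v < k)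
    (htwin : ∀ (v : Fin n) (u : ℕ), ClosedAdj G (R (cls v)) u ↔ ClosedAdj G v u)
    {q : ℕ} (C : G.Coloring (Fin q)) : ∑ v, c (cls v) ≤ r * q := by
  classical
  rw [← Finset.sum_fiberwise_of_maps_to (g := C) (t := Finset.univ) (fun _ _ => Finset.mem_univ _)]
  calc ∑ t : Fin q, ∑ v with C v = t, c (cls v) ≤ ∑ _t : Fin q, r := by
        refine Finset.sum_le_sum fun t _ => ?_
        have hind : ∀ u ∈ Finset.univ.filter (fun v => C v = t),
            ∀ v ∈ Finset.univ.filter (fun v => C v = t), ¬ G.Adj u v := by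
          intro u hu v hv huv
          simp only [Finset.mem_filter, Finset.mem_univ, true_and] at hu hv
          exact C.valid huv (hu.trans hv.symm)
        obtain ⟨a, ha, b, hb, e, he, hst', -, hsum⟩ := hR.exists_triple _ cls
          (card_le_three_of_independent h₁ _ hind) (fun x _ => hcls x) (by
            intro u hu v hv hne h
            rw [htwin] at h
            have h' := (htwin v u).1 h.symm
            obtain ⟨_, _, h' | h'⟩ := h'
            · exact hne (Fin.ext h'.symm)
            · exact hind v hv u hu h')
        rw [hsum c hc]
        exact hr a ha b hb e he hst'
    _ = r * q := by simp [mul_comm]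

end Classes

/-! ### A small imperative language on top of the random access machine -/

namespace RAM

/-- A store: variables, arrays, and the cells of the memory that hold input and output. -/
structure Store where
  v : ℕ → ℕ
  a : ℕ → ℕ → ℕ
  inp : ℕ → ℕ

/-- Assign to a variable. -/
def Store.setV (s : Store) (x y : ℕ) : Store :=
  ⟨fun z => if z = x then y else s.v z, s.a, s.inp⟩

/-- Assign to an array entry. -/
def Store.setA (s : Store) (j i y : ℕ) : Store :=
  ⟨s.v, fun j' i' => if j' = j ∧ i' = i then y else s.a j' i', s.inp⟩

/-- Assign to an output cell. -/
def Store.setO (s : Store) (i y : ℕ) : Store :=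
  ⟨s.v, s.a, fun i' => if i' = i then y else s.inp i'⟩

section StoreSimp

variable (s : Store) (x y z j i : ℕ)

@[simp] theorem Store.setV_v : (s.setV x y).v z = if z = x then y else s.v z := rfl
@[simp] theorem Store.setV_a : (s.setV x y).a = s.a := rfl
@[simp] theorem Store.setV_inp : (s.setV x y).inp = s.inp := rfl
@[simp] theorem Store.setA_v : (s.setA j i y).v = s.v := rfl
@[simp] theorem Store.setA_a (j' i' : ℕ) :
    (s.setA j i y).a j' i' = if j' = j ∧ i' = i then y else s.a j' i' := rfl
@[simp] theorem Store.setA_a_of_ne {j j' : ℕ} (h : j' ≠ j) : (s.setA j i y).a j' = s.a j' := by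
  funext i'; simp [h]
@[simp] theorem Store.setA_inp : (s.setA j i y).inp = s.inp := rfl
@[simp] theorem Store.setO_v : (s.setO i y).v = s.v := rfl
@[simp] theorem Store.setO_a : (s.setO i y).a = s.a := rfl
@[simp] theorem Store.setO_inp (i' : ℕ) :
    (s.setO i y).inp i' = if i' = i then y else s.inp i' := rfl

end StoreSimp

/-- Expressions over a store. -/
inductive Ex where
  | num (k : ℕ)
  | var (x : ℕ)
  | add (e f : Ex)
  | sub (e f : Ex)
  | mul (e f : Ex)
  | div (e f : Ex)
  | arr (j : ℕ) (e : Ex)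
  | inp (e : Ex)

instance : Add Ex := ⟨Ex.add⟩
instance : Sub Ex := ⟨Ex.sub⟩
instance : Mul Ex := ⟨Ex.mul⟩
instance : Div Ex := ⟨Ex.div⟩
instance (k : ℕ) : OfNat Ex k := ⟨Ex.num k⟩

namespace Ex

/-- The value of an expression. -/
def eval (s : Store) : Ex → ℕ
  | num k => k
  | var x => s.v x
  | add e f => e.eval s + f.eval s
  | sub e f => e.eval s - f.eval s
  | mul e f => e.eval s * f.eval s
  | div e f => e.eval s / f.eval s
  | arr j e => s.a j (e.eval s)
  | inp e => s.inp (e.eval s)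

/-- The number of steps that the evaluation of an expression takes. -/
def cost : Ex → ℕ
  | num _ => 1
  | var _ => 2
  | add e f => e.cost + f.cost + 1
  | sub e f => e.cost + f.cost + 1
  | mul e f => e.cost + f.cost + 1
  | div e f => e.cost + f.cost + 1
  | arr _ e => e.cost + 6
  | inp e => e.cost + 1

/-- A degree such that the values are at most `V ^ deg` when the store is bounded by `V`. -/
def deg : Ex → ℕ
  | num _ => 1
  | var _ => 1
  | add e f => e.deg + f.deg
  | sub e f => e.deg + f.deg
  | mul e f => e.deg + f.deg
  | div e f => e.deg + f.deg
  | arr _ e => e.deg + 3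
  | inp e => e.deg

/-- The constants of an expression are bounded, and its array numbers are smaller than `16`. -/
def consts : Ex → Bool
  | num k => k ≤ 100000000
  | var _ => true
  | add e f => e.consts && f.consts
  | sub e f => e.consts && f.consts
  | mul e f => e.consts && f.consts
  | div e f => e.consts && f.consts
  | arr j e => decide (j < 16) && e.consts
  | inp e => e.consts

/-- Well-formedness of expressions. -/
def wf (e : Ex) : Bool := e.consts && decide (e.deg ≤ 40)

/-- The input cells that are read lie below the bound `B`. -/
def Ok (B : ℕ) (s : Store) : Ex → Prop
  | num _ => True
  | var _ => True
  | add e f => e.Ok B s ∧ f.Ok B s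
  | sub e f => e.Ok B s ∧ f.Ok B s
  | mul e f => e.Ok B s ∧ f.Ok B s
  | div e f => e.Ok B s ∧ f.Ok B s
  | arr _ e => e.Ok B s
  | inp e => e.Ok B s ∧ e.eval s < B

section Simp

variable (s : Store) (B : ℕ) (e f : Ex) (k x j : ℕ)

@[simp] theorem eval_ofNat : eval s (no_index (OfNat.ofNat k) : Ex) = OfNat.ofNat k := rfl
@[simp] theorem eval_var : eval s (var x) = s.v x := rfl
@[simp] theorem eval_hAdd : eval s (e + f) = eval s e + eval s f := rfl
@[simp] theorem eval_hSub : eval s (e - f) = eval s e - eval s f := rfl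
@[simp] theorem eval_hMul : eval s (e * f) = eval s e * eval s f := rfl
@[simp] theorem eval_hDiv : eval s (e / f) = eval s e / eval s f := rfl
@[simp] theorem eval_arr : eval s (arr j e) = s.a j (eval s e) := rfl
@[simp] theorem eval_inp : eval s (inp e) = s.inp (eval s e) := rfl
@[simp] theorem cost_ofNat : cost (no_index (OfNat.ofNat k) : Ex) = 1 := rfl
@[simp] theorem cost_var : cost (var x) = 2 := rfl
@[simp] theorem cost_hAdd : cost (e + f) = cost e + cost f + 1 := rfl
@[simp] theorem cost_hSub : cost (e - f) = cost e + cost f + 1 := rfl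
@[simp] theorem cost_hMul : cost (e * f) = cost e + cost f + 1 := rfl
@[simp] theorem cost_hDiv : cost (e / f) = cost e + cost f + 1 := rfl
@[simp] theorem cost_arr : cost (arr j e) = cost e + 6 := rfl
@[simp] theorem cost_inp : cost (inp e) = cost e + 1 := rfl
@[simp] theorem ok_ofNat : Ok B s (no_index (OfNat.ofNat k) : Ex) ↔ True := Iff.rfl
@[simp] theorem ok_var : Ok B s (var x) ↔ True := Iff.rfl
@[simp] theorem ok_hAdd : Ok B s (e + f) ↔ Ok B s e ∧ Ok B s f := Iff.rfl
@[simp] theorem ok_hSub : Ok B s (e - f) ↔ Ok B s e ∧ Ok B s f := Iff.rfl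
@[simp] theorem ok_hMul : Ok B s (e * f) ↔ Ok B s e ∧ Ok B s f := Iff.rfl
@[simp] theorem ok_hDiv : Ok B s (e / f) ↔ Ok B s e ∧ Ok B s f := Iff.rfl
@[simp] theorem ok_arr : Ok B s (arr j e) ↔ Ok B s e := Iff.rfl
@[simp] theorem ok_inp : Ok B s (inp e) ↔ Ok B s e ∧ eval s e < B := Iff.rfl

end Simp

/-! ### Compilation of expressions -/

/-- Turn the content of register `2 * d + 3` into the address of an entry of the array `j`. -/
def addr (j d : ℕ) : Program :=
  .seq (.assign (2 * d + 5) (.const 16)) <|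
  .seq (.assign (2 * d + 3) (.mul (2 * d + 3) (2 * d + 5))) <|
  .seq (.assign (2 * d + 3) (.add (2 * d + 3) 1)) <|
  .seq (.assign (2 * d + 5) (.const j)) (.assign (2 * d + 3) (.add (2 * d + 3) (2 * d + 5)))

/-- Evaluate an expression into the register `2 * d + 3`. Variables occupy the registers with even
numbers, and register `1` holds the beginning of the arrays. -/
def code : Ex → ℕ → Program
  | num k, d => .assign (2 * d + 3) (.const k)
  | var x, d => .seq (.assign (2 * d + 3) (.const 0)) (.assign (2 * d + 3) (.add (2 * d + 3) (2 * x)))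
  | add e f, d => .seq (e.code d) (.seq (f.code (d + 1))
      (.assign (2 * d + 3) (.add (2 * d + 3) (2 * d + 5))))
  | sub e f, d => .seq (e.code d) (.seq (f.code (d + 1))
      (.assign (2 * d + 3) (.sub (2 * d + 3) (2 * d + 5))))
  | mul e f, d => .seq (e.code d) (.seq (f.code (d + 1))
      (.assign (2 * d + 3) (.mul (2 * d + 3) (2 * d + 5))))
  | div e f, d => .seq (e.code d) (.seq (f.code (d + 1))
      (.assign (2 * d + 3) (.div (2 * d + 3) (2 * d + 5))))
  | arr j e, d => .seq (e.code d) (.seq (addr j d) (.assign (2 * d + 3) (.load (2 * d + 3))))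
  | inp e, d => .seq (e.code d) (.assign (2 * d + 3) (.load (2 * d + 3)))

end Ex

/-- The parameters of a run: the word size `W`, the address `B` where the arrays begin, and a bound
`V` for the values of variables and array entries. -/
structure Params where
  W : ℕ
  B : ℕ
  V : ℕ
  hB : B ≤ V
  hV : 100000000 ≤ V
  hW : V ^ 40 < W

/-- The machine configuration `σ` represents the store `s`. -/
structure Rep (P : Params) (s : Store) (σ : State) : Prop where
  base : σ.reg 1 = P.B
  var : ∀ x, σ.reg (2 * x) = s.v x
  arr : ∀ j < 16, ∀ i, σ.mem (P.B + 16 * i + j) = s.a j i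
  inp : ∀ i < P.B, σ.mem i = s.inp i

/-- All values of a store are bounded. -/
structure Bdd (P : Params) (s : Store) : Prop where
  var : ∀ x, s.v x ≤ P.V
  arr : ∀ j i, s.a j i ≤ P.V
  inp : ∀ i, s.inp i ≤ P.V

theorem Params.pow_le (P : Params) {p q : ℕ} (h : p ≤ q) : P.V ^ p ≤ P.V ^ q :=
  Nat.pow_le_pow_right (by have := P.hV; omega) h

theorem Params.lt_W (P : Params) {p x : ℕ} (hx : x ≤ P.V ^ p) (h : p ≤ 40) : x < P.W :=
  (hx.trans (P.pow_le h)).trans_lt P.hW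

theorem Params.add_le (P : Params) {p q x y : ℕ} (hp : 1 ≤ p) (hq : 1 ≤ q) (hx : x ≤ P.V ^ p)
    (hy : y ≤ P.V ^ q) : x + y ≤ P.V ^ (p + q) := by
  have h₁ : 2 ≤ P.V ^ p := (show 2 ≤ P.V ^ 1 by have := P.hV; simp; omega).trans (P.pow_le hp)
  have h₂ : 2 ≤ P.V ^ q := (show 2 ≤ P.V ^ 1 by have := P.hV; simp; omega).trans (P.pow_le hq)
  rw [pow_add]
  calc x + y ≤ P.V ^ p + P.V ^ q := Nat.add_le_add hx hy
    _ ≤ P.V ^ p * P.V ^ q := Nat.add_le_mul h₁ h₂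

theorem Ex.one_le_deg (e : Ex) : 1 ≤ e.deg := by
  induction e <;> simp [Ex.deg] <;> omega

theorem Ex.eval_le (P : Params) {s : Store} (hs : Bdd P s) (e : Ex) (he : e.consts = true) :
    e.eval s ≤ P.V ^ e.deg := by
  induction e with
  | num k => simp only [Ex.consts, decide_eq_true_eq] at he; simpa [Ex.eval, Ex.deg] using he.trans P.hV
  | var x => simpa [Ex.eval, Ex.deg] using hs.var x
  | add e f ihe ihf =>
    simp only [Ex.consts, Bool.and_eq_true] at he
    exact P.add_le e.one_le_deg f.one_le_deg (ihe he.1) (ihf he.2)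
  | sub e f ihe ihf =>
    simp only [Ex.consts, Bool.and_eq_true] at he
    exact (Nat.sub_le _ _).trans ((ihe he.1).trans (P.pow_le (Nat.le_add_right _ _)))
  | mul e f ihe ihf =>
    simp only [Ex.consts, Bool.and_eq_true] at he
    simp only [Ex.eval, Ex.deg, pow_add]
    exact Nat.mul_le_mul (ihe he.1) (ihf he.2)
  | div e f ihe ihf =>
    simp only [Ex.consts, Bool.and_eq_true] at he
    exact (Nat.div_le_self _ _).trans ((ihe he.1).trans (P.pow_le (Nat.le_add_right _ _)))
  | arr j e ih =>
    refine (hs.arr _ _).trans ?_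
    simpa using P.pow_le (p := 1) (q := (Ex.arr j e).deg) (Ex.one_le_deg _)
  | inp e ih =>
    refine (hs.inp _).trans ?_
    simpa using P.pow_le (p := 1) (q := (Ex.inp e).deg) (Ex.one_le_deg _)

/-- The registers with even numbers and those below `2 * d + 3` agree, and so does the memory. -/
structure Keeps (d : ℕ) (σ τ : State) : Prop where
  mem : τ.mem = σ.mem
  reg : ∀ x, (x % 2 = 0 ∨ x < 2 * d + 3) → τ.reg x = σ.reg x

theorem Keeps.rep {P : Params} {s : Store} {d : ℕ} {σ τ : State} (h : Keeps d σ τ)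
    (hσ : Rep P s σ) : Rep P s τ :=
  ⟨by rw [h.reg _ (Or.inr (by omega)), hσ.base], fun x => by rw [h.reg _ (Or.inl (by omega)), hσ.var],
    fun j hj i => by rw [h.mem, hσ.arr j hj], fun i hi => by rw [h.mem, hσ.inp i hi]⟩

theorem Keeps.trans {d d' : ℕ} {σ τ υ : State} (h : Keeps d σ τ) (h' : Keeps d' τ υ) (hd : d ≤ d') :
    Keeps d σ υ :=
  ⟨h'.mem.trans h.mem, fun x hx => (h'.reg x (hx.imp id fun h => by omega)).trans (h.reg x hx)⟩

theorem Keeps.assign {d r y : ℕ} {σ : State} (hr : r % 2 = 1) (hd : 2 * d + 3 ≤ r) :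
    Keeps d σ ⟨Function.update σ.reg r y, σ.mem⟩ :=
  ⟨rfl, fun x hx => Function.update_of_ne (by rintro rfl; omega) _ _⟩

theorem Params.addr_le (P : Params) {p x j : ℕ} (hp : 1 ≤ p) (hx : x ≤ P.V ^ p) (hj : j < 16) :
    16 * x + P.B + j ≤ P.V ^ (p + 2) := by
  have h₁ : P.V ^ 1 ≤ P.V ^ (p + 1) := P.pow_le (by omega)
  have h₂ : 16 * P.V ^ p ≤ P.V ^ (p + 1) := by
    rw [pow_succ, mul_comm]; exact Nat.mul_le_mul_left _ (by have := P.hV; omega)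
  have h₃ : 4 * P.V ^ (p + 1) ≤ P.V ^ (p + 2) := by
    rw [pow_succ _ (p + 1), mul_comm]; exact Nat.mul_le_mul_left _ (by have := P.hV; omega)
  have := P.hB
  have := P.hV
  rw [pow_one] at h₁
  omega

theorem exec_addr {P : Params} {d j p x : ℕ} {σ : State} (hj : j < 16) (hb : σ.reg 1 = P.B)
    (hx : σ.reg (2 * d + 3) = x) (hp : 1 ≤ p) (hp' : p ≤ 38) (hxp : x ≤ P.V ^ p) :
    ∃ τ, Exec P.W (Ex.addr j d) σ τ 5 ∧ Keeps d σ τ ∧ τ.reg (2 * d + 3) = P.B + 16 * x + j := by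
  have hle := P.addr_le hp hxp hj
  have hlt := P.lt_W hle (by omega)
  have hV := P.hV
  have hW : P.V < P.W := by simpa using P.lt_W (p := 1) (x := P.V) (by simp) (by omega)
  have e₁ : (2 * d + 5 = 2 * d + 3) = False := by simp
  have e₂ : (1 = 2 * d + 3) = False := by simp
  have e₃ : (1 = 2 * d + 5) = False := by simp
  have e₄ : (2 * d + 3 = 2 * d + 5) = False := by simp
  refine ⟨_, Exec.seq (s := 1) (t := 4) (Exec.assign _ _ _ ?_) (Exec.seq (s := 1) (t := 3)
    (Exec.assign _ _ _ ?_) (Exec.seq (s := 1) (t := 2) (Exec.assign _ _ _ ?_) (Exec.seq (s := 1)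
    (t := 1) (Exec.assign _ _ _ ?_) (Exec.assign _ _ _ ?_)))), ?_, ?_⟩
  · simp only [Expr.eval]; omega
  · simp only [Expr.eval, Function.update_apply, e₄, if_true, if_false, hx]; omega
  · simp only [Expr.eval, Function.update_apply, e₂, e₃, e₄, if_true, if_false, hx, hb]; omega
  · simp only [Expr.eval]; omega
  · simp only [Expr.eval, Function.update_apply, e₁, e₂, e₃, e₄, if_true, if_false, hx, hb]; omega
  · refine ⟨rfl, fun y hy => ?_⟩
    have h₁ : (y = 2 * d + 3) = False := by simp; omega
    have h₂ : (y = 2 * d + 5) = False := by simp; omega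
    simp only [Function.update_apply, h₁, h₂, if_false]
  · simp only [Expr.eval, Function.update_apply, e₁, e₂, e₃, e₄, if_true, if_false, hx, hb]; omega

theorem exec_binary {P : Params} {s : Store} {e f : Ex} {d : ℕ} {σ : State} {op : ℕ → ℕ → Expr}
    {y : ℕ} (hσ : Rep P s σ)
    (he : ∃ τ, Exec P.W (e.code d) σ τ e.cost ∧ Keeps d σ τ ∧ τ.reg (2 * d + 3) = e.eval s)
    (hf : ∀ τ, Rep P s τ → ∃ υ, Exec P.W (f.code (d + 1)) τ υ f.cost ∧ Keeps (d + 1) τ υ ∧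
      υ.reg (2 * (d + 1) + 3) = f.eval s)
    (hop : ∀ υ : State, υ.reg (2 * d + 3) = e.eval s → υ.reg (2 * d + 5) = f.eval s →
      (op (2 * d + 3) (2 * d + 5)).eval υ = y) (hy : y < P.W) :
    ∃ τ, Exec P.W (.seq (e.code d) (.seq (f.code (d + 1))
      (.assign (2 * d + 3) (op (2 * d + 3) (2 * d + 5))))) σ τ (e.cost + f.cost + 1) ∧
      Keeps d σ τ ∧ τ.reg (2 * d + 3) = y := by
  obtain ⟨τ, hτ, kτ, vτ⟩ := he
  obtain ⟨υ, hυ, kυ, vυ⟩ := hf τ (kτ.rep hσ)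
  have hval := hop υ (by rw [kυ.reg _ (Or.inr (by omega)), vτ]) vυ
  have hex := Exec.seq hτ (Exec.seq hυ (Exec.assign (2 * d + 3) (op (2 * d + 3) (2 * d + 5)) υ
    (by rw [hval]; exact hy)))
  rw [← add_assoc] at hex
  refine ⟨_, hex, ?_, ?_⟩
  · exact (kτ.trans kυ (by omega)).trans (Keeps.assign (by omega) le_rfl) le_rfl
  · simp [hval]

/-- The odd registers from `2 * d + 3` on serve as an evaluation stack. The left operand stays in
register `2 * d + 3` while the right one is evaluated at depth `d + 1`, which `Keeps` records; the
degree keeps all intermediate values below `V ^ 40 < W`. -/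
theorem Ex.exec_code {P : Params} {s : Store} (hs : Bdd P s) (e : Ex) :
    ∀ (d : ℕ) (σ : State), Rep P s σ → e.consts = true → e.deg ≤ 40 → e.Ok P.B s →
      ∃ τ, Exec P.W (e.code d) σ τ e.cost ∧ Keeps d σ τ ∧ τ.reg (2 * d + 3) = e.eval s := by
  have hW : P.V < P.W := by simpa using P.lt_W (p := 1) (x := P.V) (by simp) (by omega)
  have hV := P.hV
  induction e with
  | num k =>
    intro d σ hσ hc hd hok
    simp only [Ex.consts, decide_eq_true_eq] at hc
    exact ⟨_, Exec.assign _ _ _ (by simp only [Expr.eval]; omega),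
      Keeps.assign (by omega) le_rfl, by simp [Expr.eval, Ex.eval]⟩
  | var x =>
    intro d σ hσ hc hd hok
    have e₁ : (2 * x = 2 * d + 3) = False := by simp; omega
    have hval : (Expr.add (2 * d + 3) (2 * x)).eval
        ⟨Function.update σ.reg (2 * d + 3) ((Expr.const 0).eval σ), σ.mem⟩ = s.v x := by
      simp [Expr.eval, e₁, hσ.var]
    refine ⟨_, Exec.seq (s := 1) (t := 1) (Exec.assign _ _ _ ?_) (Exec.assign _ _ _ ?_), ?_, ?_⟩
    · simp only [Expr.eval]; omega
    · rw [hval]; have := hs.var x; omega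
    · exact (Keeps.assign (by omega) le_rfl).trans (Keeps.assign (by omega) le_rfl) le_rfl
    · simp [hval, Ex.eval]
  | add e f ihe ihf =>
    intro d σ hσ hc hd hok
    have hle := Ex.eval_le P hs _ hc
    simp only [Ex.consts, Bool.and_eq_true] at hc
    simp only [Ex.deg] at hd
    exact exec_binary (op := Expr.add) hσ (ihe d σ hσ hc.1 (by omega) hok.1)
      (fun τ hτ => ihf _ τ hτ hc.2 (by omega) hok.2)
      (fun υ h₁ h₂ => by simp [Expr.eval, h₁, h₂, Ex.eval]) (P.lt_W hle hd)
  | sub e f ihe ihf =>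
    intro d σ hσ hc hd hok
    have hle := Ex.eval_le P hs _ hc
    simp only [Ex.consts, Bool.and_eq_true] at hc
    simp only [Ex.deg] at hd
    exact exec_binary (op := Expr.sub) hσ (ihe d σ hσ hc.1 (by omega) hok.1)
      (fun τ hτ => ihf _ τ hτ hc.2 (by omega) hok.2)
      (fun υ h₁ h₂ => by simp [Expr.eval, h₁, h₂, Ex.eval]) (P.lt_W hle hd)
  | mul e f ihe ihf =>
    intro d σ hσ hc hd hok
    have hle := Ex.eval_le P hs _ hc
    simp only [Ex.consts, Bool.and_eq_true] at hc
    simp only [Ex.deg] at hd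
    exact exec_binary (op := Expr.mul) hσ (ihe d σ hσ hc.1 (by omega) hok.1)
      (fun τ hτ => ihf _ τ hτ hc.2 (by omega) hok.2)
      (fun υ h₁ h₂ => by simp [Expr.eval, h₁, h₂, Ex.eval]) (P.lt_W hle hd)
  | div e f ihe ihf =>
    intro d σ hσ hc hd hok
    have hle := Ex.eval_le P hs _ hc
    simp only [Ex.consts, Bool.and_eq_true] at hc
    simp only [Ex.deg] at hd
    exact exec_binary (op := Expr.div) hσ (ihe d σ hσ hc.1 (by omega) hok.1)
      (fun τ hτ => ihf _ τ hτ hc.2 (by omega) hok.2)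
      (fun υ h₁ h₂ => by simp [Expr.eval, h₁, h₂, Ex.eval]) (P.lt_W hle hd)
  | arr j e ih =>
    intro d σ hσ hc hd hok
    simp only [Ex.consts, Bool.and_eq_true, decide_eq_true_eq] at hc
    simp only [Ex.deg] at hd
    obtain ⟨τ, hτ, kτ, vτ⟩ := ih d σ hσ hc.2 (by omega) hok
    obtain ⟨υ, hυ, kυ, vυ⟩ := exec_addr hc.1 (kτ.rep hσ).base vτ e.one_le_deg (by omega)
      (Ex.eval_le P hs e hc.2)
    have hval : (Expr.load (2 * d + 3)).eval υ = s.a j (e.eval s) := by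
      rw [Expr.eval, vυ, (kυ.rep (kτ.rep hσ)).arr j hc.1]
    refine ⟨_, Exec.seq hτ (Exec.seq hυ (Exec.assign _ _ _ ?_)), ?_, ?_⟩
    · rw [hval]; exact (hs.arr _ _).trans_lt hW
    · exact (kτ.trans kυ le_rfl).trans (Keeps.assign (by omega) le_rfl) le_rfl
    · simp [hval, Ex.eval]
  | inp e ih =>
    intro d σ hσ hc hd hok
    simp only [Ex.consts] at hc
    simp only [Ex.deg] at hd
    obtain ⟨τ, hτ, kτ, vτ⟩ := ih d σ hσ hc hd hok.1
    have hval : (Expr.load (2 * d + 3)).eval τ = s.inp (e.eval s) := by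
      rw [Expr.eval, vτ, (kτ.rep hσ).inp _ hok.2]
    refine ⟨_, Exec.seq hτ (Exec.assign _ _ _ ?_), ?_, ?_⟩
    · rw [hval]; exact (hs.inp _).trans_lt hW
    · exact kτ.trans (Keeps.assign (by omega) le_rfl) le_rfl
    · simp [hval, Ex.eval]

end RAM

/-! ### Commands and a program logic with step counts -/

namespace RAM

/-- Comparisons of two expressions. -/
inductive Tst where
  | lt (e f : Ex)
  | eq (e f : Ex)

/-- The left-hand side of a comparison. -/
def Tst.lhs : Tst → Ex
  | lt e _ => e
  | eq e _ => e

/-- The right-hand side of a comparison. -/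
def Tst.rhs : Tst → Ex
  | lt _ f => f
  | eq _ f => f

/-- The outcome of a comparison. -/
def Tst.holds (s : Store) : Tst → Prop
  | lt e f => e.eval s < f.eval s
  | eq e f => e.eval s = f.eval s

/-- The machine test for a comparison. -/
def Tst.code : Tst → Test
  | lt _ _ => .lt 3 5
  | eq _ _ => .eq 3 5

/-- Commands. `put j e f` writes the value of `f` into entry `e` of the array `j`, `out e f`
writes it into the output cell `e`, and `loop x y c` runs `c` for all values of the variable `x`
below that of the variable `y`. -/
inductive Cmd where
  | skip
  | set (x : ℕ) (e : Ex)
  | put (j : ℕ) (e f : Ex)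
  | out (e f : Ex)
  | seq (c d : Cmd)
  | ite (t : Tst) (c d : Cmd)
  | loop (x y : ℕ) (c : Cmd)

namespace Cmd

/-- Sequential composition of a list of commands. -/
def block : List Cmd → Cmd
  | [] => skip
  | [c] => c
  | c :: d :: l => seq c (block (d :: l))

/-- The assignment of an expression to a variable. -/
def setCode (x : ℕ) (e : Ex) : Program :=
  .seq (e.code 0) (.seq (.assign 5 (.const 0)) (.assign (2 * x) (.add 3 5)))

/-- The machine program for a command. -/
def compile : Cmd → Program
  | skip => .skip
  | set x e => setCode x e
  | put j e f => .seq (e.code 0) (.seq (Ex.addr j 0) (.seq (f.code 1) (.store 3 5)))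
  | out e f => .seq (e.code 0) (.seq (f.code 1) (.store 3 5))
  | seq c d => .seq c.compile d.compile
  | ite t c d => .seq (t.lhs.code 0) (.seq (t.rhs.code 1) (.ite t.code c.compile d.compile))
  | loop x y c => .seq (setCode x 0)
      (.loop (.lt (2 * x) (2 * y)) (.seq c.compile (setCode x (.var x + 1))))

/-- The variables that a command may change. -/
def vars : Cmd → List ℕ
  | skip => []
  | set x _ => [x]
  | put _ _ _ => []
  | out _ _ => []
  | seq c d => c.vars ++ d.vars
  | ite _ c d => c.vars ++ d.vars
  | loop x _ c => x :: c.vars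

/-- The arrays that a command may change; the number `16` stands for the output cells. -/
def arrs : Cmd → List ℕ
  | skip => []
  | set _ _ => []
  | put j _ _ => [j]
  | out _ _ => [16]
  | seq c d => c.arrs ++ d.arrs
  | ite _ c d => c.arrs ++ d.arrs
  | loop _ _ c => c.arrs

end Cmd

/-- The stores `s` and `s'` differ only in variables and arrays that `c` may change. -/
structure Frame (c : Cmd) (s s' : Store) : Prop where
  v : ∀ x, x ∉ c.vars → s'.v x = s.v x
  a : ∀ j, j ∉ c.arrs → s'.a j = s.a j
  inp : 16 ∉ c.arrs → s'.inp = s.inp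

theorem Frame.refl (c : Cmd) (s : Store) : Frame c s s :=
  ⟨fun _ _ => rfl, fun _ _ => rfl, fun _ => rfl⟩

theorem Frame.trans {c d e : Cmd} {s s' s'' : Store} (h : Frame c s s') (h' : Frame d s' s'')
    (hcv : c.vars ⊆ e.vars) (hdv : d.vars ⊆ e.vars) (hca : c.arrs ⊆ e.arrs)
    (hda : d.arrs ⊆ e.arrs) : Frame e s s'' :=
  ⟨fun x hx => (h'.v x fun hh => hx (hdv hh)).trans (h.v x fun hh => hx (hcv hh)),
    fun x hx => (h'.a x fun hh => hx (hda hh)).trans (h.a x fun hh => hx (hca hh)),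
    fun hx => (h'.inp fun hh => hx (hda hh)).trans (h.inp fun hh => hx (hca hh))⟩

/-- Started in the store `s`, the command `c` halts within `T` steps in a store with the
property `Q`. -/
def Runs (P : Params) (c : Cmd) (s : Store) (T : ℕ) (Q : Store → Prop) : Prop :=
  Bdd P s → ∀ σ, Rep P s σ → ∃ τ t s', Exec P.W c.compile σ τ t ∧ t ≤ T ∧ Rep P s' τ ∧ Bdd P s' ∧
    Frame c s s' ∧ Q s'

section Rules

variable {P : Params} {s : Store} {T : ℕ} {Q : Store → Prop}

theorem Runs.mono {c : Cmd} {T' : ℕ} {Q' : Store → Prop} (h : Runs P c s T' Q') (hT : T' ≤ T)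
    (hQ : ∀ s', Q' s' → Q s') : Runs P c s T Q := by
  intro hs σ hσ
  obtain ⟨τ, t, s', h₁, h₂, h₃, h₄, h₅, h₆⟩ := h hs σ hσ
  exact ⟨τ, t, s', h₁, h₂.trans hT, h₃, h₄, h₅, hQ s' h₆⟩

theorem Runs.mono_frame {c : Cmd} {T' : ℕ} {Q' : Store → Prop} (h : Runs P c s T' Q')
    (hT : T' ≤ T) (hQ : ∀ s', Frame c s s' → Q' s' → Q s') : Runs P c s T Q := by
  intro hs σ hσ
  obtain ⟨τ, t, s', h₁, h₂, h₃, h₄, h₅, h₆⟩ := h hs σ hσ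
  exact ⟨τ, t, s', h₁, h₂.trans hT, h₃, h₄, h₅, hQ s' h₅ h₆⟩

theorem Runs.of_bdd {c : Cmd} (h : Bdd P s → Runs P c s T Q) : Runs P c s T Q :=
  fun hs => h hs hs

theorem Runs.skip (h : Q s) : Runs P .skip s 0 Q := fun hs σ hσ =>
  ⟨σ, 0, s, Exec.skip σ, le_rfl, hσ, hs, Frame.refl _ _, h⟩

/-- The rest of the program is part of the postcondition, so that a proof follows the program from
front to back. -/
theorem Runs.seq {c d : Cmd} {T₁ T₂ : ℕ} (h : Runs P c s T₁ fun s' => Runs P d s' T₂ Q) :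
    Runs P (.seq c d) s (T₁ + T₂) Q := by
  intro hs σ hσ
  obtain ⟨τ, t, s', h₁, h₂, h₃, h₄, h₅, h₆⟩ := h hs σ hσ
  obtain ⟨υ, t', s'', k₁, k₂, k₃, k₄, k₅, k₆⟩ := h₆ h₄ τ h₃
  exact ⟨υ, t + t', s'', Exec.seq h₁ k₁, Nat.add_le_add h₂ k₂, k₃, k₄,
    h₅.trans k₅ (by simp [Cmd.vars]) (by simp [Cmd.vars]) (by simp [Cmd.arrs])
      (by simp [Cmd.arrs]), k₆⟩

theorem exec_setCode {x : ℕ} {e : Ex} {σ : State} (hs : Bdd P s) (hσ : Rep P s σ)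
    (he : e.wf = true) (hok : e.Ok P.B s) (hv : e.eval s ≤ P.V) :
    ∃ τ, Exec P.W (Cmd.setCode x e) σ τ (e.cost + 2) ∧ Rep P (s.setV x (e.eval s)) τ ∧
      Bdd P (s.setV x (e.eval s)) := by
  simp only [Ex.wf, Bool.and_eq_true, decide_eq_true_eq] at he
  obtain ⟨τ, hτ, kτ, vτ⟩ := e.exec_code hs 0 σ hσ he.1 he.2 hok
  have hW : P.V < P.W := by simpa using P.lt_W (p := 1) (x := P.V) (by simp) (by omega)
  have vτ' : τ.reg 3 = e.eval s := vτ
  refine ⟨_, Exec.seq hτ (Exec.seq (s := 1) (t := 1) (Exec.assign _ _ _ ?_)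
    (Exec.assign _ _ _ ?_)), ?_, ?_⟩
  · simp only [Expr.eval]; have := P.hV; omega
  · simp [Expr.eval, vτ']; omega
  · have hrep := kτ.rep hσ
    constructor
    · have : 1 ≠ 2 * x := by omega
      simp [this, hrep.base]
    · intro y
      have h₁ : 2 * y ≠ 5 := by omega
      by_cases hyx : y = x
      · subst hyx; simp [Expr.eval, vτ']
      · have h₂ : 2 * y ≠ 2 * x := by omega
        simp [hyx, h₁, hrep.var]
    · exact hrep.arr
    · exact hrep.inp
  · refine ⟨fun y => ?_, hs.arr, hs.inp⟩
    simp only [Store.setV_v]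
    split_ifs
    · exact hv
    · exact hs.var y

theorem Runs.set {x : ℕ} {e : Ex} (he : e.wf = true) (hok : e.Ok P.B s) (hv : e.eval s ≤ P.V)
    (hQ : Q (s.setV x (e.eval s))) : Runs P (.set x e) s (e.cost + 2) Q := by
  intro hs σ hσ
  obtain ⟨τ, h₁, h₂, h₃⟩ := exec_setCode (x := x) hs hσ he hok hv
  refine ⟨τ, _, _, h₁, le_rfl, h₂, h₃, ⟨fun y hy => ?_, fun _ _ => rfl, fun _ => rfl⟩, hQ⟩
  simp only [Cmd.vars, List.mem_singleton] at hy
  simp [hy]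

theorem Runs.put {j : ℕ} {e f : Ex} (hj : j < 16) (he : e.wf = true) (hed : e.deg ≤ 38)
    (hf : f.wf = true) (hok : e.Ok P.B s) (hok' : f.Ok P.B s) (hv : f.eval s ≤ P.V)
    (hQ : Q (s.setA j (e.eval s) (f.eval s))) :
    Runs P (.put j e f) s (e.cost + f.cost + 6) Q := by
  intro hs σ hσ
  simp only [Ex.wf, Bool.and_eq_true, decide_eq_true_eq] at he hf
  obtain ⟨τ, hτ, kτ, vτ⟩ := e.exec_code hs 0 σ hσ he.1 he.2 hok
  have hW : P.V < P.W := by simpa using P.lt_W (p := 1) (x := P.V) (by simp) (by omega)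
  obtain ⟨υ, hυ, kυ, vυ⟩ := exec_addr hj (kτ.rep hσ).base vτ e.one_le_deg hed
    (Ex.eval_le P hs e he.1)
  obtain ⟨φ, hφ, kφ, vφ⟩ := f.exec_code hs 1 υ (kυ.rep (kτ.rep hσ)) hf.1 hf.2 hok'
  have v₅ : φ.reg 5 = f.eval s := vφ
  have v₃ : φ.reg 3 = P.B + 16 * e.eval s + j := by
    rw [kφ.reg 3 (Or.inr (by omega))]; exact vυ
  have hrep := kφ.rep (kυ.rep (kτ.rep hσ))
  have hex := Exec.seq hτ (Exec.seq hυ (Exec.seq hφ (Exec.store 3 5 φ (by rw [v₅]; omega))))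
  rw [v₃, v₅] at hex
  refine ⟨_, _, s.setA j (e.eval s) (f.eval s), hex, by omega, ⟨hrep.base, hrep.var, ?_, ?_⟩, ?_,
    ⟨fun _ _ => rfl, fun y hy => ?_, fun _ => rfl⟩, hQ⟩
  · intro j' hj' i
    dsimp only
    rw [Store.setA_a, Function.update_apply]
    by_cases h : j' = j ∧ i = e.eval s
    · rw [if_pos h, if_pos (by rw [h.1, h.2])]
    -- The arrays are interleaved with stride 16, so for array numbers below 16 the addresses of
    -- distinct entries differ.
    · rw [if_neg h, if_neg (by omega), hrep.arr j' hj']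
  · intro i hi
    dsimp only
    rw [Function.update_apply, if_neg (by omega), hrep.inp i hi]
    rfl
  · refine ⟨hs.var, fun j' i => ?_, hs.inp⟩
    rw [Store.setA_a]
    split_ifs
    · exact hv
    · exact hs.arr _ _
  · simp only [Cmd.arrs, List.mem_singleton] at hy
    funext i
    simp [hy]

theorem Runs.out {e f : Ex} (he : e.wf = true)
    (hf : f.wf = true) (hok : e.Ok P.B s) (hok' : f.Ok P.B s) (hB : e.eval s < P.B)
    (hv : f.eval s ≤ P.V) (hQ : Q (s.setO (e.eval s) (f.eval s))) :
    Runs P (.out e f) s (e.cost + f.cost + 1) Q := by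
  intro hs σ hσ
  simp only [Ex.wf, Bool.and_eq_true, decide_eq_true_eq] at he hf
  obtain ⟨τ, hτ, kτ, vτ⟩ := e.exec_code hs 0 σ hσ he.1 he.2 hok
  have hW : P.V < P.W := by simpa using P.lt_W (p := 1) (x := P.V) (by simp) (by omega)
  obtain ⟨φ, hφ, kφ, vφ⟩ := f.exec_code hs 1 τ (kτ.rep hσ) hf.1 hf.2 hok'
  have v₅ : φ.reg 5 = f.eval s := vφ
  have v₃ : φ.reg 3 = e.eval s := by
    rw [kφ.reg 3 (Or.inr (by omega))]; exact vτ
  have hrep := kφ.rep (kτ.rep hσ)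
  have hex := Exec.seq hτ (Exec.seq hφ (Exec.store 3 5 φ (by rw [v₅]; omega)))
  rw [v₃, v₅] at hex
  refine ⟨_, _, s.setO (e.eval s) (f.eval s), hex, by omega, ⟨hrep.base, hrep.var, ?_, ?_⟩, ?_,
    ⟨fun _ _ => rfl, fun y hy => rfl, fun h => absurd (by simp [Cmd.arrs]) h⟩, hQ⟩
  · intro j' hj' i
    dsimp only
    rw [Store.setO_a, Function.update_apply, if_neg (by omega), hrep.arr j' hj']
  · intro i hi
    dsimp only
    rw [Store.setO_inp, Function.update_apply, hrep.inp i hi]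
  · refine ⟨hs.var, hs.arr, fun i => ?_⟩
    rw [Store.setO_inp]
    split_ifs
    · exact hv
    · exact hs.inp _

theorem Runs.ite {t : Tst} {c d : Cmd} {T₁ T₂ : ℕ} (he : t.lhs.wf = true) (hf : t.rhs.wf = true)
    (hok : t.lhs.Ok P.B s) (hok' : t.rhs.Ok P.B s) (hc : t.holds s → Runs P c s T₁ Q)
    (hd : ¬ t.holds s → Runs P d s T₂ Q) :
    Runs P (.ite t c d) s (t.lhs.cost + t.rhs.cost + 2 + max T₁ T₂) Q := by
  intro hs σ hσ
  simp only [Ex.wf, Bool.and_eq_true, decide_eq_true_eq] at he hf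
  obtain ⟨τ, hτ, kτ, vτ⟩ := t.lhs.exec_code hs 0 σ hσ he.1 he.2 hok
  obtain ⟨φ, hφ, kφ, vφ⟩ := t.rhs.exec_code hs 1 τ (kτ.rep hσ) hf.1 hf.2 hok'
  have v₅ : φ.reg 5 = t.rhs.eval s := vφ
  have v₃ : φ.reg 3 = t.lhs.eval s := by
    rw [kφ.reg 3 (Or.inr (by omega))]; exact vτ
  have hrep := kφ.rep (kτ.rep hσ)
  have htest : t.code.holds φ ↔ t.holds s := by
    cases t <;> simp only [Tst.code, Test.holds, Tst.holds, v₅, v₃] <;> rfl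
  by_cases h : t.holds s
  · obtain ⟨υ, u, s', h₁, h₂, h₃, h₄, h₅, h₆⟩ := hc h hs φ hrep
    exact ⟨υ, _, s', Exec.seq hτ (Exec.seq hφ (Exec.iteTrue (htest.2 h) h₁)), by omega, h₃, h₄,
      h₅.trans (Frame.refl c s') (by simp [Cmd.vars]) (by simp [Cmd.vars]) (by simp [Cmd.arrs])
      (by simp [Cmd.arrs]), h₆⟩
  · obtain ⟨υ, u, s', h₁, h₂, h₃, h₄, h₅, h₆⟩ := hd h hs φ hrep
    exact ⟨υ, _, s', Exec.seq hτ (Exec.seq hφ (Exec.iteFalse (mt htest.1 h) h₁)), by omega, h₃, h₄,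
      h₅.trans (Frame.refl d s') (by simp [Cmd.vars]) (by simp [Cmd.vars]) (by simp [Cmd.arrs])
      (by simp [Cmd.arrs]), h₆⟩

/-- The extra 8 steps of a passage are the test, the jump and the six steps that increment `x`; the
final 4 are the initialization and the last test. The cost may depend on the passage, as sums of
vertex degrees are needed later. -/
theorem Runs.loop {x y N : ℕ} {c : Cmd} {T : ℕ → ℕ} (I : ℕ → Store → Prop) (hx : x ∉ c.vars)
    (hy : y ∉ c.vars) (hxy : y ≠ x) (hN : s.v y = N) (h0 : I 0 (s.setV x 0))
    (hstep : ∀ i < N, ∀ s', Frame (.loop x y c) s s' → s'.v x = i → I i s' →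
      Runs P c s' (T i) fun s'' => I (i + 1) (s''.setV x (i + 1)))
    (hQ : ∀ s', Frame (.loop x y c) s s' → s'.v x = N → I N s' → Q s') :
    Runs P (.loop x y c) s (∑ i ∈ Finset.range N, (T i + 8) + 4) Q := by
  intro hs σ hσ
  -- Induction on the number `m` of remaining passages.
  have main : ∀ m i, i + m = N → ∀ s', Frame (.loop x y c) s s' → s'.v x = i → I i s' →
      Bdd P s' → ∀ σ', Rep P s' σ' → ∃ τ t s'', Exec P.W (.loop (.lt (2 * x) (2 * y))
        (.seq c.compile (Cmd.setCode x (.var x + 1)))) σ' τ t ∧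
        t ≤ ∑ i ∈ Finset.Ico i N, (T i + 8) + 1 ∧ Rep P s'' τ ∧ Bdd P s'' ∧
        Frame (.loop x y c) s s'' ∧ Q s'' := by
    intro m
    induction m with
    | zero =>
      intro i hi s' hfr hsx hI hs' σ' hσ'
      obtain rfl : i = N := by omega
      refine ⟨σ', 1, s', Exec.loopStop ?_, by simp, hσ', hs', hfr, hQ s' hfr hsx hI⟩
      have : s'.v y = i := by rw [hfr.v y (by simp [Cmd.vars, hxy, hy]), hN]
      simp [Test.holds, hσ'.var, this, hsx]
    | succ m ih =>
      intro i hi s' hfr hsx hI hs' σ' hσ'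
      have hsy : s'.v y = N := by rw [hfr.v y (by simp [Cmd.vars, hxy, hy]), hN]
      obtain ⟨τ, t, s'', h₁, h₂, h₃, h₄, h₅, h₆⟩ := hstep i (by omega) s' hfr hsx hI hs' σ' hσ'
      have hval : (Ex.var x + 1 : Ex).eval s'' = i + 1 := by simp [h₅.v x hx, hsx]
      have hNV : N ≤ P.V := hN ▸ hs.var y
      obtain ⟨υ, k₁, k₂, k₃⟩ := exec_setCode (x := x) (e := .var x + 1) h₄ h₃ rfl (by simp)
        (by rw [hval]; omega)
      rw [hval] at k₂ k₃
      obtain ⟨φ, u, s₃, l₁, l₂, l₃, l₄, l₅, l₆⟩ := ih (i + 1) (by omega) (s''.setV x (i + 1))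
        ⟨fun z hz => by
          have hz' : z ≠ x ∧ z ∉ c.vars := by simpa [Cmd.vars] using hz
          simp only [Store.setV_v, hz'.1, if_false]
          rw [h₅.v z hz'.2, hfr.v z hz],
          fun z hz => (h₅.a z hz).trans (hfr.a z hz), fun hz => (h₅.inp hz).trans (hfr.inp hz)⟩
        (by simp) h₆ k₃ υ k₂
      refine ⟨φ, _, s₃, Exec.loopStep ?_ (Exec.seq h₁ k₁) l₁, ?_, l₃, l₄, l₅, l₆⟩
      · simp only [Test.holds, hσ'.var, hsy, hsx]; omega
      · rw [Finset.sum_eq_sum_Ico_succ_bot (by omega)]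
        have : (Ex.var x + 1 : Ex).cost = 4 := rfl
        omega
  obtain ⟨τ, h₁, h₂, h₃⟩ := exec_setCode (x := x) (e := 0) hs hσ rfl (by simp) (Nat.zero_le _)
  obtain ⟨υ, t, s', k₁, k₂, k₃, k₄, k₅, k₆⟩ := main N 0 (by omega) (s.setV x 0)
    ⟨fun z hz => by
      have hz' : z ≠ x := by rintro rfl; exact hz (by simp [Cmd.vars])
      simp [hz'], fun _ _ => rfl, fun _ => rfl⟩ (by simp) h0 h₃ τ h₂
  refine ⟨υ, _, s', Exec.seq h₁ k₁, ?_, k₃, k₄, k₅, k₆⟩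
  rw [Finset.range_eq_Ico]
  have : (0 : Ex).cost = 1 := rfl
  omega

theorem Runs.loop_const {x y N : ℕ} {c : Cmd} {T : ℕ} (I : ℕ → Store → Prop) (hx : x ∉ c.vars)
    (hy : y ∉ c.vars) (hxy : y ≠ x) (hN : s.v y = N) (h0 : I 0 (s.setV x 0))
    (hstep : ∀ i < N, ∀ s', Frame (.loop x y c) s s' → s'.v x = i → I i s' →
      Runs P c s' T fun s'' => I (i + 1) (s''.setV x (i + 1)))
    (hQ : ∀ s', Frame (.loop x y c) s s' → s'.v x = N → I N s' → Q s') :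
    Runs P (.loop x y c) s (N * (T + 8) + 4) Q := by
  simpa using Runs.loop (T := fun _ => T) I hx hy hxy hN h0 hstep hQ

/-! Rules in which the number of steps is a budget that is used up. -/

theorem Runs.done {T : ℕ} (h : Q s) : Runs P .skip s T Q :=
  (Runs.skip h).mono (Nat.zero_le _) fun _ h => h

theorem Runs.andThen {c d : Cmd} (T₁ : ℕ) (hT : T₁ ≤ T)
    (h : Runs P c s T₁ fun s' => Runs P d s' (T - T₁) Q) : Runs P (.seq c d) s T Q :=
  (Runs.seq h).mono (by omega) fun _ h => h

theorem Runs.cut {c d : Cmd} (T₁ : ℕ) (Q₁ : Store → Prop) (hT : T₁ ≤ T) (h : Runs P c s T₁ Q₁)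
    (h' : ∀ s', Frame c s s' → Q₁ s' → Runs P d s' (T - T₁) Q) : Runs P (.seq c d) s T Q :=
  Runs.andThen T₁ hT (h.mono_frame le_rfl h')

/-- Forgets how a store has arisen except for the facts in `F`, which keeps nested updates from
piling up. -/
theorem Runs.generalize {c : Cmd} (F : Store → Prop) (hF : F s)
    (h : ∀ s', F s' → Runs P c s' T Q) : Runs P c s T Q :=
  h s hF

theorem Runs.set' {x : ℕ} {e : Ex} (hv : e.eval s ≤ P.V) (hQ : Q (s.setV x (e.eval s)))
    (he : e.wf = true := by rfl) (hok : e.Ok P.B s := by simp) (hT : e.cost + 2 ≤ T := by simp) :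
    Runs P (.set x e) s T Q :=
  (Runs.set he hok hv hQ).mono hT fun _ h => h

theorem Runs.set_seq {x : ℕ} {e : Ex} {d : Cmd} (hv : e.eval s ≤ P.V)
    (h : Runs P d (s.setV x (e.eval s)) (T - (e.cost + 2)) Q)
    (he : e.wf = true := by rfl) (hok : e.Ok P.B s := by simp) (hT : e.cost + 2 ≤ T := by simp) :
    Runs P (.seq (.set x e) d) s T Q :=
  Runs.andThen _ hT (Runs.set he hok hv h)

theorem Runs.put' {j : ℕ} {e f : Ex} (hv : f.eval s ≤ P.V)
    (hQ : Q (s.setA j (e.eval s) (f.eval s)))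
    (hj : j < 16 := by decide) (he : e.wf = true := by rfl) (hed : e.deg ≤ 38 := by decide)
    (hf : f.wf = true := by rfl) (hok : e.Ok P.B s := by simp) (hok' : f.Ok P.B s := by simp)
    (hT : e.cost + f.cost + 6 ≤ T := by simp) : Runs P (.put j e f) s T Q :=
  (Runs.put hj he hed hf hok hok' hv hQ).mono hT fun _ h => h

theorem Runs.put_seq {j : ℕ} {e f : Ex} {d : Cmd} (hv : f.eval s ≤ P.V)
    (h : Runs P d (s.setA j (e.eval s) (f.eval s)) (T - (e.cost + f.cost + 6)) Q)
    (hj : j < 16 := by decide) (he : e.wf = true := by rfl) (hed : e.deg ≤ 38 := by decide)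
    (hf : f.wf = true := by rfl) (hok : e.Ok P.B s := by simp) (hok' : f.Ok P.B s := by simp)
    (hT : e.cost + f.cost + 6 ≤ T := by simp) :
    Runs P (.seq (.put j e f) d) s T Q :=
  Runs.andThen _ hT (Runs.put hj he hed hf hok hok' hv h)

theorem Runs.ite_eq {e f : Ex} {c d : Cmd}
    (hc : e.eval s = f.eval s → Runs P c s (T - (e.cost + f.cost + 2)) Q)
    (hd : e.eval s ≠ f.eval s → Runs P d s (T - (e.cost + f.cost + 2)) Q)
    (he : e.wf = true := by rfl) (hf : f.wf = true := by rfl)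
    (hok : e.Ok P.B s := by simp) (hok' : f.Ok P.B s := by simp)
    (hT : e.cost + f.cost + 2 ≤ T := by simp) : Runs P (.ite (.eq e f) c d) s T Q :=
  (Runs.ite (t := .eq e f) he hf hok hok' hc hd).mono (by simp [Tst.lhs, Tst.rhs]; omega) fun _ h => h

theorem Runs.ite_lt {e f : Ex} {c d : Cmd}
    (hc : e.eval s < f.eval s → Runs P c s (T - (e.cost + f.cost + 2)) Q)
    (hd : ¬ e.eval s < f.eval s → Runs P d s (T - (e.cost + f.cost + 2)) Q)
    (he : e.wf = true := by rfl) (hf : f.wf = true := by rfl)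
    (hok : e.Ok P.B s := by simp) (hok' : f.Ok P.B s := by simp)
    (hT : e.cost + f.cost + 2 ≤ T := by simp) : Runs P (.ite (.lt e f) c d) s T Q :=
  (Runs.ite (t := .lt e f) he hf hok hok' hc hd).mono (by simp [Tst.lhs, Tst.rhs]; omega) fun _ h => h

theorem Runs.for {x y : ℕ} {c : Cmd} (N : ℕ) (T₁ : ℕ) (I : ℕ → Store → Prop) (hN : s.v y = N)
    (hT : N * (T₁ + 8) + 4 ≤ T) (h0 : I 0 (s.setV x 0))
    (hstep : ∀ i < N, ∀ s', Frame (.loop x y c) s s' → s'.v x = i → I i s' →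
      Runs P c s' T₁ fun s'' => I (i + 1) (s''.setV x (i + 1)))
    (hQ : ∀ s', Frame (.loop x y c) s s' → s'.v x = N → I N s' → Q s')
    (hx : x ∉ c.vars := by decide) (hy : y ∉ c.vars := by decide) (hxy : y ≠ x := by decide) :
    Runs P (.loop x y c) s T Q :=
  (Runs.loop_const I hx hy hxy hN h0 hstep hQ).mono hT fun _ h => h

end Rules

end RAM

/-! ### The adjacency lists -/

section Input

variable {n : ℕ} {G : SimpleGraph (Fin n)} {M : ℕ → ℕ}

theorem IsAdjListOf.mono (h : IsAdjListOf G M) {u v : ℕ} (huv : u ≤ v) (hv : v ≤ n) :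
    M (u + 2) ≤ M (v + 2) := by
  induction v, huv using Nat.le_induction with
  | base => exact le_rfl
  | succ v huv ih =>
    have h₁ := h.next ⟨v, hv⟩
    have e : v + 1 + 2 = v + 3 := by omega
    simp only at h₁
    exact (ih (by omega)).trans (by rw [e]; omega)

theorem IsAdjListOf.le_end (h : IsAdjListOf G M) : n + 3 ≤ M (n + 2) := by
  have := h.mono (Nat.zero_le n) le_rfl
  rwa [h.first] at this

/-- The number of neighbors of the vertex `v`. -/
def adjCount (M : ℕ → ℕ) (v : ℕ) : ℕ := M (v + 3) - M (v + 2)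

theorem IsAdjListOf.adjCount_eq (h : IsAdjListOf G M) (v : Fin n) :
    adjCount M v = (G.neighborSet v).ncard := by
  rw [adjCount, h.next]; omega

theorem IsAdjListOf.add_lt (h : IsAdjListOf G M) {v j : ℕ} (hv : v < n) (hj : j < adjCount M v) :
    M (v + 2) + j < M (n + 2) := by
  have := h.mono (u := v + 1) hv le_rfl
  unfold adjCount at hj
  have e : v + 1 + 2 = v + 3 := by omega
  rw [e] at this
  omega

theorem IsAdjListOf.adj_iff (h : IsAdjListOf G M) {v y : ℕ} (hv : v < n) :
    (y = v ∨ ∃ j < adjCount M v, M (M (v + 2) + j) = y) ↔ ClosedAdj G v y := by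
  constructor
  · rintro (rfl | ⟨j, hj, rfl⟩)
    · exact closedAdj_self hv
    · unfold adjCount at hj
      obtain ⟨u, hu, hMu⟩ := h.sound ⟨v, hv⟩ (M (v + 2) + j) (Nat.le_add_right _ _)
        (by simp only; omega)
      rw [hMu]
      exact ⟨hv, u.2, Or.inr hu⟩
  · rintro ⟨_, hy, rfl | hadj⟩
    · exact Or.inl rfl
    · obtain ⟨a, ha, ha', hMa⟩ := h.complete _ _ hadj
      refine Or.inr ⟨a - M (v + 2), ?_, ?_⟩
      · unfold adjCount; simp only at ha ha'; omega
      · rw [Nat.add_sub_cancel' ha, hMa]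

/-- If the closed neighborhood of `v` lies in that of `r` and the degrees agree, then the two are
equal by finiteness. So with an adjacency matrix a scan of the list of `v` alone decides the matter.
-/
theorem IsAdjListOf.twin_iff (h : IsAdjListOf G M) {r v : ℕ} (hr : r < n) (hv : v < n) :
    (ClosedAdj G r v ∧ adjCount M r = adjCount M v ∧
      ∀ j < adjCount M v, ClosedAdj G r (M (M (v + 2) + j))) ↔
      ∀ u, ClosedAdj G r u ↔ ClosedAdj G v u := by
  have hset : ∀ x (hx : x < n), {u : ℕ | ClosedAdj G x u}.ncard = adjCount M x + 1 ∧
      {u : ℕ | ClosedAdj G x u}.Finite := by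
    intro x hx
    have e : {u : ℕ | ClosedAdj G x u} = insert x (Fin.val '' (G.neighborSet ⟨x, hx⟩)) := by
      ext u
      simp only [Set.mem_ofPred_eq, Set.mem_insert_iff, Set.mem_image, SimpleGraph.mem_neighborSet]
      constructor
      · rintro ⟨_, hu, rfl | hadj⟩
        · exact Or.inl rfl
        · exact Or.inr ⟨_, hadj, rfl⟩
      · rintro (rfl | ⟨y, hy, rfl⟩)
        · exact closedAdj_self hx
        · exact ⟨hx, y.2, Or.inr hy⟩
    rw [e]
    refine ⟨?_, (Set.toFinite _).insert _⟩
    rw [Set.ncard_insert_of_notMem _ (Set.toFinite _), Set.ncard_image_of_injective _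
      Fin.val_injective, ← h.adjCount_eq]
    rintro ⟨y, hy, rfl⟩
    exact G.loopless.irrefl _ hy
  constructor
  · rintro ⟨h₁, h₂, h₃⟩
    have hsub : {u : ℕ | ClosedAdj G v u} ⊆ {u : ℕ | ClosedAdj G r u} := by
      intro u hu
      rcases (h.adj_iff hv).2 hu with rfl | ⟨j, hj, rfl⟩
      · exact h₁
      · exact h₃ j hj
    have := Set.eq_of_subset_of_ncard_le hsub (by rw [(hset r hr).1, (hset v hv).1, h₂])
      (hset r hr).2
    intro u
    exact (Set.ext_iff.1 this u).symm
  · intro hu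
    refine ⟨(hu v).2 (closedAdj_self hv), ?_, fun j hj => (hu _).2 ((h.adj_iff hv).1
      (Or.inr ⟨j, hj, rfl⟩))⟩
    have : {u : ℕ | ClosedAdj G r u} = {u : ℕ | ClosedAdj G v u} := Set.ext hu
    have e := (hset r hr).1
    rw [this, (hset v hv).1] at e
    omega

theorem IsAdjListOf.sum_adjCount (h : IsAdjListOf G M) :
    ∑ v ∈ Finset.range n, adjCount M v = 2 * G.edgeSet.ncard := by
  classical
  rw [Finset.sum_range, ← Set.coe_toFinset G.edgeSet, Set.ncard_coe_finset]
  have := G.sum_degrees_eq_twice_card_edges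
  rw [SimpleGraph.edgeFinset] at this
  rw [← this]
  refine Finset.sum_congr rfl fun v _ => ?_
  rw [h.adjCount_eq, ← G.card_neighborSet_eq_degree, Set.ncard_eq_toFinset_card', Set.toFinset_card]

theorem IsAdjListOf.end_eq (h : IsAdjListOf G M) : M (n + 2) = n + 3 + 2 * G.edgeSet.ncard := by
  have : ∀ k ≤ n, M (k + 2) = n + 3 + ∑ v ∈ Finset.range k, adjCount M v := by
    intro k hk
    induction k with
    | zero => simpa using h.first
    | succ k ih =>
      have hm := h.mono (u := k) (v := k + 1) (by omega) hk
      have e : k + 1 + 2 = k + 3 := by omega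
      rw [Finset.sum_range_succ, ← add_assoc, ← ih (by omega), adjCount]
      rw [e] at hm ⊢
      omega
  rw [this n le_rfl, h.sum_adjCount]

theorem IsAdjListOf.le (h : IsAdjListOf G M) (a : ℕ) : M a ≤ n + 3 + 2 * G.edgeSet.ncard := by
  rcases Nat.lt_or_ge a 2 with ha | ha
  · have : a = 0 ∨ a = 1 := by omega
    rcases this with rfl | rfl
    · rw [h.order]; omega
    · rw [h.size]; omega
  rcases Nat.lt_or_ge a (n + 3) with ha' | ha'
  · obtain ⟨u, rfl⟩ : ∃ u, a = u + 2 := ⟨a - 2, by omega⟩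
    exact (h.mono (show u ≤ n by omega) le_rfl).trans h.end_eq.le
  rcases Nat.lt_or_ge a (M (n + 2)) with ha'' | ha''
  · have : ∀ k ≤ n, a < M (k + 2) → ∃ v, v < n ∧ M (v + 2) ≤ a ∧ a < M (v + 3) := by
      intro k hk
      induction k with
      | zero => intro h'; rw [zero_add, h.first] at h'; omega
      | succ k ih =>
        intro h'
        by_cases hlt : a < M (k + 2)
        · exact ih (by omega) hlt
        · exact ⟨k, hk, by omega, h'⟩
    obtain ⟨v, hv, h₁, h₂⟩ := this n le_rfl ha''
    obtain ⟨u, -, hu⟩ := h.sound ⟨v, hv⟩ a h₁ h₂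
    rw [hu]; omega
  · rw [h.rest a ha'']; exact Nat.zero_le _

end Input

theorem pair_eq_iff {n x y x' y' : ℕ} (hy : y ≤ n) (hy' : y' ≤ n) :
    x * (n + 1) + y = x' * (n + 1) + y' ↔ x = x' ∧ y = y' := by
  constructor
  · intro h
    have h₁ : (x * (n + 1) + y) / (n + 1) = x := by
      rw [mul_comm, Nat.mul_add_div (by omega), Nat.div_eq_of_lt (by omega), add_zero]
    have h₂ : (x' * (n + 1) + y') / (n + 1) = x' := by
      rw [mul_comm, Nat.mul_add_div (by omega), Nat.div_eq_of_lt (by omega), add_zero]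
    rw [h, h₂] at h₁
    subst h₁
    exact ⟨rfl, by omega⟩
  · rintro ⟨rfl, rfl⟩; rfl

/-! ### The adjacency matrix in linear time -/

namespace RAM

open Ex Cmd

/-- Array `0` becomes the closed adjacency matrix. Variable `0` holds the number of vertices. -/
def adjacencyCmd : Cmd :=
  loop 10 0 <| block
    [put 0 (var 10 * (var 0 + 1) + var 10) 1,
     set 13 (inp (var 10 + 2)),
     set 12 (inp (var 10 + 3) - var 13),
     loop 11 12 <| put 0 (var 10 * (var 0 + 1) + inp (var 13 + var 11)) 1]

/-- Array `0` holds the closed adjacency matrix of `G`. -/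
def IsAdjacencyTable {n : ℕ} (G : SimpleGraph (Fin n)) (A : ℕ → ℕ) : Prop :=
  ∀ x ≤ n, ∀ y ≤ n, A (x * (n + 1) + y) ≠ 0 ↔ ClosedAdj G x y

/-- Only the nonzero entries are written, one for each vertex and each list entry; the zeros are
there from the start. Row and column `n` stay zero, which fits the dummy representative `n`. -/
theorem runs_adjacencyCmd {n : ℕ} {G : SimpleGraph (Fin n)} {M : ℕ → ℕ} (hM : IsAdjListOf G M)
    {P : Params} (hB : P.B = M (n + 2)) {s : Store} (hn : s.v 0 = n) (ha : ∀ i, s.a 0 i = 0)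
    (hinp : s.inp = M) :
    Runs P adjacencyCmd s (∑ v ∈ Finset.range n, (adjCount M v * 100 + 100) + 100)
      fun s' => IsAdjacencyTable G (s'.a 0) := by
  have hend := hM.le_end
  simp only [adjacencyCmd, block]
  refine Runs.mono (Runs.loop (N := n) (T := fun v => adjCount M v * 34 + 80)
    (fun v s' => ∀ x ≤ n, ∀ y ≤ n, s'.a 0 (x * (n + 1) + y) ≠ 0 ↔ (x < v ∧ ClosedAdj G x y))
    (by decide) (by decide) (by decide) hn (by simp [ha]) ?_ (fun s' _ _ h x hx y hy => ?_))
    ?_ (fun _ h => h)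
  · intro v hv s₁ hf hv₁ hI
    have hn₁ : s₁.v 0 = n := by rw [hf.v 0 (by decide), hn]
    have hinp₁ : s₁.inp = M := by rw [hf.inp (by decide), hinp]
    have hV := P.hV
    refine Runs.of_bdd fun hbdd => ?_
    refine Runs.put_seq (by simp; omega) ?_
    refine Runs.set_seq (by simpa using hbdd.inp _) ?_ (hok := by simp [hv₁, hB]; omega)
    refine Runs.set_seq (by simpa using (Nat.sub_le _ _).trans (hbdd.inp _)) ?_
      (hok := by simp [hv₁, hB]; omega)
    refine Runs.for (adjCount M v) 26
        (fun j s' => ∀ x ≤ n, ∀ y ≤ n, s'.a 0 (x * (n + 1) + y) ≠ 0 ↔ ((x < v ∧ ClosedAdj G x y) ∨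
          (x = v ∧ (y = v ∨ ∃ i < j, M (M (v + 2) + i) = y))))
        (by simp [hv₁, hinp₁, adjCount]) (by simp) ?h0 ?hstep ?hQ
    case h0 =>
      intro x hx y hy
      simp only [Store.setV_a, Store.setA_a, eval_hAdd, eval_hMul, eval_var, hv₁, hn₁, eval_ofNat,
        true_and, pair_eq_iff hy hv.le]
      by_cases h : x = v ∧ y = v
      · simp [h]
      · rw [if_neg h, hI x hx y hy]
        simp only [Nat.not_lt_zero, false_and, exists_false, or_false]
        tauto
    case hstep =>
      intro j hj s₂ hf₂ hj₂ hI₂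
      have e₀ : s₂.v 0 = n := by rw [hf₂.v 0 (by decide)]; simp [hn₁]
      have e₁₀ : s₂.v 10 = v := by rw [hf₂.v 10 (by decide)]; simp [hv₁]
      have e₁₃ : s₂.v 13 = M (v + 2) := by rw [hf₂.v 13 (by decide)]; simp [hv₁, hinp₁]
      have ei : s₂.inp = M := by rw [hf₂.inp (by decide)]; simp [hinp₁]
      have hlt := hM.add_lt hv hj
      obtain ⟨_, hMn, -⟩ := (hM.adj_iff hv).1 (Or.inr ⟨j, hj, rfl⟩)
      refine Runs.mono (Runs.put (by decide) rfl (by decide) rfl (by simp [e₁₃, hj₂, hB, hlt])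
        (by simp) (by simp; have := P.hV; omega) ?_) (by simp) (fun _ h => h)
      intro x hx y hy
      simp only [Store.setV_a, Store.setA_a, eval_hAdd, eval_hMul, eval_var, e₁₀, e₀, eval_ofNat,
        true_and, eval_inp, e₁₃, hj₂, ei, pair_eq_iff hy hMn.le]
      by_cases h : x = v ∧ y = M (M (v + 2) + j)
      · simp only [h, and_self, if_true, true_and]
        refine iff_of_true (by decide) (Or.inr (Or.inr ⟨j, by omega, rfl⟩))
      · rw [if_neg h, hI₂ x hx y hy]
        refine or_congr_right (and_congr_right fun hxv => or_congr_right ?_)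
        constructor
        · rintro ⟨i, hi, rfl⟩
          exact ⟨i, by omega, rfl⟩
        · rintro ⟨i, hi, rfl⟩
          refine ⟨i, lt_of_le_of_ne (by omega) ?_, rfl⟩
          rintro rfl
          exact h ⟨hxv, rfl⟩
    case hQ =>
      intro s₂ _ _ hI₂ x hx y hy
      simp only [Store.setV_a]
      rw [hI₂ x hx y hy]
      constructor
      · rintro (⟨h₁, h₂⟩ | ⟨rfl, h₂⟩)
        · exact ⟨by omega, h₂⟩
        · exact ⟨by omega, (hM.adj_iff hv).1 h₂⟩
      · rintro ⟨h₁, h₂⟩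
        rcases Nat.lt_succ_iff_lt_or_eq.1 h₁ with h₁ | rfl
        · exact Or.inl ⟨h₁, h₂⟩
        · exact Or.inr ⟨rfl, (hM.adj_iff hv).2 h₂⟩
  · rw [h x hx y hy]
    exact ⟨And.right, fun h => ⟨h.1, h⟩⟩
  · simp only [Finset.sum_add_distrib, ← Finset.sum_mul]
    simp
    omega

end RAM

/-! ### The test for twins -/

namespace RAM

open Ex Cmd

/-- `u` and `v` have the same closed neighborhood. -/
def Twins {n : ℕ} (G : SimpleGraph (Fin n)) (u v : ℕ) : Prop :=
  ∀ x, ClosedAdj G u x ↔ ClosedAdj G v x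

/-- Variable `15` tells whether the vertices in the variables `17` and `10` are twins. -/
def twinsCmd : Cmd := block
  [set 15 1,
   ite (.eq (arr 0 (var 17 * (var 0 + 1) + var 10)) 0) (set 15 0) skip,
   ite (.eq (inp (var 17 + 3) - inp (var 17 + 2)) (var 12)) skip (set 15 0),
   loop 11 12 <| ite (.eq (arr 0 (var 17 * (var 0 + 1) + inp (var 13 + var 11))) 0) (set 15 0) skip]

/-- The data of the vertex in variable `10` have been read. -/
structure AtVertex {n : ℕ} (G : SimpleGraph (Fin n)) (M : ℕ → ℕ) (v : ℕ) (s : Store) : Prop where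
  order : s.v 0 = n
  lt : v < n
  vertex : s.v 10 = v
  start : s.v 13 = M (v + 2)
  degree : s.v 12 = adjCount M v
  table : IsAdjacencyTable G (s.a 0)
  input : s.inp = M

variable {n : ℕ} {G : SimpleGraph (Fin n)} {M : ℕ → ℕ} {P : Params} {s : Store}

theorem AtVertex.frame {v : ℕ} (h : AtVertex G M v s) {c : Cmd} {s' : Store} (hf : Frame c s s')
    (h₀ : 0 ∉ c.vars) (h₁ : 10 ∉ c.vars) (h₂ : 13 ∉ c.vars) (h₃ : 12 ∉ c.vars) (h₄ : 0 ∉ c.arrs)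
    (h₅ : 16 ∉ c.arrs) : AtVertex G M v s' :=
  ⟨(hf.v _ h₀).trans h.order, h.lt, (hf.v _ h₁).trans h.vertex, (hf.v _ h₂).trans h.start,
    (hf.v _ h₃).trans h.degree, (hf.a _ h₄).symm ▸ h.table, (hf.inp h₅).trans h.input⟩

theorem runs_twinsCmd (hM : IsAdjListOf G M) (hB : P.B = M (n + 2)) {v r : ℕ}
    (hs : AtVertex G M v s) (hr : s.v 17 = r) (hrn : r < n) :
    Runs P twinsCmd s (adjCount M v * 40 + 100) fun s' => s'.v 15 ≠ 0 ↔ Twins G r v := by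
  have hend := hM.le_end
  have hV := P.hV
  have hv := hs.lt
  simp only [twinsCmd, block]
  refine Runs.set_seq (by simp; omega) ?_
  have w₀ : AtVertex G M v (s.setV 15 (eval s 1)) :=
    ⟨by simp [hs.order], hv, by simp [hs.vertex], by simp [hs.start], by simp [hs.degree],
      hs.table, hs.input⟩
  have r₀ : (s.setV 15 (eval s 1)).v 17 = r := by simp [hr]
  have e₀ : (s.setV 15 (eval s 1)).v 15 = 1 := by simp
  generalize s.setV 15 (eval s 1) = s₀ at w₀ r₀ e₀ ⊢
  have key : s₀.a 0 (r * (n + 1) + v) = 0 ↔ ¬ ClosedAdj G r v := by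
    rw [← w₀.table r hrn.le v hv.le, not_not]
  refine Runs.cut 40 (fun s' => s'.v 15 ≠ 0 ↔ ClosedAdj G r v) (by simp)
    (Runs.ite_eq (fun h => Runs.set' (by simp) ?_) fun h => Runs.done ?_) fun s₁ f₁ h₁ => ?_
  · simpa [r₀, w₀.order, w₀.vertex, key] using h
  · simpa [r₀, w₀.order, w₀.vertex, key, e₀] using h
  have w₁ := w₀.frame f₁ (by decide) (by decide) (by decide) (by decide) (by decide) (by decide)
  have r₁ : s₁.v 17 = r := (f₁.v _ (by decide)).trans r₀
  refine Runs.cut 40 (fun s' => s'.v 15 ≠ 0 ↔ ClosedAdj G r v ∧ adjCount M r = adjCount M v)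
    (by simp) (Runs.ite_eq (fun h => Runs.done ?_) (fun h => Runs.set' (by simp) ?_)
      (hok := by simp [r₁, hB]; omega)) fun s₂ f₂ h₂ => ?_
  · simp [r₁, w₁.input, w₁.degree] at h
    have h' : adjCount M r = adjCount M v := h
    simp [h₁, h']
  · simp [r₁, w₁.input, w₁.degree] at h
    have h' : ¬ adjCount M r = adjCount M v := h
    simp [h']
  have w₂ := w₁.frame f₂ (by decide) (by decide) (by decide) (by decide) (by decide) (by decide)
  have r₂ : s₂.v 17 = r := (f₂.v _ (by decide)).trans r₁
  refine Runs.for (adjCount M v) 30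
    (fun j s' => s'.v 15 ≠ 0 ↔ ClosedAdj G r v ∧ adjCount M r = adjCount M v ∧
      ∀ i < j, ClosedAdj G r (M (M (v + 2) + i))) w₂.degree (by simp; omega) (by simpa using h₂)
    ?_ fun s' _ _ h => h.trans (hM.twin_iff hrn hv)
  intro j hj s₃ f₃ hj₃ h₃
  have w₃ := w₂.frame f₃ (by decide) (by decide) (by decide) (by decide) (by decide) (by decide)
  have r₃ : s₃.v 17 = r := (f₃.v _ (by decide)).trans r₂
  have hlt := hM.add_lt hv hj
  obtain ⟨_, hMn, -⟩ := (hM.adj_iff hv).1 (Or.inr ⟨j, hj, rfl⟩)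
  have key : s₃.a 0 (r * (n + 1) + M (M (v + 2) + j)) = 0 ↔ ¬ ClosedAdj G r (M (M (v + 2) + j)) :=
    by rw [← w₃.table r hrn.le _ hMn.le, not_not]
  refine Runs.ite_eq (fun h => Runs.set' (by simp) ?_) (fun h => Runs.done ?_)
    (hok := by simp [w₃.start, hj₃, hB, hlt])
  · simp [r₃, w₃.order, w₃.start, hj₃, w₃.input, key] at h
    simpa using fun _ _ => ⟨j, by omega, h⟩
  · simp [r₃, w₃.order, w₃.start, hj₃, w₃.input, key] at h
    rw [Store.setV_v, if_neg (by decide), h₃]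
    simp only [Nat.forall_lt_succ_right, h, and_true]

end RAM

/-! ### The classes of twins -/

namespace RAM

open Ex Cmd

/-- Variable `16` becomes `i + 1`, if the vertex in variable `10` is a twin of the representative
number `i`, and `0`, if there is no such `i`. -/
def findCmd : Cmd := block
  [set 16 0,
   loop 14 1 <| block
    [set 17 (arr 1 (var 14)), twinsCmd, ite (.eq (var 15) 0) skip (set 16 (var 14 + 1))]]

/-- Put the vertex in variable `10` into its class. -/
def classifyCmd : Cmd := block
  [set 13 (inp (var 10 + 2)),
   set 12 (inp (var 10 + 3) - var 13),
   findCmd,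
   ite (.eq (var 16) 0) (block [put 1 (var 1) (var 10), set 1 (var 1 + 1), set 16 (var 1)]) skip,
   put 3 (var 10) (var 16 - 1),
   put 4 (var 10) (arr 2 (var 16 - 1)),
   put 2 (var 16 - 1) (arr 2 (var 16 - 1) + 1)]

/-- Variable `1` becomes the number of classes of twins, array `1` lists their representatives,
followed by `n`, array `2` their sizes, followed by `3 * n + 3`. Arrays `3` and `4` tell the class
of a vertex and its number within the class. -/
def classesCmd : Cmd := block
  [set 1 0,
   loop 10 0 classifyCmd,
   put 1 (var 1) (var 0),
   put 2 (var 1) (3 * var 0 + 3)]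

variable {n : ℕ} {G : SimpleGraph (Fin n)} {M : ℕ → ℕ} {P : Params} {s : Store}

theorem runs_findCmd (hM : IsAdjListOf G M) (hB : P.B = M (n + 2)) {v k : ℕ}
    (hs : AtVertex G M v s) (hk : s.v 1 = k) (hR : ∀ i < k, s.a 1 i < n) :
    Runs P findCmd s (k * (adjCount M v * 40 + 150) + 20) fun s' =>
      (s'.v 16 = 0 ∧ ∀ i < k, ¬ Twins G (s.a 1 i) v) ∨
        ∃ i < k, s'.v 16 = i + 1 ∧ Twins G (s.a 1 i) v := by
  have hV := P.hV
  simp only [findCmd, block]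
  refine Runs.of_bdd fun hbdd => Runs.set_seq (by simp) ?_
  refine Runs.for k (adjCount M v * 40 + 140) (fun j s' =>
    (s'.v 16 = 0 ∧ ∀ i < j, ¬ Twins G (s.a 1 i) v) ∨
        ∃ i < j, s'.v 16 = i + 1 ∧ Twins G (s.a 1 i) v) (by simp [hk])
    (by
      have := Nat.mul_le_mul_left k (show adjCount M v * 40 + 140 + 8 ≤ adjCount M v * 40 + 150 by omega)
      simp; omega) (by simp) ?_ fun s' _ _ h => h
  intro j hj s₁ f₁ hj₁ h₁
  have w₁ : AtVertex G M v s₁ := by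
    have : AtVertex G M v (s.setV 16 (eval s 0)) :=
      ⟨by simp [hs.order], hs.lt, by simp [hs.vertex], by simp [hs.start], by simp [hs.degree],
        hs.table, hs.input⟩
    exact this.frame f₁ (by decide) (by decide) (by decide) (by decide) (by decide) (by decide)
  have a₁ : s₁.a 1 = s.a 1 := f₁.a _ (by decide)
  refine Runs.set_seq (by simpa [hj₁, a₁] using hbdd.arr _ _) ?_
  have w₂ : AtVertex G M v (s₁.setV 17 (eval s₁ (arr 1 (var 14)))) :=
      ⟨by simp [w₁.order], hs.lt, by simp [w₁.vertex], by simp [w₁.start], by simp [w₁.degree],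
        w₁.table, w₁.input⟩
  refine Runs.cut (adjCount M v * 40 + 100) _ (by simp) (runs_twinsCmd hM hB (r := s.a 1 j)
    w₂ (by simp [hj₁, a₁]) (hR j hj)) fun s₂ f₂ h₂ => ?_
  have e₁₄ : s₂.v 14 = j := (f₂.v _ (by decide)).trans (by simp [hj₁])
  have e₁₆ : s₂.v 16 = s₁.v 16 := (f₂.v _ (by decide)).trans (by simp)
  have hkV : k ≤ P.V := hk ▸ hbdd.var _
  refine Runs.ite_eq (fun h => Runs.done ?_) (fun h => Runs.set' (by simp [e₁₄]; omega) ?_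
    (hT := by simp)) (hT := by simp)
  · have h' : ¬ Twins G (s.a 1 j) v := by
      rw [← h₂, not_not]; simpa using h
    simp only [Store.setV_v, e₁₆]
    rcases h₁ with ⟨h₃, h₄⟩ | ⟨i, hi, h₃, h₄⟩
    · exact Or.inl ⟨h₃, Nat.forall_lt_succ_right.2 ⟨h₄, h'⟩⟩
    · exact Or.inr ⟨i, by omega, h₃, h₄⟩
  · exact Or.inr ⟨j, by omega, by simp [e₁₄], h₂.1 (by simpa using h)⟩

/-- The first `v` vertices have been distributed over `k` classes. -/
structure Classified {n : ℕ} (G : SimpleGraph (Fin n)) (v k : ℕ) (R w cls rank : ℕ → ℕ) : Prop where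
  lt : ∀ i < k, R i < v
  ne : ∀ i < k, ∀ j < k, i ≠ j → ¬ Twins G (R i) (R j)
  cls_lt : ∀ u < v, cls u < k
  twins : ∀ u < v, Twins G (R (cls u)) u
  card : ∀ i, w i = ((Finset.range v).filter fun u => cls u = i).card
  rank_eq : ∀ u < v, rank u = ((Finset.range u).filter fun u' => cls u' = cls u).card

theorem Classified.zero (R cls rank : ℕ → ℕ) : Classified G 0 0 R (fun _ => 0) cls rank := by
  constructor <;> simp

/-- The common core of joining an old class and opening a new one: the new vertex gets the old size
of its class as its number within the class. -/
theorem Classified.assign {v k k' i : ℕ} {R R' w cls rank : ℕ → ℕ} (h : Classified G v k R w cls rank)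
    (hk : k ≤ k') (hR : ∀ j < k, R' j = R j) (hlt : ∀ j < k', R' j < v + 1)
    (hne : ∀ i < k', ∀ j < k', i ≠ j → ¬ Twins G (R' i) (R' j)) (hi : i < k')
    (ht : Twins G (R' i) v) : Classified G (v + 1) k' R' (fun j => if j = i then w i + 1 else w j)
      (fun u => if u = v then i else cls u) (fun u => if u = v then w i else rank u) where
  lt := hlt
  ne := hne
  cls_lt u hu := by
    split_ifs with huv
    · exact hi
    · exact (h.cls_lt u (by omega)).trans_le hk
  twins u hu := by
    split_ifs with huv
    · rwa [huv]
    · rw [hR _ (h.cls_lt u (by omega))]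
      exact h.twins u (by omega)
  card j := by
    have e : ∀ j, ((Finset.range v).filter fun u => (if u = v then i else cls u) = j) =
        (Finset.range v).filter fun u => cls u = j := fun j =>
      Finset.filter_congr fun u hu => by rw [if_neg (Finset.mem_range.1 hu).ne]
    rw [Finset.range_add_one, Finset.filter_insert, e]
    by_cases hj : j = i
    · subst hj
      simp [h.card]
    · rw [if_neg hj, if_neg (by simpa using Ne.symm hj), h.card]
  rank_eq u hu := by
    have e : ∀ j, ((Finset.range u).filter fun u => (if u = v then i else cls u) = j) =
        (Finset.range u).filter fun u => cls u = j := fun j =>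
      Finset.filter_congr fun u' hu' => by
        have := Finset.mem_range.1 hu'
        rw [if_neg (by omega)]
    rw [e]
    split_ifs with huv
    · rw [huv, h.card]
    · exact h.rank_eq u (by omega)

theorem Classified.step {v k i : ℕ} {R w cls rank : ℕ → ℕ} (h : Classified G v k R w cls rank)
    (hi : i < k) (ht : Twins G (R i) v) :
    Classified G (v + 1) k R (fun j => if j = i then w i + 1 else w j)
      (fun u => if u = v then i else cls u) (fun u => if u = v then w i else rank u) :=
  h.assign le_rfl (fun _ _ => rfl) (fun j hj => (h.lt j hj).trans (Nat.lt_succ_self v)) h.ne hi ht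

theorem Classified.new {v k : ℕ} {R w cls rank : ℕ → ℕ} (h : Classified G v k R w cls rank)
    (ht : ∀ i < k, ¬ Twins G (R i) v) :
    Classified G (v + 1) (k + 1) (fun j => if j = k then v else R j)
      (fun j => if j = k then w k + 1 else w j)
      (fun u => if u = v then k else cls u) (fun u => if u = v then w k else rank u) := by
  refine h.assign (R' := fun j => if j = k then v else R j) (Nat.le_succ k)
    (fun j hj => if_neg hj.ne) (fun j hj => ?_) (fun i hi j hj hij => ?_) (Nat.lt_succ_self k)
    (by simp [Twins])
  · split_ifs with hjk
    · omega
    · have := h.lt j (by omega)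
      omega
  · split_ifs with h₁ h₂ h₂
    · omega
    · exact fun hh => ht j (by omega) fun x => (hh x).symm
    · exact ht i (by omega)
    · exact h.ne i (by omega) j (by omega) hij

theorem Classified.w_le {v k : ℕ} {R w cls rank : ℕ → ℕ} (h : Classified G v k R w cls rank) (i : ℕ) :
    w i ≤ v := by
  rw [h.card]
  exact (Finset.card_filter_le _ _).trans (Finset.card_range v).le

/-- The first `v` vertices have been distributed over classes with the data in the store. -/
def IsClassified {n : ℕ} (G : SimpleGraph (Fin n)) (v : ℕ) (s : Store) : Prop :=
  Classified G v (s.v 1) (s.a 1) (s.a 2) (s.a 3) (s.a 4)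

theorem runs_classifyCmd (hM : IsAdjListOf G M) (hB : P.B = M (n + 2)) {v k : ℕ} (hv : v < n)
    (hk : s.v 1 = k) (hs₀ : s.v 0 = n) (hsv : s.v 10 = v) (htab : IsAdjacencyTable G (s.a 0))
    (hinp : s.inp = M) (hs : IsClassified G v s) (hVn : n + 1 ≤ P.V)
    (hk13 : k ≤ 13) :
    Runs P classifyCmd s (k * (adjCount M v * 40 + 150) + 150) fun s' =>
      IsClassified G (v + 1) s' := by
  have hend := hM.le_end
  simp only [classifyCmd, block]
  refine Runs.of_bdd fun hbdd => ?_
  refine Runs.set_seq (by simpa using hbdd.inp _) ?_ (hok := by simp [hsv, hB]; omega)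
  refine Runs.set_seq (by simpa using (Nat.sub_le _ _).trans (hbdd.inp _)) ?_
      (hok := by simp [hsv, hB]; omega)
  refine Runs.cut (k * (adjCount M v * 40 + 150) + 20) _ (by simp)
    (runs_findCmd (v := v) hM hB ⟨by simp [hs₀], hv, by simp [hsv], by simp [hsv, hinp],
      by simp [hsv, hinp, adjCount], by simpa using htab, by simpa using hinp⟩ (by simpa using hk)
      fun i hi => (hs.lt i (by omega)).trans hv) fun s₁ f₁ h₁ => ?_
  simp only [Store.setV_a] at h₁
  have d₁ : IsClassified G v s₁ := by
    unfold IsClassified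
    rw [f₁.v 1 (by decide), f₁.a 1 (by decide), f₁.a 2 (by decide), f₁.a 3 (by decide),
      f₁.a 4 (by decide)]
    exact hs
  have k₁ : s₁.v 1 = k := by rw [f₁.v 1 (by decide)]; simp [hk]
  have v₁ : s₁.v 10 = v := by rw [f₁.v 10 (by decide)]; simp [hsv]
  rw [← show s₁.a 1 = s.a 1 by rw [f₁.a 1 (by decide)]; simp] at h₁
  have hV := P.hV
  refine Runs.of_bdd fun hbdd₁ => ?_
  -- The intermediate assertion already describes the arrays as the three writes at the end of the
  -- command will leave them; in the case of a new class only its representative has been stored so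
  -- far.
  refine Runs.cut 60 (fun s' => ∃ i, s'.v 16 = i + 1 ∧ Classified G (v + 1) (s'.v 1) (s'.a 1)
      (fun j => if j = i then s'.a 2 i + 1 else s'.a 2 j) (fun u => if u = v then i else s'.a 3 u)
      (fun u => if u = v then s'.a 2 i else s'.a 4 u)) (by simp)
    (Runs.ite_eq (fun h => ?_) fun h => ?_) fun s₂ f₂ ⟨i, hi, d₂⟩ => ?_
  · refine Runs.put_seq (by simpa using hbdd₁.var _) (Runs.set_seq ?_ (Runs.set' ?_ ?_))
    · simp [k₁]; omega
    · simp [k₁]; omega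
    have h₂ := h₁.resolve_right (by rintro ⟨i, -, h', -⟩; simp [h'] at h)
    refine ⟨k, by simp [k₁], ?_⟩
    have := Classified.new d₁ (by rw [k₁]; exact h₂.2)
    convert this using 1
    · simp
    · funext j; simp [k₁, v₁]
    · simp [k₁]
    · simp [k₁]
    · simp [k₁]
  · refine Runs.done ?_
    obtain ⟨i, hik, hi, ht⟩ := h₁.resolve_left (by rintro ⟨h', -⟩; exact h (by simpa using h'))
    exact ⟨i, hi, Classified.step d₁ (by rw [k₁]; exact hik) ht⟩
  have v₂ : s₂.v 10 = v := (f₂.v _ (by decide)).trans v₁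
  have hle := d₂.w_le i
  rw [if_pos rfl] at hle
  refine Runs.of_bdd fun hbdd₂ => ?_
  refine Runs.put_seq (by simpa using (Nat.sub_le _ _).trans (hbdd₂.var 16)) ?_
  refine Runs.put_seq (by simpa using hbdd₂.arr _ _) ?_
  refine Runs.put' (by simp [hi]; omega) ?_
  unfold IsClassified
  convert d₂ using 1
  all_goals first | (simp; done) | (funext j; simp [hi, v₂])

/-- The data about the classes of twins are in the store. -/
structure HasClasses {n : ℕ} (G : SimpleGraph (Fin n)) (s : Store) : Prop where
  order : s.v 0 = n
  table : IsAdjacencyTable G (s.a 0)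
  rep : IsRepFamily G (s.v 1) (s.a 1)
  le : s.v 1 ≤ 13
  cls_lt : ∀ u < n, s.a 3 u < s.v 1
  twins : ∀ u < n, Twins G (s.a 1 (s.a 3 u)) u
  card : ∀ i < s.v 1, s.a 2 i = ((Finset.range n).filter fun u => s.a 3 u = i).card
  top : s.a 2 (s.v 1) = 3 * n + 3
  rank_eq : ∀ u < n, s.a 4 u = ((Finset.range u).filter fun u' => s.a 3 u' = s.a 3 u).card

theorem Classified.isRepFamily {v k : ℕ} {R w cls rank : ℕ → ℕ}
    (h : Classified G v k R w cls rank) (hv : v ≤ n) :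
    IsRepFamily G k fun i => if i = k then n else R i where
  lt i hi := by rw [if_neg hi.ne]; exact (h.lt i hi).trans_le hv
  dummy := if_pos rfl
  ne i hi j hj hij := by
    rw [if_neg hi.ne, if_neg hj.ne]
    exact not_forall.1 (h.ne i hi j hj hij)

theorem runs_classesCmd (h₁ : ¬ (⊥ : SimpleGraph (Fin 4)).IsIndContained G)
    (h₄ : ¬ (SimpleGraph.cycleGraph 4).IsIndContained G)
    (h₆ : ¬ (SimpleGraph.cycleGraph 6).IsIndContained G)
    (h₇ : (SimpleGraph.cycleGraph 7).IsIndContained G) (hM : IsAdjListOf G M)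
    (hB : P.B = M (n + 2)) (hs₀ : s.v 0 = n) (htab : IsAdjacencyTable G (s.a 0))
    (hw : ∀ i, s.a 2 i = 0) (hinp : s.inp = M) (hVn : 3 * n + 3 ≤ P.V) :
    Runs P classesCmd s (∑ v ∈ Finset.range n, (adjCount M v * 600 + 2400) + 100)
      (HasClasses G) := by
  simp only [classesCmd, block]
  refine Runs.set_seq (by simp) ?_
  refine Runs.cut (∑ v ∈ Finset.range n, (adjCount M v * 520 + 2100 + 8) + 4) (IsClassified G n) ?_
    (Runs.loop (N := n) (T := fun v => adjCount M v * 520 + 2100) (IsClassified G) (by decide)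
      (by decide) (by decide) (by simp [hs₀]) ?_ ?_ fun _ _ _ h => h) fun s₁ f₁ d₁ => ?_
  · simp only [Finset.sum_add_distrib, ← Finset.sum_mul]
    simp
    omega
  · unfold IsClassified
    convert Classified.zero (G := G) (s.a 1) (s.a 3) (s.a 4) using 1
    all_goals first | (simp; done) | (funext i; simp [hw])
  · intro v hv s₁ f₁ hv₁ d₁
    -- Already the representatives found so far have distinct closed neighborhoods in the whole
    -- graph, so there are never more than 13 of them. This bounds each step by `13 * (40 * adjCount
    -- M v + 150) + 150`.
    have hk := (d₁.isRepFamily hv.le).card_le h₁ h₄ h₆ h₇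
    refine (runs_classifyCmd hM hB hv rfl ?_ hv₁ ?_ ?_ d₁ (by omega) hk).mono ?_ fun s₂ h => ?_
    · rw [f₁.v 0 (by decide)]; simp [hs₀]
    · rw [f₁.a 0 (by decide)]; simpa using htab
    · rw [f₁.inp (by decide)]; simpa using hinp
    · have := Nat.mul_le_mul_right (adjCount M v * 40 + 150) hk
      omega
    · simpa [IsClassified] using h
  have hk := (d₁.isRepFamily le_rfl).card_le h₁ h₄ h₆ h₇
  have v₁ : s₁.v 0 = n := by rw [f₁.v 0 (by decide)]; simp [hs₀]
  have hcost : 40 ≤ ∑ v ∈ Finset.range n, (adjCount M v * 600 + 2400) + 100 - (cost 0 + 2) -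
      (∑ v ∈ Finset.range n, (adjCount M v * 520 + 2100 + 8) + 4) := by
    simp only [Finset.sum_add_distrib, ← Finset.sum_mul]
    simp
    omega
  refine Runs.put_seq (by simp [v₁]; omega) ?_ (hT := by simp at hcost ⊢; omega)
  refine Runs.put' (by simp [v₁]; omega) ?_ (hT := by simp at hcost ⊢; omega)
  constructor
  · simp [v₁]
  · have : s₁.a 0 = s.a 0 := f₁.a 0 (by decide)
    simpa [IsAdjacencyTable, this] using htab
  · have := d₁.isRepFamily le_rfl
    convert this using 1
    all_goals first | (simp; done) | (funext i; simp [v₁])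
  · exact hk
  · simpa using d₁.cls_lt
  · intro u hu
    have := d₁.cls_lt u hu
    simpa [this.ne] using d₁.twins u hu
  · intro i hi
    simp at hi
    simpa [hi.ne] using d₁.card i
  · simp [v₁]
  · simpa using d₁.rank_eq

end RAM

/-! ### Stable triples of representatives -/

namespace RAM

open Ex Cmd

/-- The entry of array `5` at the number in variable `20` becomes `0`, if the representatives given
there by the arrays `p` and `q` are adjacent. -/
def separateCmd (p q : ℕ) : Cmd :=
  ite (.eq (arr 0 (arr 1 (arr p (var 20)) * (var 0 + 1) + arr 1 (arr q (var 20)))) 0) skip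
    (put 5 (var 20) 0)

/-- Variable `2` becomes the number `k + 1` of representatives including the dummy, variable `3` its
third power, and variable `4` becomes `4 ^ k`. The arrays `9`, `10` and `11` list the triples of
representatives, and array `5` tells which of them are stable. -/
def triplesCmd : Cmd := block
  [set 2 (var 1 + 1),
   set 3 (var 2 * var 2 * var 2),
   set 4 1,
   loop 14 1 (set 4 (var 4 * 4)),
   loop 20 3 <| block
    [put 9 (var 20) (var 20 / (var 2 * var 2)),
     put 10 (var 20) (var 20 / var 2 - var 20 / (var 2 * var 2) * var 2),
     put 11 (var 20) (var 20 - var 20 / var 2 * var 2),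
     put 5 (var 20) 1,
     separateCmd 9 10, separateCmd 9 11, separateCmd 10 11]]

variable {n : ℕ} {G : SimpleGraph (Fin n)} {M : ℕ → ℕ} {P : Params} {s : Store}

theorem runs_separateCmd {p q t : ℕ} (hp : p < 16) (hq : q < 16) (hs₀ : s.v 0 = n) (ht : s.v 20 = t)
    (htab : IsAdjacencyTable G (s.a 0)) (hx : s.a 1 (s.a p t) ≤ n) (hy : s.a 1 (s.a q t) ≤ n) :
    Runs P (separateCmd p q) s 60 fun s' =>
      (s'.a 5 t ≠ 0 ↔ s.a 5 t ≠ 0 ∧ ¬ ClosedAdj G (s.a 1 (s.a p t)) (s.a 1 (s.a q t))) ∧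
        ∀ i ≠ t, s'.a 5 i = s.a 5 i := by
  have hwf : (arr 0 (arr 1 (arr p (var 20)) * (var 0 + 1) + arr 1 (arr q (var 20)))).wf = true := by
    simp [wf, consts, deg, hp, hq]
  have key := htab _ hx _ hy
  refine Runs.ite_eq (fun h => Runs.done ?_) (fun h => Runs.put' (by simp) ?_) (he := hwf)
  · simp [hs₀, ht] at h
    simp [← key, h]
  · simp [hs₀, ht] at h
    refine ⟨by simp [← key, h, ht], fun i hi => by simp [ht, hi]⟩

/-- The arrays hold the triple number `t`. -/
def HasTriple {n : ℕ} (G : SimpleGraph (Fin n)) (k : ℕ) (s : Store) (t : ℕ) : Prop :=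
  s.a 9 t = t / ((k + 1) * (k + 1)) ∧
  s.a 10 t = t / (k + 1) - t / ((k + 1) * (k + 1)) * (k + 1) ∧
  s.a 11 t = t - t / (k + 1) * (k + 1) ∧
  (s.a 5 t ≠ 0 ↔ StableTriple G (s.a 1) (s.a 9 t) (s.a 10 t) (s.a 11 t))

/-- The triples of representatives are in the store. -/
structure HasTriples {n : ℕ} (G : SimpleGraph (Fin n)) (s : Store) : Prop where
  card_succ : s.v 2 = s.v 1 + 1
  card_triples : s.v 3 = (s.v 1 + 1) * (s.v 1 + 1) * (s.v 1 + 1)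
  card_codes : s.v 4 = 4 ^ s.v 1
  le₁ : ∀ t < s.v 3, s.a 9 t ≤ s.v 1
  le₂ : ∀ t < s.v 3, s.a 10 t ≤ s.v 1
  le₃ : ∀ t < s.v 3, s.a 11 t ≤ s.v 1
  stable : ∀ t < s.v 3, s.a 5 t ≠ 0 ↔ StableTriple G (s.a 1) (s.a 9 t) (s.a 10 t) (s.a 11 t)
  exists_eq : ∀ a ≤ s.v 1, ∀ b ≤ s.v 1, ∀ e ≤ s.v 1, ∃ t < s.v 3,
    s.a 9 t = a ∧ s.a 10 t = b ∧ s.a 11 t = e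

/-- The digits of `t` in base `k + 1`; the largest digit `k` stands for the dummy class. Remainders
are written with division and subtraction, as the machine computes them. -/
theorem digits_lt {k t : ℕ} (ht : t < (k + 1) * (k + 1) * (k + 1)) :
    t / ((k + 1) * (k + 1)) ≤ k ∧ t / (k + 1) - t / ((k + 1) * (k + 1)) * (k + 1) ≤ k ∧
      t - t / (k + 1) * (k + 1) ≤ k := by
  have h₁ : t / ((k + 1) * (k + 1)) < k + 1 := Nat.div_lt_of_lt_mul ht
  have h₂ : t / (k + 1) - t / ((k + 1) * (k + 1)) * (k + 1) = t / (k + 1) % (k + 1) := by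
    rw [← Nat.div_div_eq_div_mul, Nat.mod_eq_sub_mul_div, mul_comm (t / (k + 1) / (k + 1))]
  have h₃ : t - t / (k + 1) * (k + 1) = t % (k + 1) := by
    rw [Nat.mod_eq_sub_mul_div, mul_comm]
  have h₄ := Nat.mod_lt (t / (k + 1)) (Nat.succ_pos k)
  have h₅ := Nat.mod_lt t (Nat.succ_pos k)
  rw [Nat.succ_eq_add_one] at h₄ h₅
  omega

theorem digits_eq {k a b e : ℕ} (ha : a ≤ k) (hb : b ≤ k) (he : e ≤ k) : ∃ t,
    t < (k + 1) * (k + 1) * (k + 1) ∧ t / ((k + 1) * (k + 1)) = a ∧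
      t / (k + 1) - t / ((k + 1) * (k + 1)) * (k + 1) = b ∧ t - t / (k + 1) * (k + 1) = e := by
  have h₁ : ((a * (k + 1) + b) * (k + 1) + e) / (k + 1) = a * (k + 1) + b := by
    rw [mul_comm, Nat.mul_add_div (by omega), Nat.div_eq_of_lt (by omega), add_zero]
  have h₂ : (a * (k + 1) + b) / (k + 1) = a := by
    rw [mul_comm, Nat.mul_add_div (by omega), Nat.div_eq_of_lt (by omega), add_zero]
  refine ⟨(a * (k + 1) + b) * (k + 1) + e, ?_, ?_, ?_, ?_⟩
  · nlinarith [Nat.mul_le_mul_right (k + 1) (Nat.mul_le_mul_right (k + 1) ha),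
      Nat.mul_le_mul_right (k + 1) hb]
  · rw [← Nat.div_div_eq_div_mul, h₁, h₂]
  · rw [← Nat.div_div_eq_div_mul, h₁, h₂]; omega
  · rw [h₁]; omega

theorem runs_triplesCmd (hs : HasClasses G s) (hVn : n + 1 ≤ P.V) :
    Runs P triplesCmd s 2000000 fun s' => HasTriples G s' := by
  have hV := P.hV
  have hk := hs.le
  have h4 : ∀ i ≤ 13, 4 ^ i ≤ 4 ^ 13 := fun i hi => Nat.pow_le_pow_right (by omega) hi
  have hK : (s.v 1 + 1) * (s.v 1 + 1) * (s.v 1 + 1) ≤ 14 * 14 * 14 :=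
    Nat.mul_le_mul (Nat.mul_le_mul (by omega) (by omega)) (by omega)
  have hR : ∀ i ≤ s.v 1, s.a 1 i ≤ n := fun i hi => by
    rcases hi.lt_or_eq with h | h
    · exact (hs.rep.lt i h).le
    · rw [h, hs.rep.dummy]
  simp only [triplesCmd, block]
  refine Runs.of_bdd fun hbdd => ?_
  refine Runs.set_seq (by simp; omega) ?_
  refine Runs.set_seq (by simp; omega) ?_
  refine Runs.set_seq (by simp; omega) ?_
  refine Runs.cut 1000 (fun s' => s'.v 4 = 4 ^ s.v 1) (by simp)
    (Runs.for (s.v 1) 10 (fun i s' => s'.v 4 = 4 ^ i) (by simp) (by omega) (by simp) ?_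
      fun _ _ _ h => h) fun s₁ f₁ h₁ => ?_
  · intro i hi s' f hi' h
    have := h4 (i + 1) (by omega)
    refine Runs.set' ?_ ?_
    · simp [h, ← pow_succ]; omega
    · simp [h, ← pow_succ]
  have e₀ : s₁.v 0 = n := by rw [f₁.v 0 (by decide)]; simp [hs.order]
  have e₁ : s₁.v 1 = s.v 1 := by rw [f₁.v 1 (by decide)]; simp
  have e₂ : s₁.v 2 = s.v 1 + 1 := by rw [f₁.v 2 (by decide)]; simp
  have e₃ : s₁.v 3 = (s.v 1 + 1) * (s.v 1 + 1) * (s.v 1 + 1) := by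
    rw [f₁.v 3 (by decide)]; simp
  have t₁ : IsAdjacencyTable G (s₁.a 0) := by rw [f₁.a 0 (by decide)]; simpa using hs.table
  have a₁ : s₁.a 1 = s.a 1 := by rw [f₁.a 1 (by decide)]; simp
  refine Runs.for _ 400 (fun i s' => ∀ t < i, HasTriple G (s.v 1) s' t) e₃ (by simp; omega)
    (by simp) ?_ ?_
  · intro i hi s₂ f₂ hi₂ h₂
    have b₀ : s₂.v 0 = n := by rw [f₂.v 0 (by decide), e₀]
    have b₂ : s₂.v 2 = s.v 1 + 1 := by rw [f₂.v 2 (by decide), e₂]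
    have u₂ : IsAdjacencyTable G (s₂.a 0) := by rw [f₂.a 0 (by decide)]; exact t₁
    have c₂ : s₂.a 1 = s.a 1 := by rw [f₂.a 1 (by decide), a₁]
    obtain ⟨d₁, d₂, d₃⟩ := digits_lt hi
    refine Runs.put_seq (by simp [hi₂, b₂]; omega) ?_
    refine Runs.put_seq (by simp [hi₂, b₂]; omega) ?_
    refine Runs.put_seq (by simp [hi₂, b₂]; omega) ?_
    refine Runs.put_seq (by simp; omega) ?_
    refine Runs.generalize (F := fun s' => s'.v 0 = n ∧ s'.v 20 = i ∧ s'.a 0 = s₂.a 0 ∧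
      s'.a 1 = s.a 1 ∧ s'.a 9 i = i / ((s.v 1 + 1) * (s.v 1 + 1)) ∧
      s'.a 10 i = i / (s.v 1 + 1) - i / ((s.v 1 + 1) * (s.v 1 + 1)) * (s.v 1 + 1) ∧
      s'.a 11 i = i - i / (s.v 1 + 1) * (s.v 1 + 1) ∧ s'.a 5 i ≠ 0 ∧
      ∀ t < i, HasTriple G (s.v 1) s' t) ?_ ?_
    · refine ⟨by simp [b₀], by simp [hi₂], by simp, by simp [c₂], by simp [hi₂, b₂],
        by simp [hi₂, b₂], by simp [hi₂, b₂], by simp [hi₂], fun t ht => ?_⟩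
      have := h₂ t ht
      simpa [HasTriple, hi₂, ht.ne, c₂] using this
    rintro s₃ ⟨g₀, g₂₀, g₁, g₂, g₃, g₄, g₅, g₆, g₇⟩
    have u₃ : IsAdjacencyTable G (s₃.a 0) := g₁ ▸ u₂
    have x₁ : s₃.a 1 (s₃.a 9 i) ≤ n := g₂ ▸ hR _ (g₃ ▸ d₁)
    have x₂ : s₃.a 1 (s₃.a 10 i) ≤ n := g₂ ▸ hR _ (g₄ ▸ d₂)
    have x₃ : s₃.a 1 (s₃.a 11 i) ≤ n := g₂ ▸ hR _ (g₅ ▸ d₃)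
    refine Runs.cut 60 _ (by simp) (runs_separateCmd (by decide) (by decide) g₀ g₂₀ u₃ x₁ x₂)
      fun s₄ f₄ h₄ => ?_
    have r₀ : s₄.a 0 = s₃.a 0 := f₄.a _ (by decide)
    have r₁ : s₄.a 1 = s₃.a 1 := f₄.a _ (by decide)
    have r₉ : s₄.a 9 = s₃.a 9 := f₄.a _ (by decide)
    have r₁₀ : s₄.a 10 = s₃.a 10 := f₄.a _ (by decide)
    have r₁₁ : s₄.a 11 = s₃.a 11 := f₄.a _ (by decide)
    have v₀ : s₄.v 0 = n := (f₄.v _ (by decide)).trans g₀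
    have v₂₀ : s₄.v 20 = i := (f₄.v _ (by decide)).trans g₂₀
    refine Runs.cut 60 _ (by simp) (runs_separateCmd (by decide) (by decide) v₀ v₂₀ (r₀ ▸ u₃)
      (by rw [r₁, r₉]; exact x₁) (by rw [r₁, r₁₁]; exact x₃)) fun s₅ f₅ h₅ => ?_
    have q₀ : s₅.a 0 = s₃.a 0 := (f₅.a _ (by decide)).trans r₀
    have q₁ : s₅.a 1 = s₃.a 1 := (f₅.a _ (by decide)).trans r₁
    have q₉ : s₅.a 9 = s₃.a 9 := (f₅.a _ (by decide)).trans r₉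
    have q₁₀ : s₅.a 10 = s₃.a 10 := (f₅.a _ (by decide)).trans r₁₀
    have q₁₁ : s₅.a 11 = s₃.a 11 := (f₅.a _ (by decide)).trans r₁₁
    have w₀ : s₅.v 0 = n := (f₅.v _ (by decide)).trans v₀
    have w₂₀ : s₅.v 20 = i := (f₅.v _ (by decide)).trans v₂₀
    refine (runs_separateCmd (by decide) (by decide) w₀ w₂₀ (q₀ ▸ u₃)
      (by rw [q₁, q₁₀]; exact x₂) (by rw [q₁, q₁₁]; exact x₃)).mono_frame (by simp)
      fun s₆ f₆ h₆ t ht => ?_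
    have p₁ : s₆.a 1 = s₃.a 1 := (f₆.a _ (by decide)).trans q₁
    have p₉ : s₆.a 9 = s₃.a 9 := (f₆.a _ (by decide)).trans q₉
    have p₁₀ : s₆.a 10 = s₃.a 10 := (f₆.a _ (by decide)).trans q₁₀
    have p₁₁ : s₆.a 11 = s₃.a 11 := (f₆.a _ (by decide)).trans q₁₁
    simp only [HasTriple, Store.setV_a, p₁, p₉, p₁₀, p₁₁]
    rcases Nat.lt_succ_iff_lt_or_eq.1 ht with ht | rfl
    · rw [h₆.2 t ht.ne, h₅.2 t ht.ne, h₄.2 t ht.ne]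
      exact g₇ t ht
    · refine ⟨g₃, g₄, g₅, ?_⟩
      rw [h₆.1, h₅.1, h₄.1, r₁, r₉, r₁₁, q₁, q₁₀, q₁₁, StableTriple]
      simp only [g₆, true_and, and_assoc, ne_eq, not_false_eq_true]
  · intro s₂ f₂ hi₂ h₂
    have b₁ : s₂.v 1 = s.v 1 := by rw [f₂.v 1 (by decide), e₁]
    have b₃ : s₂.v 3 = _ := (f₂.v 3 (by decide)).trans e₃
    constructor
    · rw [b₁, f₂.v 2 (by decide), e₂]
    · rw [b₁, b₃]
    · rw [b₁, f₂.v 4 (by decide), h₁]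
    · intro t ht
      rw [b₃] at ht
      rw [b₁, (h₂ t ht).1]
      exact (digits_lt ht).1
    · intro t ht
      rw [b₃] at ht
      rw [b₁, (h₂ t ht).2.1]
      exact (digits_lt ht).2.1
    · intro t ht
      rw [b₃] at ht
      rw [b₁, (h₂ t ht).2.2.1]
      exact (digits_lt ht).2.2
    · intro t ht
      exact (h₂ t (b₃ ▸ ht)).2.2.2
    · rw [b₁]
      intro a ha b hb e he
      obtain ⟨t, ht, h⟩ := digits_eq ha hb he
      have := h₂ t ht
      exact ⟨t, by rwa [b₃], by rw [this.1, h.1], by rw [this.2.1, h.2.1], by rw [this.2.2.1, h.2.2]⟩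

end RAM

/-! ### Weight vectors as numbers in base four -/

section Codes

variable {n : ℕ} {G : SimpleGraph (Fin n)} {k : ℕ} {R : ℕ → ℕ}

/-- The weights on `k` classes with the digits of `x` in base four. -/
def codeWeight (k x i : ℕ) : ℕ := if i < k then x / 4 ^ i % 4 else 0

theorem codeWeight_le (k x i : ℕ) : codeWeight k x i ≤ 3 := by
  unfold codeWeight
  split_ifs <;> omega

theorem codeWeight_self (k x : ℕ) : codeWeight k x k = 0 := if_neg (lt_irrefl k)

theorem exists_code (c : ℕ → ℕ) (hc : ∀ i, c i ≤ 3) (k : ℕ) :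
    ∃ x < 4 ^ k, ∀ i < k, x / 4 ^ i % 4 = c i := by
  induction k generalizing c with
  | zero => exact ⟨0, by simp, by simp⟩
  | succ k ih =>
    obtain ⟨x, hx, h⟩ := ih (fun i => c (i + 1)) fun i => hc _
    have h₀ := hc 0
    refine ⟨c 0 + 4 * x, by rw [pow_succ]; omega, fun i hi => ?_⟩
    cases i with
    | zero => simp; omega
    | succ i =>
      rw [pow_succ', ← Nat.div_div_eq_div_mul]
      have : (c 0 + 4 * x) / 4 = x := by omega
      rw [this]
      exact h i (by omega)

/-- The weighted counting bound for the weights with the code `x`. -/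
def CodeBound {n : ℕ} (G : SimpleGraph (Fin n)) (k : ℕ) (R w : ℕ → ℕ) (q x : ℕ) : Prop :=
  ∀ r, WeightBound G k R (codeWeight k x) r →
    ∑ i ∈ Finset.range k, codeWeight k x i * w i ≤ r * q

theorem CodeBound.mono {w : ℕ → ℕ} {q q' x : ℕ} (h : CodeBound G k R w q x) (hq : q ≤ q') :
    CodeBound G k R w q' x :=
  fun r hr => (h r hr).trans (Nat.mul_le_mul_left r hq)

/-- Only the values on the `k` classes and on the dummy matter, so all weights up to 3 reduce to `4
^ k` codes. -/
theorem countingBound_iff {w : ℕ → ℕ} {q : ℕ} :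
    CountingBound G k R w q ↔ ∀ x < 4 ^ k, CodeBound G k R w q x := by
  refine ⟨fun h x _ r hr => h _ (codeWeight_le k x) (codeWeight_self k x) r hr,
    fun h c hc hck r hr => ?_⟩
  obtain ⟨x, hx, hxc⟩ := exists_code c hc k
  have e : ∀ i ≤ k, codeWeight k x i = c i := fun i hi => by
    unfold codeWeight
    split_ifs with hik
    · exact hxc i hik
    · rw [le_antisymm hi (not_lt.1 hik), hck]
  have := h x hx r fun a ha b hb d hd hst => by rw [e a ha, e b hb, e d hd]; exact hr a ha b hb d hd hst
  rwa [Finset.sum_congr rfl fun i hi => by rw [e i (Finset.mem_range.1 hi).le]] at this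

end Codes

/-! ### Computing the number of colors -/

namespace RAM

open Ex Cmd

/-- The total weight of the triple in variable `20`. -/
def tripleWeight : Ex := arr 6 (arr 9 (var 20)) + arr 6 (arr 10 (var 20)) + arr 6 (arr 11 (var 20))

/-- Array `6` receives the weights with the code in variable `24`, variable `27` the total weight of
the graph, and variable `28` the maximal weight of a stable set. -/
def evalCmd : Cmd := block
  [set 25 (var 24),
   set 27 0,
   loop 26 1 <| block
    [put 6 (var 26) (var 25 - var 25 / 4 * 4),
     set 27 (var 27 + arr 6 (var 26) * arr 2 (var 26)),
     set 25 (var 25 / 4)],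
   put 6 (var 1) 0,
   set 28 0,
   loop 20 3 <| ite (.eq (arr 5 (var 20)) 0) skip <| block
    [set 29 tripleWeight, ite (.lt (var 28) (var 29)) (set 28 (var 29)) skip]]

/-- Variable `5` becomes the smallest number of colors that obeys the weighted counting bound. -/
def countCmd : Cmd := block
  [set 5 0,
   loop 24 4 <| block
    [evalCmd,
     ite (.eq (var 28) 0) skip <| block
      [set 30 ((var 27 + var 28 - 1) / var 28),
       ite (.lt (var 5) (var 30)) (set 5 (var 30)) skip]]]

variable {n : ℕ} {G : SimpleGraph (Fin n)} {M : ℕ → ℕ} {P : Params} {s : Store}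

/-- The store holds the result of `evalCmd` for the code `x`. -/
structure HasWeights {n : ℕ} (G : SimpleGraph (Fin n)) (x : ℕ) (s : Store) : Prop where
  weight : ∀ i ≤ s.v 1, s.a 6 i = codeWeight (s.v 1) x i
  total : s.v 27 = ∑ i ∈ Finset.range (s.v 1), codeWeight (s.v 1) x i * s.a 2 i
  bound : WeightBound G (s.v 1) (s.a 1) (codeWeight (s.v 1) x) (s.v 28)
  least : ∀ r, WeightBound G (s.v 1) (s.a 1) (codeWeight (s.v 1) x) r → s.v 28 ≤ r

theorem HasTriples.congr (h : HasTriples G s) {s' : Store} (h₁ : s'.v 1 = s.v 1)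
    (h₂ : s'.v 2 = s.v 2) (h₃ : s'.v 3 = s.v 3) (h₄ : s'.v 4 = s.v 4) (k₁ : s'.a 1 = s.a 1)
    (k₅ : s'.a 5 = s.a 5) (k₉ : s'.a 9 = s.a 9) (k₁₀ : s'.a 10 = s.a 10) (k₁₁ : s'.a 11 = s.a 11) :
    HasTriples G s' := by
  obtain ⟨a, b, d, e, f, g, i, j⟩ := h
  constructor <;> simpa only [h₁, h₂, h₃, h₄, k₁, k₅, k₉, k₁₀, k₁₁]

theorem HasTriples.frame (h : HasTriples G s) {c : Cmd} {s' : Store} (hf : Frame c s s')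
    (hv : ∀ x ∈ [1, 2, 3, 4], x ∉ c.vars) (ha : ∀ x ∈ [1, 5, 9, 10, 11], x ∉ c.arrs) :
    HasTriples G s' := by
  simp only [List.mem_cons, List.not_mem_nil, or_false, forall_eq_or_imp, forall_eq] at hv ha
  exact h.congr (hf.v _ hv.1) (hf.v _ hv.2.1) (hf.v _ hv.2.2.1) (hf.v _ hv.2.2.2) (hf.a _ ha.1)
    (hf.a _ ha.2.1) (hf.a _ ha.2.2.1) (hf.a _ ha.2.2.2.1) (hf.a _ ha.2.2.2.2)

@[simp] theorem cost_tripleWeight : tripleWeight.cost = 44 := rfl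

@[simp] theorem ok_tripleWeight (B : ℕ) (s : Store) : tripleWeight.Ok B s := by simp [tripleWeight]

@[simp] theorem eval_tripleWeight (s : Store) : tripleWeight.eval s =
    s.a 6 (s.a 9 (s.v 20)) + s.a 6 (s.a 10 (s.v 20)) + s.a 6 (s.a 11 (s.v 20)) := rfl

theorem HasTriples.weightBound_iff (h : HasTriples G s) (c : ℕ → ℕ) (r : ℕ) :
    WeightBound G (s.v 1) (s.a 1) c r ↔
      ∀ t < s.v 3, s.a 5 t ≠ 0 → c (s.a 9 t) + c (s.a 10 t) + c (s.a 11 t) ≤ r := by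
  constructor
  · intro hr t ht hst
    exact hr _ (h.le₁ t ht) _ (h.le₂ t ht) _ (h.le₃ t ht) ((h.stable t ht).1 hst)
  · intro hr a ha b hb e he hst
    obtain ⟨t, ht, rfl, rfl, rfl⟩ := h.exists_eq a ha b hb e he
    exact hr t ht ((h.stable t ht).2 hst)

theorem runs_evalCmd (hs : HasTriples G s) (hk : s.v 1 ≤ 13) (hw : ∀ i < s.v 1, s.a 2 i ≤ n)
    (hVn : 40 * n ≤ P.V) {x : ℕ} (hx : s.v 24 = x) :
    Runs P evalCmd s 230000 (HasWeights G x) := by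
  have hV := P.hV
  refine Runs.of_bdd fun hbdd => ?_
  have hxV : x ≤ P.V := hx ▸ hbdd.var _
  have hK : (s.v 1 + 1) * (s.v 1 + 1) * (s.v 1 + 1) ≤ 14 * 14 * 14 :=
    Nat.mul_le_mul (Nat.mul_le_mul (by omega) (by omega)) (by omega)
  simp only [evalCmd, block]
  refine Runs.set_seq (by simp [hx, hxV]) ?_
  refine Runs.set_seq (by simp) ?_
  refine Runs.cut 1500 (fun s' => (∀ i < s.v 1, s'.a 6 i = codeWeight (s.v 1) x i) ∧
    s'.v 27 = ∑ i ∈ Finset.range (s.v 1), codeWeight (s.v 1) x i * s.a 2 i) (by simp)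
    (Runs.for (s.v 1) 80 (fun j s' => s'.v 25 = x / 4 ^ j ∧
      (∀ i < j, s'.a 6 i = codeWeight (s.v 1) x i) ∧
      s'.v 27 = ∑ i ∈ Finset.range j, codeWeight (s.v 1) x i * s.a 2 i) (by simp) (by omega)
      (by simp [hx]) ?_ fun _ _ _ h => h.2) fun s₁ f₁ ⟨h₆, h₂₇⟩ => ?_
  · rintro j hj s₁ f₁ hj₁ ⟨h₁, h₂, h₃⟩
    have a₂ : s₁.a 2 = s.a 2 := f₁.a 2 (by decide)
    have hd : s₁.v 25 - s₁.v 25 / 4 * 4 = codeWeight (s.v 1) x j := by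
      rw [h₁, codeWeight, if_pos hj]; omega
    have hc := codeWeight_le (s.v 1) x
    have hsum : ∑ i ∈ Finset.range (j + 1), codeWeight (s.v 1) x i * s.a 2 i ≤ (j + 1) * (3 * n) := by
      have := Finset.sum_le_card_nsmul (Finset.range (j + 1))
        (fun i => codeWeight (s.v 1) x i * s.a 2 i) (3 * n) fun i hi =>
          Nat.mul_le_mul (hc i) (hw i (by have := Finset.mem_range.1 hi; omega))
      simpa using this
    have hsum' : (j + 1) * (3 * n) ≤ 13 * (3 * n) := Nat.mul_le_mul_right _ (by omega)
    rw [Finset.sum_range_succ, ← h₃] at hsum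
    refine Runs.put_seq ?_ (Runs.set_seq ?_ (Runs.set' ?_ ⟨?_, ?_, ?_⟩))
    · simp only [eval_hSub, eval_hMul, eval_hDiv, eval_var, eval_ofNat, hd]
      exact (hc j).trans (by omega)
    · simp [hj₁, hd, a₂]; omega
    · simpa [h₁] using (Nat.div_le_self _ _).trans ((Nat.div_le_self _ _).trans hxV)
    · simp [h₁, pow_succ, Nat.div_div_eq_div_mul]
    · intro i hi
      rcases Nat.lt_succ_iff_lt_or_eq.1 hi with hi | rfl
      · simp [hj₁, hi.ne, h₂ i hi]
      · simp [hj₁, hd]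
    · simp [hj₁, hd, a₂, Finset.sum_range_succ, h₃]
  have t₁ : HasTriples G s₁ := by
    refine HasTriples.frame (HasTriples.congr hs ?_ ?_ ?_ ?_ ?_ ?_ ?_ ?_ ?_) f₁ (by decide) (by decide)
    all_goals simp
  have v₁ : s₁.v 1 = s.v 1 := by rw [f₁.v 1 (by decide)]; simp
  have a₁ : s₁.a 1 = s.a 1 := by rw [f₁.a 1 (by decide)]; simp
  have a₂ : s₁.a 2 = s.a 2 := by rw [f₁.a 2 (by decide)]; simp
  refine Runs.put_seq (by simp) ?_
  refine Runs.set_seq (by simp) ?_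
  refine Runs.generalize (F := fun s' => HasTriples G s' ∧ s'.v 1 = s.v 1 ∧ s'.a 1 = s.a 1 ∧
    s'.a 2 = s.a 2 ∧ (∀ i ≤ s.v 1, s'.a 6 i = codeWeight (s.v 1) x i) ∧
    s'.v 27 = ∑ i ∈ Finset.range (s.v 1), codeWeight (s.v 1) x i * s.a 2 i ∧ s'.v 28 = 0) ?_ ?_
  · refine ⟨?_, by simp [v₁], by simp [a₁], by simp [a₂], fun i hi => ?_, by simp [h₂₇], by simp⟩
    · refine t₁.congr ?_ ?_ ?_ ?_ ?_ ?_ ?_ ?_ ?_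
      all_goals simp
    · rcases hi.lt_or_eq with hi | rfl
      · simp [v₁, hi.ne, h₆ i hi]
      · simp [v₁, codeWeight_self]
  rintro s₂ ⟨t₂, v₂, b₁, b₂, b₆, b₂₇, b₂₈⟩
  refine Runs.for _ 75 (fun j s' => (∀ t < j, s₂.a 5 t ≠ 0 → codeWeight (s.v 1) x (s₂.a 9 t) +
      codeWeight (s.v 1) x (s₂.a 10 t) + codeWeight (s.v 1) x (s₂.a 11 t) ≤ s'.v 28) ∧
    ∀ r, (∀ t < j, s₂.a 5 t ≠ 0 → codeWeight (s.v 1) x (s₂.a 9 t) +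
      codeWeight (s.v 1) x (s₂.a 10 t) + codeWeight (s.v 1) x (s₂.a 11 t) ≤ r) → s'.v 28 ≤ r)
    t₂.card_triples (by simp [v₂]; omega) (by simp [b₂₈]) ?_ ?_
  · rintro j hj s₃ f₃ hj₃ ⟨h₁, h₂⟩
    have e₅ : s₃.a 5 = s₂.a 5 := f₃.a _ (by decide)
    have e₆ : s₃.a 6 = s₂.a 6 := f₃.a _ (by decide)
    have e₉ : s₃.a 9 = s₂.a 9 := f₃.a _ (by decide)
    have e₁₀ : s₃.a 10 = s₂.a 10 := f₃.a _ (by decide)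
    have e₁₁ : s₃.a 11 = s₂.a 11 := f₃.a _ (by decide)
    rw [← t₂.card_triples] at hj
    have l₉ := t₂.le₁ j hj
    have l₁₀ := t₂.le₂ j hj
    have l₁₁ := t₂.le₃ j hj
    rw [v₂] at l₉ l₁₀ l₁₁
    have hsum : tripleWeight.eval s₃ = codeWeight (s.v 1) x (s₂.a 9 j) +
      codeWeight (s.v 1) x (s₂.a 10 j) + codeWeight (s.v 1) x (s₂.a 11 j) := by
      simp [hj₃, e₆, e₉, e₁₀, e₁₁, b₆ _ l₉, b₆ _ l₁₀, b₆ _ l₁₁]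
    have hc := codeWeight_le (s.v 1) x
    have c₉ := hc (s₂.a 9 j)
    have c₁₀ := hc (s₂.a 10 j)
    have c₁₁ := hc (s₂.a 11 j)
    simp only [Nat.forall_lt_succ_right]
    refine Runs.ite_eq (fun h => Runs.done ?_) fun h => Runs.set_seq (by rw [hsum]; omega)
      (Runs.ite_lt (fun h' => Runs.set' ?_ ?_) fun h' => Runs.done ?_)
    · have h' : s₂.a 5 j = 0 := by simpa [hj₃, e₅] using h
      exact ⟨⟨h₁, by simp [h']⟩, fun r hr => h₂ r hr.1⟩
    all_goals
      have h'' : s₂.a 5 j ≠ 0 := by simpa [hj₃, e₅] using h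
      rw [hsum] at *
    · simp; omega
    · simp at h' ⊢
      exact ⟨fun t ht hst => (h₁ t ht hst).trans h'.le, fun r _ hr => hr h''⟩
    · simp at h' ⊢
      exact ⟨⟨h₁, fun _ => h'⟩, fun r hr _ => h₂ r hr⟩
  · rintro s₃ f₃ hj₃ ⟨h₁, h₂⟩
    rw [← t₂.card_triples] at h₁ h₂
    have e₁ : s₃.v 1 = s.v 1 := (f₃.v _ (by decide)).trans v₂
    have e₂ : s₃.a 1 = s.a 1 := (f₃.a _ (by decide)).trans b₁
    have e₃ : s₃.a 2 = s.a 2 := (f₃.a _ (by decide)).trans b₂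
    have e₄ : s₃.a 6 = s₂.a 6 := f₃.a _ (by decide)
    have e₅ : s₃.v 27 = s₂.v 27 := f₃.v _ (by decide)
    have hw := t₂.weightBound_iff (codeWeight (s.v 1) x)
    rw [v₂, b₁] at hw
    constructor
    · rw [e₁, e₄]; exact b₆
    · rw [e₁, e₃, e₅]; exact b₂₇
    · rw [e₁, e₂]; exact (hw _).2 h₁
    · rw [e₁, e₂]; exact fun r hr => h₂ r ((hw _).1 hr)

/-- The result is the maximum over all codes of the total weight divided by the largest weight of a
stable set, rounded up. The bound `H` for `n` colors keeps the numbers small and settles the codes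
for which that largest weight is zero. -/
theorem runs_countCmd (hs : HasTriples G s) (hk : s.v 1 ≤ 13) (hw : ∀ i < s.v 1, s.a 2 i ≤ n)
    (hVn : 40 * n ≤ P.V) (H : CountingBound G (s.v 1) (s.a 1) (s.a 2) n) :
    Runs P countCmd s (4 ^ 13 * 231000 + 100) fun s' =>
      CountingBound G (s.v 1) (s.a 1) (s.a 2) (s'.v 5) ∧
        ∀ q, CountingBound G (s.v 1) (s.a 1) (s.a 2) q → s'.v 5 ≤ q := by
  have hV := P.hV
  have h4 : 4 ^ s.v 1 ≤ 4 ^ 13 := Nat.pow_le_pow_right (by omega) hk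
  simp only [countCmd, block]
  refine Runs.set_seq (by simp) ?_
  have t₀ : HasTriples G (s.setV 5 (eval s 0)) := by
    refine hs.congr ?_ ?_ ?_ ?_ ?_ ?_ ?_ ?_ ?_
    all_goals simp
  refine Runs.for (4 ^ s.v 1) 230900 (fun x s' =>
    (∀ y < x, CodeBound G (s.v 1) (s.a 1) (s.a 2) (s'.v 5) y) ∧
      ∀ q, CountingBound G (s.v 1) (s.a 1) (s.a 2) q → s'.v 5 ≤ q) (by simpa using hs.card_codes)
      (by simp; omega) (by simp) ?_ fun s' _ _ h => ⟨countingBound_iff.2 h.1, h.2⟩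
  rintro x hx s₁ f₁ hx₁ ⟨h₁, h₂⟩
  have t₁ := t₀.frame f₁ (by decide) (by decide)
  have v₁ : s₁.v 1 = s.v 1 := by rw [f₁.v 1 (by decide)]; simp
  have a₁ : s₁.a 1 = s.a 1 := by rw [f₁.a 1 (by decide)]; simp
  have a₂ : s₁.a 2 = s.a 2 := by rw [f₁.a 2 (by decide)]; simp
  simp only [Nat.forall_lt_succ_right]
  refine Runs.cut 230000 _ (by simp) (runs_evalCmd t₁ (by omega) (by rwa [v₁, a₂]) hVn hx₁)
    fun s₂ f₂ w₂ => ?_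
  have v₂ : s₂.v 1 = s.v 1 := (f₂.v _ (by decide)).trans v₁
  have b₁ : s₂.a 1 = s.a 1 := (f₂.a _ (by decide)).trans a₁
  have b₂ : s₂.a 2 = s.a 2 := (f₂.a _ (by decide)).trans a₂
  have v₅ : s₂.v 5 = s₁.v 5 := f₂.v _ (by decide)
  obtain ⟨-, w₂₇, wb, wl⟩ := w₂
  rw [v₂, b₂] at w₂₇
  rw [v₂, b₁] at wb wl
  -- Variable `28` holds the least admissible `r`, and larger `r` only weaken the inequality.
  have hbound : ∀ q, s₂.v 27 ≤ s₂.v 28 * q ↔ CodeBound G (s.v 1) (s.a 1) (s.a 2) q x := fun q => by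
    rw [w₂₇]
    exact ⟨fun h r hr => h.trans (Nat.mul_le_mul_right _ (wl r hr)), fun h => h _ wb⟩
  have Hx := (hbound n).2 (countingBound_iff.1 H x hx)
  refine Runs.ite_eq (fun h => Runs.done ⟨⟨?_, ?_⟩, ?_⟩) fun h => Runs.set_seq ?_
    (Runs.ite_lt (fun h' => Runs.set' ?_ ⟨⟨?_, ?_⟩, ?_⟩) fun h' => Runs.done ⟨⟨?_, ?_⟩, ?_⟩)
  · simpa [v₅] using h₁
  · have h' : s₂.v 28 = 0 := by simpa using h
    refine (hbound _).1 ?_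
    -- With `r = 0`, the bound for `n` colors says that the total weight vanishes, so the code
    -- imposes nothing on the number of colors.
    rw [h', zero_mul] at Hx ⊢
    exact Hx
  · simpa [v₅] using h₂
  all_goals
    have h28 : s₂.v 28 ≠ 0 := by simpa using h
    have hval : ∀ q, (s₂.v 27 + s₂.v 28 - 1) / s₂.v 28 ≤ q ↔
        CodeBound G (s.v 1) (s.a 1) (s.a 2) q x := fun q => by
      rw [← hbound, Nat.div_le_iff_le_mul_add_pred (by omega)]
      omega
    have hn := (hval n).2 ((hbound n).1 Hx)
    try simp [v₅] at h'
    try simp [v₅]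
  · omega
  · omega
  · exact fun y hy => (h₁ y hy).mono h'.le
  · exact (hval _).1 le_rfl
  · exact fun q hq => (hval q).2 (countingBound_iff.1 hq x hx)
  · exact h₁
  · exact (hval _).1 h'
  · exact h₂

end RAM

/-! ### Removing one color class -/

section Removal

variable {n : ℕ} {G : SimpleGraph (Fin n)} {k : ℕ} {R : ℕ → ℕ}

/-- Take one vertex out of the class `x`. -/
def removeOne (w : ℕ → ℕ) (x : ℕ) : ℕ → ℕ := fun i => if i = x then w x - 1 else w i

/-- The color `γ` is given to the last vertex of the class `x`. -/
def colorLast (w col : ℕ → ℕ) (x γ : ℕ) : ℕ → ℕ :=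
  fun i => if i = 16 * (w x - 1) + x then γ else col i

theorem sum_removeOne {w c : ℕ → ℕ} {x : ℕ} (hx : x ≤ k) (hw : 0 < w x) (hc : c k = 0) :
    ∑ i ∈ Finset.range k, c i * removeOne w x i + c x = ∑ i ∈ Finset.range k, c i * w i := by
  rcases hx.lt_or_eq with hx | rfl
  · have hmem := Finset.mem_range.2 hx
    rw [← Finset.add_sum_erase _ _ hmem, ← Finset.add_sum_erase _ (fun i => c i * w i) hmem]
    have : ∑ i ∈ (Finset.range k).erase x, c i * removeOne w x i =
        ∑ i ∈ (Finset.range k).erase x, c i * w i :=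
      Finset.sum_congr rfl fun i hi => by rw [removeOne, if_neg (Finset.ne_of_mem_erase hi)]
    rw [this]
    obtain ⟨m, hm⟩ : ∃ m, w x = m + 1 := ⟨w x - 1, by omega⟩
    simp only [removeOne, if_true, hm, Nat.add_sub_cancel, mul_add, mul_one]
    omega
  · rw [hc, add_zero]
    exact Finset.sum_congr rfl fun i hi => by
      rw [removeOne, if_neg (Finset.mem_range.1 hi).ne]

/-- A triple of classes from which one color class can be taken such that the counting bound holds
for the rest with `g` colors. -/
structure GoodTriple {n : ℕ} (G : SimpleGraph (Fin n)) (k : ℕ) (R w : ℕ → ℕ) (g a b e : ℕ) : Prop where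
  stable : StableTriple G R a b e
  pos₁ : w a ≠ 0
  pos₂ : w b ≠ 0
  pos₃ : w e ≠ 0
  bound : ∀ x < 4 ^ k, ∀ r, WeightBound G k R (codeWeight k x) r →
    ∑ i ∈ Finset.range k, codeWeight k x i * w i ≤
      r * g + (codeWeight k x a + codeWeight k x b + codeWeight k x e)

theorem IsRepFamily.eq_of_not_closedAdj (hR : IsRepFamily G k R) {x : ℕ} (hx : x ≤ k)
    (h : ¬ ClosedAdj G (R x) (R x)) : x = k := by
  rcases hx.lt_or_eq with hx | hx
  · exact absurd (closedAdj_self (hR.lt x hx)) h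
  · exact hx

/-- Removing one vertex from each of the three classes lowers the weighted sum by exactly the weight
of the triple. Entries of a stable triple coincide only if they are the dummy, whose count is at
least 3 and so survives repeated removal. -/
theorem GoodTriple.countingBound (hR : IsRepFamily G k R) {w : ℕ → ℕ} {g a b e : ℕ}
    (h : GoodTriple G k R w g a b e) (hk : 3 ≤ w k) (ha : a ≤ k) (hb : b ≤ k) (he : e ≤ k) :
    0 < removeOne w a b ∧ 0 < removeOne (removeOne w a) b e ∧
      CountingBound G k R (removeOne (removeOne (removeOne w a) b) e) g := by
  obtain ⟨⟨hab, hae, hbe⟩, pa, pb, pe, hsum⟩ := h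
  have h₁ : 0 < removeOne w a b := by
    unfold removeOne
    split_ifs with hh
    · subst hh
      rw [hR.eq_of_not_closedAdj hb hab]; omega
    · omega
  have h₂ : 0 < removeOne (removeOne w a) b e := by
    unfold removeOne
    split_ifs with h₁ h₂ h₂
    · subst h₁ h₂
      rw [hR.eq_of_not_closedAdj he hbe]; omega
    · subst h₁
      rw [hR.eq_of_not_closedAdj he hbe]; omega
    · subst h₂
      rw [hR.eq_of_not_closedAdj he hae]; omega
    · omega
  refine ⟨h₁, h₂, countingBound_iff.2 fun x hx r hr => ?_⟩
  have hc := codeWeight_self k x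
  have := hsum x hx r hr
  rw [← sum_removeOne ha (Nat.pos_of_ne_zero pa) hc, ← sum_removeOne hb h₁ hc,
    ← sum_removeOne he h₂ hc] at this
  omega

/-- In each class `a < k` the vertices with the numbers `w a, …, w₀ a - 1` have been properly
colored with colors from `γ` to `q`; only last vertices of classes from `S` have the color `γ`. -/
structure PartialColoring {n : ℕ} (G : SimpleGraph (Fin n)) (k : ℕ) (R w₀ : ℕ → ℕ) (q γ : ℕ)
    (S : Set ℕ) (w col : ℕ → ℕ) : Prop where
  le : ∀ a < k, w a ≤ w₀ a
  lower : ∀ a < k, ∀ i, w a ≤ i → i < w₀ a → γ ≤ col (16 * i + a)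
  upper : ∀ a < k, ∀ i, w a ≤ i → i < w₀ a → col (16 * i + a) ≤ q
  current : ∀ a < k, ∀ i, w a ≤ i → i < w₀ a → col (16 * i + a) = γ → a ∈ S
  ne : ∀ a < k, ∀ i, w a ≤ i → i < w₀ a → ∀ b < k, ∀ j, w b ≤ j → j < w₀ b →
    ClosedAdj G (R a) (R b) → (a ≠ b ∨ i ≠ j) → col (16 * i + a) ≠ col (16 * j + b)

variable {w₀ w col : ℕ → ℕ} {q γ : ℕ} {S : Set ℕ}

theorem PartialColoring.zero (w₀ col : ℕ → ℕ) (q : ℕ) : PartialColoring G k R w₀ q q ∅ w₀ col := by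
  constructor <;> intros <;> omega

/-- No vertex has the new current color yet, as all colors used so far are at least `γ + 1`. -/
theorem PartialColoring.next (h : PartialColoring G k R w₀ q (γ + 1) S w col) :
    PartialColoring G k R w₀ q γ ∅ w col :=
  ⟨h.le, fun a ha i hi hi' => (Nat.le_succ γ).trans (h.lower a ha i hi hi'), h.upper,
    fun a ha i hi hi' hc => by have := h.lower a ha i hi hi'; omega, h.ne⟩

/-- The vertex colored now can only conflict with vertices of the current color; these lie in
classes from `S`, which are neither equal nor adjacent to `x`. The case `x = k` writes into the
column of the dummy class and changes nothing relevant. -/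
theorem PartialColoring.color (h : PartialColoring G k R w₀ q γ S w col) (hR : IsRepFamily G k R)
    (hk : k < 16) (hγ : γ ≤ q) {x : ℕ} (hx : x ≤ k) (hw : 0 < w x)
    (hS : ∀ y ∈ S, ¬ ClosedAdj G (R y) (R x)) :
    PartialColoring G k R w₀ q γ (insert x S) (removeOne w x) (colorLast w col x γ) := by
  -- A pair of a position and a class is decoded from `16 * i + a` because `k < 16`, so only the
  -- entry of the last vertex of `x` is overwritten.
  have hdec : ∀ a < k, ∀ i, removeOne w x a ≤ i → (a = x ∧ i = w x - 1 ∧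
      colorLast w col x γ (16 * i + a) = γ) ∨
      (w a ≤ i ∧ colorLast w col x γ (16 * i + a) = col (16 * i + a)) := by
    intro a ha i hi
    unfold removeOne at hi
    unfold colorLast
    by_cases hax : a = x
    · subst hax
      rw [if_pos rfl] at hi
      by_cases hiw : i = w a - 1
      · left; simp [hiw]
      · right
        exact ⟨by omega, if_neg (by omega)⟩
    · rw [if_neg hax] at hi
      exact Or.inr ⟨hi, if_neg (by omega)⟩
  have hxS : x < k → x ∉ S := fun hxk hxS => hS x hxS (closedAdj_self (hR.lt x hxk))
  constructor
  · intro a ha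
    unfold removeOne
    split_ifs with hax
    · subst hax; have := h.le a ha; omega
    · exact h.le a ha
  · intro a ha i hi hi'
    rcases hdec a ha i hi with ⟨-, -, e⟩ | ⟨hi, e⟩
    · exact e.ge
    · rw [e]; exact h.lower a ha i hi hi'
  · intro a ha i hi hi'
    rcases hdec a ha i hi with ⟨-, -, e⟩ | ⟨hi, e⟩
    · rw [e]; exact hγ
    · rw [e]; exact h.upper a ha i hi hi'
  · intro a ha i hi hi' hc
    rcases hdec a ha i hi with ⟨hax, -, -⟩ | ⟨hi, e⟩
    · exact Or.inl hax
    · rw [e] at hc; exact Or.inr (h.current a ha i hi hi' hc)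
  · intro a ha i hi hi' b hb j hj hj' hadj hne
    rcases hdec a ha i hi with ⟨rfl, hiw, e⟩ | ⟨hi₂, e⟩
    · rcases hdec b hb j hj with ⟨rfl, hjw, e'⟩ | ⟨hj₂, e'⟩
      · omega
      · rw [e, e']
        exact fun hc => hS b (h.current b hb j hj₂ hj' hc.symm) hadj.symm
    · rcases hdec b hb j hj with ⟨rfl, hjw, e'⟩ | ⟨hj₂, e'⟩
      · rw [e, e']
        exact fun hc => hS a (h.current a ha i hi₂ hi' hc) hadj
      · rw [e, e']
        exact h.ne a ha i hi₂ hi' b hb j hj₂ hj' hadj hne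

end Removal

/-! ### Peeling off color classes by exhaustive search -/

namespace RAM

open Ex Cmd

/-- Array `7` holds `0` at the stable triples that only consist of nonempty classes. -/
def nonemptyCmd : Cmd :=
  loop 20 3 <| block
    [put 7 (var 20) 1,
     ite (.eq (arr 5 (var 20)) 0) skip <|
     ite (.eq (arr 2 (arr 9 (var 20))) 0) skip <|
     ite (.eq (arr 2 (arr 10 (var 20))) 0) skip <|
     ite (.eq (arr 2 (arr 11 (var 20))) 0) skip <| put 7 (var 20) 0]

/-- Mark the triples that do not satisfy the bound for the weights in array `6`. -/
def boundCmd : Cmd :=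
  loop 20 3 <| ite (.lt (var 28 * var 6 + tripleWeight) (var 27)) (put 7 (var 20) 1) skip

/-- Array `7` holds `0` exactly at the good triples for the number of colors in variable `6`. -/
def markCmd : Cmd := block [nonemptyCmd, loop 24 4 <| block [evalCmd, boundCmd]]

/-- Variable `32` becomes the number of a good triple. -/
def chooseCmd : Cmd := block
  [set 32 0, loop 20 3 <| ite (.eq (arr 7 (var 20)) 0) (set 32 (var 20)) skip]

/-- Color the last vertex of a class of the chosen triple. -/
def removeCmd (p : ℕ) : Cmd := block
  [set 33 (arr p (var 32)),
   put 2 (var 33) (arr 2 (var 33) - 1),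
   put 8 (16 * arr 2 (var 33) + var 33) (var 6 + 1)]

/-- Color all vertices with the colors from the number in variable `5` down to `1`. -/
def peelCmd : Cmd :=
  loop 31 5 <| block
    [set 6 (var 5 - var 31 - 1), markCmd, chooseCmd, removeCmd 9, removeCmd 10, removeCmd 11]

variable {n : ℕ} {G : SimpleGraph (Fin n)} {M : ℕ → ℕ} {P : Params} {s : Store}

theorem runs_nonemptyCmd (hs : HasTriples G s) (hk : s.v 1 ≤ 13) :
    Runs P nonemptyCmd s 250000 fun s' => ∀ t < s.v 3, s'.a 7 t = 0 ↔
      s.a 5 t ≠ 0 ∧ s.a 2 (s.a 9 t) ≠ 0 ∧ s.a 2 (s.a 10 t) ≠ 0 ∧ s.a 2 (s.a 11 t) ≠ 0 := by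
  have hV := P.hV
  have hK : (s.v 1 + 1) * (s.v 1 + 1) * (s.v 1 + 1) ≤ 14 * 14 * 14 :=
    Nat.mul_le_mul (Nat.mul_le_mul (by omega) (by omega)) (by omega)
  rw [← hs.card_triples] at hK
  simp only [nonemptyCmd, block]
  refine Runs.for _ 80 (fun j s' => ∀ t < j, s'.a 7 t = 0 ↔
    s.a 5 t ≠ 0 ∧ s.a 2 (s.a 9 t) ≠ 0 ∧ s.a 2 (s.a 10 t) ≠ 0 ∧ s.a 2 (s.a 11 t) ≠ 0) rfl (by omega)
    (by simp) ?_ fun _ _ _ h => h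
  intro j hj s₁ f₁ hj₁ h₁
  have e₂ : s₁.a 2 = s.a 2 := f₁.a _ (by decide)
  have e₅ : s₁.a 5 = s.a 5 := f₁.a _ (by decide)
  have e₉ : s₁.a 9 = s.a 9 := f₁.a _ (by decide)
  have e₁₀ : s₁.a 10 = s.a 10 := f₁.a _ (by decide)
  have e₁₁ : s₁.a 11 = s.a 11 := f₁.a _ (by decide)
  refine Runs.put_seq (by simp; omega) ?_
  refine Runs.generalize (F := fun s' => s'.v 20 = j ∧ s'.a 2 = s.a 2 ∧ s'.a 5 = s.a 5 ∧
    s'.a 9 = s.a 9 ∧ s'.a 10 = s.a 10 ∧ s'.a 11 = s.a 11 ∧ s'.a 7 j = 1 ∧ ∀ t < j, s'.a 7 t = 0 ↔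
    s.a 5 t ≠ 0 ∧ s.a 2 (s.a 9 t) ≠ 0 ∧ s.a 2 (s.a 10 t) ≠ 0 ∧ s.a 2 (s.a 11 t) ≠ 0) ?_ ?_
  · refine ⟨by simp [hj₁], by simp [e₂], by simp [e₅], by simp [e₉], by simp [e₁₀], by simp [e₁₁],
      by simp [hj₁], fun t ht => ?_⟩
    rw [← h₁ t ht]; simp [hj₁, ht.ne]
  rintro s₂ ⟨g₀, g₂, g₅, g₉, g₁₀, g₁₁, g₇, h₂⟩
  simp only [Nat.forall_lt_succ_right, Store.setV_a]
  refine Runs.ite_eq (fun h => Runs.done ⟨h₂, ?_⟩) fun b₁ => Runs.ite_eq (fun h => Runs.done ⟨h₂, ?_⟩)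
    fun b₂ => Runs.ite_eq (fun h => Runs.done ⟨h₂, ?_⟩) fun b₃ =>
    Runs.ite_eq (fun h => Runs.done ⟨h₂, ?_⟩) fun b₄ => Runs.put' (by simp) ⟨fun t ht => ?_, ?_⟩
  · simp [g₀, g₅] at h; simp [g₇, h]
  · simp [g₀, g₂, g₉] at h; simp [g₇, h]
  · simp [g₀, g₂, g₁₀] at h; simp [g₇, h]
  · simp [g₀, g₂, g₁₁] at h; simp [g₇, h]
  · rw [← h₂ t ht]; simp [g₀, ht.ne]
  · simp only [eval_arr, eval_var, g₀, g₂, g₅, g₉, g₁₀, g₁₁, eval_ofNat, Ne] at *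
    simp
    exact ⟨b₁, b₂, b₃, b₄⟩

theorem runs_boundCmd (hs : HasTriples G s) (hk : s.v 1 ≤ 13) :
    Runs P boundCmd s 195000 fun s' => ∀ t < s.v 3, s'.a 7 t = 0 ↔
      s.a 7 t = 0 ∧ s.v 27 ≤ s.v 28 * s.v 6 +
        (s.a 6 (s.a 9 t) + s.a 6 (s.a 10 t) + s.a 6 (s.a 11 t)) := by
  have hV := P.hV
  have hK : (s.v 1 + 1) * (s.v 1 + 1) * (s.v 1 + 1) ≤ 14 * 14 * 14 :=
    Nat.mul_le_mul (Nat.mul_le_mul (by omega) (by omega)) (by omega)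
  rw [← hs.card_triples] at hK
  simp only [boundCmd]
  refine Runs.for _ 63 (fun j s' => (∀ t < j, s'.a 7 t = 0 ↔
      s.a 7 t = 0 ∧ s.v 27 ≤ s.v 28 * s.v 6 +
        (s.a 6 (s.a 9 t) + s.a 6 (s.a 10 t) + s.a 6 (s.a 11 t))) ∧
      ∀ t, j ≤ t → s'.a 7 t = s.a 7 t) rfl (by omega) (by simp) ?_ fun _ _ _ h => h.1
  rintro j hj s₁ f₁ hj₁ ⟨h₁, h₂⟩
  have e₆ : s₁.a 6 = s.a 6 := f₁.a _ (by decide)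
  have e₉ : s₁.a 9 = s.a 9 := f₁.a _ (by decide)
  have e₁₀ : s₁.a 10 = s.a 10 := f₁.a _ (by decide)
  have e₁₁ : s₁.a 11 = s.a 11 := f₁.a _ (by decide)
  have v₂₈ : s₁.v 28 = s.v 28 := f₁.v _ (by decide)
  have v₂₇ : s₁.v 27 = s.v 27 := f₁.v _ (by decide)
  have v₆ : s₁.v 6 = s.v 6 := f₁.v _ (by decide)
  simp only [Nat.forall_lt_succ_right, Store.setV_a]
  refine Runs.ite_lt (fun h => Runs.put' (by simp; omega) ⟨⟨fun t ht => ?_, ?_⟩, fun t ht => ?_⟩)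
    fun h => Runs.done ⟨⟨h₁, ?_⟩, fun t ht => h₂ t (by omega)⟩
  · rw [← h₁ t ht]; simp [hj₁, ht.ne]
  · simp [hj₁, e₆, e₉, e₁₀, e₁₁, v₂₈, v₂₇, v₆] at h
    simp [hj₁]; omega
  · rw [← h₂ t (by omega)]; simp [hj₁]; omega
  · simp [hj₁, e₆, e₉, e₁₀, e₁₁, v₂₈, v₂₇, v₆] at h
    simp [h₂ j le_rfl, h]

/-- For each code one pass over the triples strikes out those that violate the bound. As in the
computation of the number of colors, it suffices to test the largest weight of a stable set in the
place of all `r`. -/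
theorem runs_markCmd (hs : HasTriples G s) (hk : s.v 1 ≤ 13) (hw : ∀ i < s.v 1, s.a 2 i ≤ n)
    (hVn : 40 * n ≤ P.V) :
    Runs P markCmd s (4 ^ 13 * 425100 + 260000) fun s' => ∀ t < s.v 3, s'.a 7 t = 0 ↔
      GoodTriple G (s.v 1) (s.a 1) (s.a 2) (s.v 6) (s.a 9 t) (s.a 10 t) (s.a 11 t) := by
  have h4 : 4 ^ s.v 1 ≤ 4 ^ 13 := Nat.pow_le_pow_right (by omega) hk
  simp only [markCmd, block]
  refine Runs.cut 250000 _ (by omega) (runs_nonemptyCmd hs hk) fun s₁ f₁ h₁ => ?_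
  have t₁ := hs.frame f₁ (by decide) (by decide)
  have v₁ : s₁.v 1 = s.v 1 := f₁.v _ (by decide)
  have v₃ : s₁.v 3 = s.v 3 := f₁.v _ (by decide)
  have v₆ : s₁.v 6 = s.v 6 := f₁.v _ (by decide)
  have e₁ : s₁.a 1 = s.a 1 := f₁.a _ (by decide)
  have e₂ : s₁.a 2 = s.a 2 := f₁.a _ (by decide)
  have e₉ : s₁.a 9 = s.a 9 := f₁.a _ (by decide)
  have e₁₀ : s₁.a 10 = s.a 10 := f₁.a _ (by decide)
  have e₁₁ : s₁.a 11 = s.a 11 := f₁.a _ (by decide)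
  refine Runs.for (4 ^ s.v 1) 425050 (fun x s' => ∀ t < s.v 3, s'.a 7 t = 0 ↔ s₁.a 7 t = 0 ∧
      ∀ y < x, ∀ r, WeightBound G (s.v 1) (s.a 1) (codeWeight (s.v 1) y) r →
        ∑ i ∈ Finset.range (s.v 1), codeWeight (s.v 1) y i * s.a 2 i ≤
        r * s.v 6 + (codeWeight (s.v 1) y (s.a 9 t) + codeWeight (s.v 1) y (s.a 10 t) +
          codeWeight (s.v 1) y (s.a 11 t))) (by rw [t₁.card_codes, v₁]) (by omega) (by simp) ?_ ?_
  · intro x hx s₂ f₂ hx₂ h₂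
    have t₂ := t₁.frame f₂ (by decide) (by decide)
    have u₁ : s₂.v 1 = s.v 1 := (f₂.v _ (by decide)).trans v₁
    have u₆ : s₂.v 6 = s.v 6 := (f₂.v _ (by decide)).trans v₆
    have u₃ : s₂.v 3 = s.v 3 := (f₂.v _ (by decide)).trans v₃
    have a₁ : s₂.a 1 = s.a 1 := (f₂.a _ (by decide)).trans e₁
    have a₂ : s₂.a 2 = s.a 2 := (f₂.a _ (by decide)).trans e₂
    have a₉ : s₂.a 9 = s.a 9 := (f₂.a _ (by decide)).trans e₉
    have a₁₀ : s₂.a 10 = s.a 10 := (f₂.a _ (by decide)).trans e₁₀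
    have a₁₁ : s₂.a 11 = s.a 11 := (f₂.a _ (by decide)).trans e₁₁
    refine Runs.cut 230000 _ (by omega) (runs_evalCmd t₂ (by omega) (by rwa [u₁, a₂]) hVn hx₂)
      fun s₃ f₃ w₃ => ?_
    have t₃ := t₂.frame f₃ (by decide) (by decide)
    have u₁' : s₃.v 1 = s.v 1 := (f₃.v _ (by decide)).trans u₁
    refine (runs_boundCmd t₃ (by omega)).mono (by omega) fun s₄ h₄ t ht => ?_
    obtain ⟨w₆, w₂₇, wb, wl⟩ := w₃
    rw [u₁', f₃.a 2 (by decide), a₂] at w₂₇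
    rw [u₁', f₃.a 1 (by decide), a₁] at wb wl
    rw [u₁'] at w₆
    rw [f₃.v 3 (by decide), u₃, f₃.v 6 (by decide), u₆, f₃.a 7 (by decide), f₃.a 9 (by decide), a₉,
      f₃.a 10 (by decide), a₁₀, f₃.a 11 (by decide), a₁₁, w₂₇] at h₄
    simp only [Store.setV_a]
    rw [h₄ t ht, h₂ t ht, w₆ _ (hs.le₁ t ht), w₆ _ (hs.le₂ t ht), w₆ _ (hs.le₃ t ht),
      Nat.forall_lt_succ_right, and_assoc]
    refine and_congr_right fun _ => and_congr_right fun _ => ⟨fun h r hr => h.trans ?_,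
      fun h => h _ wb⟩
    exact Nat.add_le_add_right (Nat.mul_le_mul_right _ (wl r hr)) _
  · intro s₂ f₂ _ h₂ t ht
    rw [h₂ t ht, h₁ t ht, hs.stable t ht]
    exact ⟨fun ⟨⟨a, b, c, d⟩, e⟩ => ⟨a, b, c, d, e⟩, fun ⟨a, b, c, d, e⟩ => ⟨⟨a, b, c, d⟩, e⟩⟩

theorem runs_chooseCmd {K : ℕ} (hK : s.v 3 = K) (hK' : K ≤ 14 * 14 * 14) (hg : ∃ t < K, s.a 7 t = 0) :
    Runs P chooseCmd s 100000 fun s' => s'.v 32 < K ∧ s.a 7 (s'.v 32) = 0 := by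
  have hV := P.hV
  simp only [chooseCmd, block]
  refine Runs.set_seq (by simp) ?_
  refine Runs.for K 25 (fun j s' => (∃ t < j, s.a 7 t = 0) → s'.v 32 < K ∧ s.a 7 (s'.v 32) = 0)
    (by simp [hK]) (by simp; omega) (by simp) ?_ fun _ _ _ h => h hg
  intro j hj s₁ f₁ hj₁ h₁
  have e₇ : s₁.a 7 = s.a 7 := by rw [f₁.a _ (by decide)]; simp
  refine Runs.ite_eq (fun h => Runs.set' (by simp; omega) ?_) fun h => Runs.done ?_
  · intro _
    simp [hj₁, e₇] at h ⊢
    exact ⟨hj, h⟩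
  · simp [hj₁, e₇] at h
    rintro ⟨t, ht, h'⟩
    refine h₁ ⟨t, lt_of_le_of_ne (by omega) ?_, h'⟩
    rintro rfl
    exact h h'

theorem runs_removeCmd {p x : ℕ} (hp : p < 16) (hx : s.a p (s.v 32) = x) (hg : s.v 6 + 1 ≤ P.V) :
    Runs P (removeCmd p) s 100 fun s' => s'.a 2 = removeOne (s.a 2) x ∧
      s'.a 8 = colorLast (s.a 2) (s.a 8) x (s.v 6 + 1) := by
  have hwf : (arr p (var 32)).wf = true := by simp [wf, consts, deg, hp]
  simp only [removeCmd, block]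
  refine Runs.of_bdd fun hbdd => ?_
  refine Runs.set_seq (by simpa using hbdd.arr _ _) ?_ (he := hwf)
  refine Runs.put_seq (by simpa using (Nat.sub_le _ _).trans (hbdd.arr _ _)) ?_
  refine Runs.put' (by simpa using hg) ?_
  constructor
  · funext i; simp [removeOne, hx]
  · funext i; simp [colorLast, hx]

/-- A bound for the number of steps that it takes to find and to remove a color class. -/
def peelCost : ℕ := 4 ^ 13 * 425100 + 400000

/-- The invariant is that the rest satisfies the counting bound for the remaining number of colors.
This guarantees that the search finds a good triple, and a good triple restores the invariant. -/
theorem runs_peelCmd (h₁ : ¬ (⊥ : SimpleGraph (Fin 4)).IsIndContained G)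
    (h₄ : ¬ (SimpleGraph.cycleGraph 4).IsIndContained G)
    (h₆ : ¬ (SimpleGraph.cycleGraph 6).IsIndContained G)
    (h₇ : (SimpleGraph.cycleGraph 7).IsIndContained G) (hs : HasTriples G s)
    (hR : IsRepFamily G (s.v 1) (s.a 1)) (hw : ∀ i < s.v 1, s.a 2 i ≤ n)
    (hwk : 3 * s.v 5 ≤ s.a 2 (s.v 1)) (hVn : 40 * n ≤ P.V)
    (H : CountingBound G (s.v 1) (s.a 1) (s.a 2) (s.v 5)) :
    Runs P peelCmd s (s.v 5 * peelCost + 100) fun s' =>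
      CountingBound G (s.v 1) (s.a 1) (s'.a 2) 0 ∧
      PartialColoring G (s.v 1) (s.a 1) (s.a 2) (s.v 5) 0 ∅ (s'.a 2) (s'.a 8) := by
  have hk := hR.card_le h₁ h₄ h₆ h₇
  have hK : (s.v 1 + 1) * (s.v 1 + 1) * (s.v 1 + 1) ≤ 14 * 14 * 14 :=
    Nat.mul_le_mul (Nat.mul_le_mul (by omega) (by omega)) (by omega)
  rw [← hs.card_triples] at hK
  simp only [peelCmd, block]
  refine Runs.of_bdd fun hbdd => ?_
  have hqV := hbdd.var 5
  refine Runs.for (s.v 5) (4 ^ 13 * 425100 + 399000) (fun i s' =>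
    CountingBound G (s.v 1) (s.a 1) (s'.a 2) (s.v 5 - i) ∧
    PartialColoring G (s.v 1) (s.a 1) (s.a 2) (s.v 5) (s.v 5 - i) ∅ (s'.a 2) (s'.a 8) ∧
    3 * (s.v 5 - i) ≤ s'.a 2 (s.v 1)) rfl ?_ ?_ ?_ ?_
  · have := Nat.mul_le_mul_left (s.v 5) (show 4 ^ 13 * 425100 + 399000 + 8 ≤
      peelCost by unfold peelCost; omega)
    exact Nat.add_le_add this (by norm_num)
  · exact ⟨by simpa using H, by simpa using PartialColoring.zero _ _ _, by simpa using hwk⟩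
  · rintro i hi s₁ f₁ hi₁ ⟨H₁, p₁, b₁⟩
    obtain ⟨g, hg⟩ : ∃ g, s.v 5 - i = g + 1 := ⟨s.v 5 - i - 1, by omega⟩
    have hg' : s.v 5 - (i + 1) = g := by omega
    rw [hg] at H₁ p₁ b₁
    rw [hg']
    have v₁ : s₁.v 1 = s.v 1 := f₁.v _ (by decide)
    have v₃ : s₁.v 3 = s.v 3 := f₁.v _ (by decide)
    have v₅ : s₁.v 5 = s.v 5 := f₁.v _ (by decide)
    have e₁ : s₁.a 1 = s.a 1 := f₁.a _ (by decide)
    have t₁ := hs.frame f₁ (by decide) (by decide)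
    refine Runs.set_seq (by simp [hi₁, v₅]; omega) ?_
    refine Runs.generalize (F := fun s' => HasTriples G s' ∧ s'.v 6 = g ∧ s'.v 1 = s.v 1 ∧
      s'.v 3 = s.v 3 ∧ s'.a 1 = s.a 1 ∧ s'.a 2 = s₁.a 2 ∧ s'.a 8 = s₁.a 8) ?_ ?_
    · refine ⟨t₁.congr ?_ ?_ ?_ ?_ ?_ ?_ ?_ ?_ ?_, ?_, by simp [v₁], by simp [v₃], by simp [e₁], rfl,
        rfl⟩
      case refine_10 => simp [v₅, hi₁]; omega
      all_goals simp
    rintro s₂ ⟨t₂, g₂, r₁, r₃, a₁, a₂, a₈⟩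
    refine Runs.cut (4 ^ 13 * 425100 + 260000) _ (by simp) (runs_markCmd t₂ (by omega)
      (by rw [r₁, a₂]; exact fun i hi => (p₁.le i hi).trans (hw i hi)) hVn) fun s₃ f₃ h₃ => ?_
    rw [r₁, r₃, a₁, a₂, g₂] at h₃
    have x₆ : s₃.v 6 = g := (f₃.v _ (by decide)).trans g₂
    refine Runs.cut 100000 _ (by simp) (runs_chooseCmd ((f₃.v 3 (by decide)).trans r₃) hK ?_)
      fun s₄ f₄ ⟨h₄, h₄'⟩ => ?_
    -- The coloring theorem enters the algorithm here, as the mere existence of a good triple; no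
    -- coloring of the types is ever computed.
    · obtain ⟨a, ha, b, hb, e, he, hst, hpos, hsum⟩ := H₁.exists_stableTriple hR h₁ h₄ h₆ h₇
      obtain ⟨t, ht, rfl, rfl, rfl⟩ := t₂.exists_eq a (r₁ ▸ ha) b (r₁ ▸ hb) e (r₁ ▸ he)
      rw [r₃] at ht
      have hpos' : ∀ z ≤ s.v 1, (z = s₂.a 9 t ∨ z = s₂.a 10 t ∨ z = s₂.a 11 t) → s₁.a 2 z ≠ 0 := by
        intro z hz hz'
        rcases hz.lt_or_eq with hz | rfl
        · exact (hpos z hz hz').ne'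
        · omega
      exact ⟨t, ht, (h₃ t ht).2 ⟨hst, hpos' _ ha (Or.inl rfl), hpos' _ hb (Or.inr (Or.inl rfl)),
        hpos' _ he (Or.inr (Or.inr rfl)), fun x hx r hr => hsum _ (codeWeight_self _ _) r hr⟩⟩
    have good := (h₃ _ h₄).1 h₄'
    set t := s₄.v 32 with ht
    have ha := t₂.le₁ t (by omega)
    have hb := t₂.le₂ t (by omega)
    have he := t₂.le₃ t (by omega)
    rw [r₁] at ha hb he
    generalize hA : s₂.a 9 t = a at good ha
    generalize hB : s₂.a 10 t = b at good hb
    generalize hE : s₂.a 11 t = e at good he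
    have y₂ : s₄.a 2 = s₁.a 2 := ((f₄.a _ (by decide)).trans (f₃.a _ (by decide))).trans a₂
    have y₈ : s₄.a 8 = s₁.a 8 := ((f₄.a _ (by decide)).trans (f₃.a _ (by decide))).trans a₈
    have y₆ : s₄.v 6 = g := (f₄.v _ (by decide)).trans x₆
    have y₉ : s₄.a 9 = s₂.a 9 := (f₄.a _ (by decide)).trans (f₃.a _ (by decide))
    have y₁₀ : s₄.a 10 = s₂.a 10 := (f₄.a _ (by decide)).trans (f₃.a _ (by decide))
    have y₁₁ : s₄.a 11 = s₂.a 11 := (f₄.a _ (by decide)).trans (f₃.a _ (by decide))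
    have hgV : g + 1 ≤ P.V := by omega
    refine Runs.cut 100 _ (by simp) (runs_removeCmd (x := a) (by decide) (by rw [y₉, ← ht, hA])
      (by rw [y₆]; exact hgV)) fun s₅ f₅ h₅ => ?_
    rw [y₂, y₈, y₆] at h₅
    have z₆ : s₅.v 6 = g := (f₅.v _ (by decide)).trans y₆
    have z₃₂ : s₅.v 32 = t := f₅.v _ (by decide)
    have z₁₀ : s₅.a 10 = s₂.a 10 := (f₅.a _ (by decide)).trans y₁₀
    have z₁₁ : s₅.a 11 = s₂.a 11 := (f₅.a _ (by decide)).trans y₁₁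
    refine Runs.cut 100 _ (by simp) (runs_removeCmd (x := b) (by decide)
      (by rw [z₁₀, z₃₂, hB]) (by rw [z₆]; exact hgV)) fun s₆ f₆ h₆ => ?_
    rw [h₅.1, h₅.2, z₆] at h₆
    have u₆ : s₆.v 6 = g := (f₆.v _ (by decide)).trans z₆
    have u₃₂ : s₆.v 32 = t := (f₆.v _ (by decide)).trans z₃₂
    have u₁₁ : s₆.a 11 = s₂.a 11 := (f₆.a _ (by decide)).trans z₁₁
    refine (runs_removeCmd (x := e) (by decide) (by rw [u₁₁, u₃₂, hE])
      (by rw [u₆]; exact hgV)).mono (by simp) fun s₇ h₇ => ?_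
    rw [h₆.1, h₆.2, u₆] at h₇
    simp only [Store.setV_a]
    rw [h₇.1, h₇.2]
    obtain ⟨pb, pe, Hg⟩ := good.countingBound hR (by omega) ha hb he
    obtain ⟨⟨hab, hae, hbe⟩, pa, -, -, -⟩ := good
    refine ⟨Hg, ?_, ?_⟩
    · have q₁ := p₁.color hR (by omega) (by omega) ha (Nat.pos_of_ne_zero pa) (by simp)
      have q₂ := q₁.color hR (by omega) (by omega) hb pb (by simpa using hab)
      have q₃ := q₂.color hR (by omega) (by omega) he pe (by simpa using ⟨hbe, hae⟩)
      exact q₃.next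
    -- The dummy class loses at most three members per round, so the initial stock of three per
    -- color suffices.
    · have hrm : ∀ (w : ℕ → ℕ) (x z : ℕ), w z - 1 ≤ removeOne w x z := fun w x z => by
        unfold removeOne; split_ifs with h
        · rw [h]
        · exact Nat.sub_le _ _
      have r₁ := hrm (s₁.a 2) a (s.v 1)
      have r₂ := hrm (removeOne (s₁.a 2) a) b (s.v 1)
      have r₃ := hrm (removeOne (removeOne (s₁.a 2) a) b) e (s.v 1)
      omega
  · rintro s₁ f₁ _ ⟨h₁, h₂, -⟩
    simp only [Nat.sub_self] at h₁ h₂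
    exact ⟨h₁, h₂⟩

end RAM

/-! ### Output, optimality and the whole program -/

namespace RAM

open Ex Cmd

/-- Write the coloring into the output cells. -/
def outputCmd : Cmd := block
  [loop 10 0 <| out (var 10 + 1) (arr 8 (16 * arr 4 (var 10) + arr 3 (var 10))), out 0 (var 5)]

/-- The coloring algorithm. -/
def colorCmd : Cmd := block [adjacencyCmd, classesCmd, triplesCmd, countCmd, peelCmd, outputCmd]

variable {n : ℕ} {G : SimpleGraph (Fin n)} {M : ℕ → ℕ} {P : Params} {s : Store}

theorem HasClasses.congr (h : HasClasses G s) {s' : Store} (h₀ : s'.v 0 = s.v 0)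
    (h₁ : s'.v 1 = s.v 1) (k₀ : s'.a 0 = s.a 0) (k₁ : s'.a 1 = s.a 1) (k₂ : s'.a 2 = s.a 2)
    (k₃ : s'.a 3 = s.a 3) (k₄ : s'.a 4 = s.a 4) : HasClasses G s' := by
  obtain ⟨a, b, c, d, e, f, g, i, j⟩ := h
  constructor <;> simpa only [h₀, h₁, k₀, k₁, k₂, k₃, k₄]

theorem HasClasses.sum_eq (h : HasClasses G s) (c : ℕ → ℕ) :
    ∑ i ∈ Finset.range (s.v 1), c i * s.a 2 i = ∑ v : Fin n, c (s.a 3 v) := by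
  rw [Fin.sum_univ_eq_sum_range (fun v => c (s.a 3 v)) n, ← Finset.sum_fiberwise_of_maps_to
    (t := Finset.range (s.v 1)) (g := s.a 3) fun u hu =>
      Finset.mem_range.2 (h.cls_lt u (Finset.mem_range.1 hu))]
  refine Finset.sum_congr rfl fun i hi => ?_
  rw [h.card i (Finset.mem_range.1 hi), Finset.sum_congr rfl fun u hu => by
    rw [(Finset.mem_filter.1 hu).2], Finset.sum_const, smul_eq_mul, mul_comm]

/-- This is the lower bound for `χ(G)`: every proper coloring with `q` colors, whatever its form,
forces the counting bound for `q`. -/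
theorem HasClasses.countingBound (h : HasClasses G s)
    (h₁ : ¬ (⊥ : SimpleGraph (Fin 4)).IsIndContained G) {q : ℕ} (C : G.Coloring (Fin q)) :
    CountingBound G (s.v 1) (s.a 1) (s.a 2) q := by
  intro c _ hck r hr
  rw [h.sum_eq]
  exact hr.sum_le_of_coloring hck h.rep h₁ (fun v => h.cls_lt v v.2) (fun v => h.twins v v.2) C

theorem HasClasses.le_order (h : HasClasses G s) {i : ℕ} (hi : i < s.v 1) : s.a 2 i ≤ n := by
  rw [h.card i hi]
  exact (Finset.card_filter_le _ _).trans (Finset.card_range n).le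

theorem HasClasses.rank_lt (h : HasClasses G s) {u : ℕ} (hu : u < n) :
    s.a 4 u < s.a 2 (s.a 3 u) := by
  rw [h.rank_eq u hu, h.card _ (h.cls_lt u hu)]
  refine Finset.card_lt_card ⟨fun x hx => ?_, fun hsub => ?_⟩
  · rw [Finset.mem_filter, Finset.mem_range] at hx ⊢
    exact ⟨hx.1.trans hu, hx.2⟩
  · have := hsub (Finset.mem_filter.2 ⟨Finset.mem_range.2 hu, rfl⟩)
    simp at this

theorem HasClasses.rank_ne (h : HasClasses G s) {u v : ℕ} (hu : u < n) (hv : v < n) (huv : u ≠ v)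
    (hcls : s.a 3 u = s.a 3 v) : s.a 4 u ≠ s.a 4 v := by
  wlog hlt : u < v generalizing u v
  · exact (this hv hu huv.symm hcls.symm (by omega)).symm
  rw [h.rank_eq u hu, h.rank_eq v hv, hcls]
  refine (Finset.card_lt_card ⟨fun x hx => ?_, fun hsub => ?_⟩).ne
  · rw [Finset.mem_filter, Finset.mem_range] at hx ⊢
    exact ⟨hx.1.trans hlt, hx.2⟩
  · have := hsub (Finset.mem_filter.2 ⟨Finset.mem_range.2 hlt, hcls⟩)
    simp at this

theorem HasClasses.closedAdj (h : HasClasses G s) {u v : Fin n} (huv : G.Adj u v) :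
    ClosedAdj G (s.a 1 (s.a 3 u)) (s.a 1 (s.a 3 v)) :=
  (h.twins u u.2 _).2 ((h.twins v v.2 u).2 ⟨v.2, u.2, Or.inr huv.symm⟩).symm

/-- The color of the vertex `u` according to the arrays of colors, ranks and classes. -/
def colorOf (col rank cls : ℕ → ℕ) (u : ℕ) : ℕ := col (16 * rank u + cls u)

/-- At most `χ(G)` colors are used because every proper coloring with `m` colors forces the counting
bound for `m`, so that `q ≤ m`. The pair of class and rank is different for different vertices, so
proper coloring of pairs yields proper coloring of vertices. -/
theorem HasClasses.isOptimalColoringOf (h : HasClasses G s)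
    (h₁ : ¬ (⊥ : SimpleGraph (Fin 4)).IsIndContained G) {q : ℕ} {w col : ℕ → ℕ}
    (hq : ∀ q', CountingBound G (s.v 1) (s.a 1) (s.a 2) q' → q ≤ q')
    (hw : CountingBound G (s.v 1) (s.a 1) w 0)
    (hc : PartialColoring G (s.v 1) (s.a 1) (s.a 2) q 0 ∅ w col) {M : ℕ → ℕ} (hM₀ : M 0 = q)
    (hM : ∀ u < n, M (u + 1) = colorOf col (s.a 4) (s.a 3) u) : IsOptimalColoringOf G M := by
  -- Weight one on every class, with stable weight at most 3, shows that for zero colors nothing is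
  -- left uncolored.
  have hw₀ : ∀ a < s.v 1, w a = 0 := by
    have := hw (fun i => if i = s.v 1 then 0 else 1) (fun i => by split_ifs <;> omega)
      (if_pos rfl) 3 fun a _ b _ e _ _ => by dsimp only; split_ifs <;> omega
    rw [mul_zero, Nat.le_zero, Finset.sum_eq_zero_iff] at this
    intro a ha
    have := this a (Finset.mem_range.2 ha)
    rwa [if_neg ha.ne, one_mul] at this
  have hrange : ∀ u < n, 1 ≤ M (u + 1) ∧ M (u + 1) ≤ q := fun u hu => by
    have hcu := h.cls_lt u hu
    have hl : w (s.a 3 u) ≤ s.a 4 u := by rw [hw₀ _ hcu]; omega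
    rw [hM u hu]
    refine ⟨Nat.pos_of_ne_zero fun h0 => ?_, hc.upper _ hcu _ hl (h.rank_lt hu)⟩
    -- Color 0 would be the current color, but no class is allowed to use it.
    exact hc.current _ hcu _ hl (h.rank_lt hu) h0
  have hproper : ∀ u v : Fin n, G.Adj u v → M (u + 1) ≠ M (v + 1) := by
    intro u v huv
    have hcu := h.cls_lt u u.2
    have hcv := h.cls_lt v v.2
    rw [hM u u.2, hM v v.2]
    refine hc.ne _ hcu _ (by rw [hw₀ _ hcu]; omega) (h.rank_lt u.2) _ hcv _
      (by rw [hw₀ _ hcv]; omega) (h.rank_lt v.2) (h.closedAdj huv) ?_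
    by_cases hcls : s.a 3 u = s.a 3 v
    · exact Or.inr (h.rank_ne u.2 v.2 (fun e => G.ne_of_adj huv (Fin.ext e)) hcls)
    · exact Or.inl hcls
  refine ⟨?_, fun v => by rw [hM₀]; exact hrange v v.2, hproper⟩
  rw [hM₀]
  refine le_antisymm (SimpleGraph.Colorable.chromaticNumber_le ⟨SimpleGraph.Coloring.mk
    (fun u => ⟨M (u + 1) - 1, by have := hrange u u.2; omega⟩) fun {u v} huv e => ?_⟩) ?_
  · have h₁ := hrange u u.2
    have h₂ := hrange v v.2
    have h₃ := hproper u v huv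
    simp only [Fin.mk.injEq] at e
    omega
  · exact SimpleGraph.le_chromaticNumber_iff_colorable.2 fun m hm =>
      hq m (h.countingBound h₁ hm.some)

theorem runs_outputCmd (hs₀ : s.v 0 = n) (hB : n < P.B) :
    Runs P outputCmd s (n * 40 + 100) fun s' => s'.inp 0 = s.v 5 ∧
      ∀ u < n, s'.inp (u + 1) = colorOf (s.a 8) (s.a 4) (s.a 3) u := by
  simp only [outputCmd, block]
  refine Runs.cut (n * 40 + 4) (fun s' => ∀ u < n, s'.inp (u + 1) =
    colorOf (s.a 8) (s.a 4) (s.a 3) u) (by omega) (Runs.for n 32 (fun j s' => ∀ u < j,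
      s'.inp (u + 1) = colorOf (s.a 8) (s.a 4) (s.a 3) u) hs₀ (by omega) (by simp) ?_
      fun _ _ _ h => h) fun s₁ f₁ h₁ => Runs.of_bdd fun hbdd => Runs.mono (Runs.out rfl rfl
      (by simp) (by simp) (by simp; omega) (by simpa using hbdd.var 5) ⟨?_, fun u hu => ?_⟩)
      (by simp) fun _ h => h
  · intro j hj s₁ f₁ hj₁ h₁
    refine Runs.of_bdd fun hbdd => Runs.mono (Runs.out rfl rfl (by simp) (by simp)
      (by simp [hj₁]; omega) (by simpa using hbdd.arr 8 _) ?_) (by simp) fun _ h => h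
    have e₃ : s₁.a 3 = s.a 3 := f₁.a _ (by decide)
    have e₄ : s₁.a 4 = s.a 4 := f₁.a _ (by decide)
    have e₈ : s₁.a 8 = s.a 8 := f₁.a _ (by decide)
    rw [Nat.forall_lt_succ_right]
    refine ⟨fun u hu => ?_, ?_⟩
    · simp [hj₁, hu.ne, h₁ u hu]
    · simp [hj₁, e₃, e₄, e₈, colorOf]
  · simp [f₁.v 5 (by decide)]
  · simp [h₁ u hu]

theorem runs_colorCmd (h₁ : ¬ (⊥ : SimpleGraph (Fin 4)).IsIndContained G)
    (h₄ : ¬ (SimpleGraph.cycleGraph 4).IsIndContained G)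
    (h₆ : ¬ (SimpleGraph.cycleGraph 6).IsIndContained G)
    (h₇ : (SimpleGraph.cycleGraph 7).IsIndContained G) (hM : IsAdjListOf G M)
    (hB : P.B = M (n + 2)) (hs₀ : s.v 0 = n) (ha : ∀ j i, s.a j i = 0) (hinp : s.inp = M)
    (hVn : 100 * n + 100 ≤ P.V) :
    Runs P colorCmd s ((n + 1) * (peelCost + 10000) + 2000 * G.edgeSet.ncard + 3000000)
      fun s' => IsOptimalColoringOf G s'.inp := by
  have hend := hM.le_end
  have hsum := hM.sum_adjCount
  have hT₁ : ∑ v ∈ Finset.range n, (adjCount M v * 100 + 100) + 100 =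
      200 * G.edgeSet.ncard + 100 * n + 100 := by
    rw [Finset.sum_add_distrib, ← Finset.sum_mul, hsum]; simp; omega
  have hT₂ : ∑ v ∈ Finset.range n, (adjCount M v * 600 + 2400) + 100 =
      1200 * G.edgeSet.ncard + 2400 * n + 100 := by
    rw [Finset.sum_add_distrib, ← Finset.sum_mul, hsum]; simp; omega
  have hcount : 4 ^ 13 * 231000 + 100 ≤ peelCost := by unfold peelCost; norm_num
  rw [show (n + 1) * (peelCost + 10000) = n * peelCost + 10000 * n + peelCost + 10000 by ring]
  simp only [colorCmd, block]
  refine Runs.cut _ _ ?_ (runs_adjacencyCmd hM hB hs₀ (ha 0) hinp) fun s₁ f₁ t₁ => ?_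
  · rw [hT₁]; omega
  rw [hT₁]
  have a₂ : ∀ i, s₁.a 2 i = 0 := by rw [f₁.a 2 (by decide)]; exact ha 2
  have i₁ : s₁.inp = M := (f₁.inp (by decide)).trans hinp
  have n₁ : s₁.v 0 = n := (f₁.v 0 (by decide)).trans hs₀
  refine Runs.cut _ _ ?_ (runs_classesCmd h₁ h₄ h₆ h₇ hM hB n₁ t₁ a₂ i₁ (by omega)) fun s₂ f₂ c₂ => ?_
  · rw [hT₂]; omega
  rw [hT₂]
  refine Runs.cut _ _ ?_ (runs_triplesCmd c₂ (by omega)) fun s₃ f₃ t₃ => ?_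
  · omega
  have c₃ : HasClasses G s₃ := c₂.congr (f₃.v _ (by decide)) (f₃.v _ (by decide))
    (f₃.a _ (by decide)) (f₃.a _ (by decide)) (f₃.a _ (by decide)) (f₃.a _ (by decide))
    (f₃.a _ (by decide))
  -- Giving every vertex its own color shows that the computed number of colors is at most `n`,
  -- which bounds the number of rounds.
  have H := c₃.countingBound h₁ G.selfColoring
  have hw₃ : ∀ i < s₃.v 1, s₃.a 2 i ≤ n := fun i hi => c₃.le_order hi
  refine Runs.cut (4 ^ 13 * 231000 + 100) _ (by omega) (runs_countCmd t₃ c₃.le hw₃ (by omega) H)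
    fun s₄ f₄ ⟨q₁, q₂⟩ => ?_
  have hq := q₂ n H
  have t₄ := t₃.frame f₄ (by decide) (by decide)
  have v₄ : s₄.v 1 = s₃.v 1 := f₄.v _ (by decide)
  have x₁ : s₄.a 1 = s₃.a 1 := f₄.a _ (by decide)
  have x₂ : s₄.a 2 = s₃.a 2 := f₄.a _ (by decide)
  have hpeel := Nat.mul_le_mul_right peelCost hq
  refine Runs.cut (n * peelCost + 100) _ (by omega) (Runs.mono (runs_peelCmd h₁ h₄ h₆ h₇ t₄ ?_ ?_ ?_
    (by omega) ?_) (by omega) fun _ h => h) fun s₅ f₅ ⟨p₁, p₂⟩ => ?_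
  · rw [v₄, x₁]; exact c₃.rep
  · rw [v₄, x₂]; exact hw₃
  · rw [v₄, x₂, c₃.top]; omega
  · rw [v₄, x₁, x₂]; exact q₁
  have n₅ : s₅.v 0 = n := (f₅.v 0 (by decide)).trans ((f₄.v 0 (by decide)).trans c₃.order)
  refine (runs_outputCmd n₅ (by omega)).mono (by omega) fun s₆ ⟨h₀, h₆⟩ => ?_
  rw [v₄, x₁] at p₁
  rw [v₄, x₁, x₂] at p₂
  refine c₃.isOptimalColoringOf h₁ q₂ p₁ p₂ (h₀.trans (f₅.v 5 (by decide))) fun u hu => ?_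
  rw [h₆ u hu, f₅.a 3 (by decide), f₅.a 4 (by decide), f₄.a 3 (by decide), f₄.a 4 (by decide)]

/-- Read the number of vertices and the end of the adjacency lists. -/
def startProgram : Program :=
  .seq (.assign 0 (.load 3)) <| .seq (.assign 3 (.const 2)) <| .seq (.assign 3 (.add 3 0))
    (.assign 1 (.load 3))

/-- Register 3 is zero at first, so the first load reads `n` from cell `0`. The arrays begin
directly behind the adjacency lists, where all cells hold zero. -/
theorem exec_startProgram (hM : IsAdjListOf G M) (hB : P.B = M (n + 2)) :
    ∃ τ, Exec P.W startProgram ⟨fun _ => 0, M⟩ τ 4 ∧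
      Rep P ⟨fun x => if x = 0 then n else 0, fun _ _ => 0, M⟩ τ := by
  have hend := hM.le_end
  have hVW : P.V < P.W := by simpa using P.lt_W (p := 1) (x := P.V) (by simp) (by omega)
  have h₁ := P.hB
  have h₂ := P.hV
  refine ⟨_, Exec.seq (s := 1) (Exec.assign _ _ _ ?_) (Exec.seq (s := 1) (Exec.assign _ _ _ ?_)
    (Exec.seq (s := 1) (t := 1) (Exec.assign _ _ _ ?_) (Exec.assign _ _ _ ?_))), ?_⟩
  · simp [Expr.eval, hM.order]; omega
  · simp [Expr.eval]; omega
  · simp [Expr.eval, hM.order]; omega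
  · simp [Expr.eval, hM.order, add_comm 2 n, ← hB]; omega
  · constructor
    · simp [Expr.eval, hM.order, add_comm 2 n, hB]
    · intro x
      have e₁ : 2 * x ≠ 1 := by omega
      have e₃ : 2 * x ≠ 3 := by omega
      by_cases hx : x = 0
      · subst hx; simp [Expr.eval, hM.order]
      · have e₀ : 2 * x ≠ 0 := by omega
        simp [e₁, e₃, hx]
    · intro j _ i
      exact hM.rest _ (by rw [hB]; omega)
    · intro i _
      rfl

end RAM

theorem mainTheorem2 :
    ∃ (P : RAM.Program) (c : ℕ), ∀ (n : ℕ) (G : SimpleGraph (Fin n)),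
      ¬ (⊥ : SimpleGraph (Fin 4)).IsIndContained G →
      ¬ (SimpleGraph.cycleGraph 4).IsIndContained G →
      ¬ (SimpleGraph.cycleGraph 6).IsIndContained G →
      (SimpleGraph.cycleGraph 7).IsIndContained G →
      ∀ M : ℕ → ℕ, IsAdjListOf G M →
        ColorsWithin P G M ((n + G.edgeSet.ncard + 2) ^ c)
          (13 ^ 13 * (n + G.edgeSet.ncard)) := by
  -- Values are bounded by `V = N ^ 9` and words must exceed `V ^ 40 = N ^ 360`, hence the exponent
  -- 361.
  refine ⟨.seq RAM.startProgram RAM.colorCmd.compile, 361, fun n G h₁ h₄ h₆ h₇ M hM => ?_⟩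
  have hn : 7 ≤ n := by
    obtain ⟨f⟩ := h₇
    simpa using Fintype.card_le_of_injective f f.injective
  generalize hm : G.edgeSet.ncard = m
  have hend := hM.end_eq
  have hle := hM.le
  rw [hm] at hend hle
  generalize hN : n + m + 2 = N
  -- The seven vertices of the cycle give `N ≥ 9`. So `V` is at least `9 ^ 9 > 100000000`, which
  -- also exceeds `4 ^ 13`, and it dominates the linear bounds needed for `n` and the input cells.
  have hpow : N * 9 ^ 8 ≤ N ^ 9 := by
    rw [pow_succ' N 8]
    exact Nat.mul_le_mul_left _ (Nat.pow_le_pow_left (by omega) 8)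
  let P : RAM.Params := ⟨N ^ 361, M (n + 2), N ^ 9, by omega, by omega, by
    rw [← pow_mul, Nat.pow_lt_pow_iff_right (by omega)]
    norm_num⟩
  have hV : P.V = N ^ 9 := rfl
  obtain ⟨τ, hτ, kτ⟩ := RAM.exec_startProgram (P := P) hM rfl
  obtain ⟨υ, t, s, hυ, ht, kυ, -, -, hs⟩ := RAM.runs_colorCmd (P := P) h₁ h₄ h₆ h₇ hM rfl (by simp)
    (by simp) rfl (by omega) ⟨fun x => by dsimp only; split_ifs <;> omega, fun _ _ => Nat.zero_le _,
      fun i => by have := hle i; dsimp only; omega⟩ τ kτ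
  have hmem : ∀ i < M (n + 2), υ.mem i = s.inp i := kυ.inp
  refine ⟨υ, 4 + t, RAM.Exec.seq hτ hυ, ?_, ?_⟩
  -- Because `n ≥ 7`, the additive constants and the factor `n + 1` are absorbed by the gap between
  -- `peelCost` and `13 ^ 13`.
  · rw [hm] at ht
    unfold RAM.peelCost at ht
    omega
  · refine ⟨?_, fun v => ?_, fun u v huv => ?_⟩
    · rw [hmem 0 (by omega)]; exact hs.chromatic
    · rw [hmem 0 (by omega), hmem _ (by omega)]; exact hs.range v
    · rw [hmem _ (by omega), hmem _ (by omega)]; exact hs.proper u v huv
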